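/- Let $k$ be a field of characteristic $0$. All modules are $\mathbb Z$-graded (homologically) and the Koszul sign rule is in force. **Data.** Let $(E,R)$ be quadratic-linear data: $E$ is a graded $\mathbb S$-module with $E(0)=0$ and $E(n)$ finite dimensional for all $n\ge 1$, and $R\subseteq E\oplus\mathcal T(E)^{(2)}$ is a graded sub-$\mathbb S$-module of the free operad satisfying the usual conditions $R\cap E=0$ and $(R\circ_{(1)}E+E\circ_{(1)}R)\cap\mathcal T(E)^{(2)}\subseteq R$. Let $qR$ be the projection of $R$ to $\mathcal T(E)^{(2)}$, so that $R=\{y-\varphi(y): y\in qR\}$ for a map $\varphi:qR\to E$. The Koszul dual operad is $\mathcal P^!=\mathcal T(E^\vee)/((qR)^\perp)$ with $E^\vee=s^{-1}\mathrm{End}_{ks^{-1}}\otimes_{\mathrm H}E^*$, that is $E^\vee(n)_p=(E(n)_{n-2-p})^*\otimes\mathrm{sgn}_n$; it carries the derivation $d$ of degree $-1$ which on generators is the transpose of $\varphi$. It is weight graded, $E^\vee$ having weight $1$. **Unital extension.** Let $\chi:E^\vee(2)\to k$ be an $\mathbb S_2$-invariant linear form of degree $0$. The operad $u_\chi\mathcal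 P^!$ is obtained from $\mathcal P^!$ by adjoining a generator $u$ of arity $0$, degree $0$ (and weight $-1$) subject to $\mu\circ_1u=\mu\circ_2u=\chi(\mu)\,\mathrm{id}$ for $\mu\in E^\vee(2)$ and $\mu\circ_iu=0$ for $\mu\in E^\vee(n)$, $n\neq2$. Assume that the canonical map $\iota:\mathcal P^!\to u_\chi\mathcal P^!$ is injective, and that $d$ extends along $\iota$ to a derivation $d'$ of degree $-1$ of $u_\chi\mathcal P^!$ (this is automatic when $R$ is homogeneous quadratic, where $d=d'=0$). **Convolution algebras.** Let $A$ be a complete graded $k$-module: $A=\bigoplus_pA_p$ with a decreasing filtration $A=F_0A\supseteq F_1A\supseteq\cdots$ by graded submodules such that $A_p\cong\lim_m A_p/F_mA_p$ for all $p$. For $\mathcal O=\mathcal P^!$ or $u_\chi\mathcal P^!$ let $\mathcal O^*$ be its weight-graded linear dual, with its infinitesimal decomposition maps $\Delta_{(1)}$ and the transposed differential. Then $\hom_{\mathbb S}(\mathcal O^*,\mathrm{End}_A)=\prod_{n\geq 0}\hom_{\mathbb S_n}(\mathcal O^*(n),\mathrm{End}_A(n))$, where $\mathrm{End}_A$ consists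 of the filtration preserving multilinear maps, has the filtration induced by that of $A$, the pre-Lie product $f\star g=\gamma_{(1)}\circ(f\otimes g)\circ\Delta_{(1)}$, the bracket $[f,g]=f\star g-(-1)^{|f||g|}g\star f$ and the map $\partial f=-(-1)^{|f|}f\circ d$. A Maurer–Cartan element is an element $\alpha$ of degree $-1$ with $\partial\alpha+\alpha\star\alpha=0$; the differential of $A$ is part of $\alpha$, namely its value on $\mathrm{id}^*$. A *complete $\mathcal P_\infty$-structure* on $A$ is a Maurer–Cartan element of $\hom_{\mathbb S}((\mathcal P^!)^*,\mathrm{End}_A)$, where $(\mathcal P^!)^*$ is identified with the Koszul dual cooperad $\mathcal P^{¡}$ up to operadic suspension. Restriction along $\iota$ embeds $\hom_{\mathbb S}((\mathcal P^!)^*,\mathrm{End}_A)$ into $\hom_{\mathbb S}((u_\chi\mathcal P^!)^*,\mathrm{End}_A)$; an element of the latter algebra is called a $\mathcal P_\infty$-structure if it is the image of one. **Theorem.** The arity $0$ part of $u_\chi\mathcal P^!$ is spanned by $u\neq0$; let $u^*$ be the dual basis element. Let $\alpha$ be a complete $\mathcal P_\infty$-structure on $A$ and let $a\in F_1A_0$,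 regarded as the element of $\hom_{\mathbb S}((u_\chi\mathcal P^!)^*,\mathrm{End}_A)$ sending $u^*$ to $a$ and vanishing in positive arities. Then the gauge action $$a.\alpha=e^{\mathrm{ad}_a}(\alpha)=\sum_{n\ge0}\frac1{n!}\mathrm{ad}_a^n(\alpha)-\sum_{n\ge0}\frac1{(n+1)!}\mathrm{ad}_a^n(\partial a)$$ converges to a unique element for the topology of the filtration, $a.\alpha$ is a Maurer–Cartan element of $\hom_{\mathbb S}((u_\chi\mathcal P^!)^*,\mathrm{End}_A)$, and $a.\alpha$ is a $\mathcal P_\infty$-structure if and only if its arity $0$ part vanishes: $$(a.\alpha)(u^*)=0 .$$ -/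

import Mathlib

open scoped DirectSum TensorProduct

universe u v w

set_option linter.unusedSimpArgs false

noncomputable section

namespace OperadTwist

/-! ## Operads

Operads are written in the partial (infinitesimal) form, with inputs labelled by arbitrary finite
sets: `obj I` is the space of operations with inputs labelled by `I`; `map σ` relabels inputs;
`comp μ ν` grafts `ν`, with inputs `J`, at the input `none` of `μ`, whose inputs are `Option K`.
The `n`-ary operations with their action of the symmetric group are `obj (Fin n)`. All signs follow
the Koszul rule; `deg` is the homological degree and `wt` is a weight. -/

/-- Identify `(K ⊔ {*}) ⊔ J` with `(K ⊔ J) ⊔ {*}`. -/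
def optLeft (K J : Type) : Option K ⊕ J ≃ Option (K ⊕ J) where
  toFun x := match x with
    | .inl none => none
    | .inl (some i) => some (.inl i)
    | .inr j => some (.inr j)
  invFun x := match x with
    | none => .inl none
    | some (.inl i) => .inl (some i)
    | some (.inr j) => .inr j
  left_inv := by rintro ((_ | _) | _) <;> rfl
  right_inv := by rintro (_ | (_ | _)) <;> rfl

/-- Identify `K ⊔ (J ⊔ {*})` with `(K ⊔ J) ⊔ {*}`. -/
def optRight (K J : Type) : K ⊕ Option J ≃ Option (K ⊕ J) where
  toFun x := match x with
    | .inl i => some (.inl i)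
    | .inr none => none
    | .inr (some j) => some (.inr j)
  invFun x := match x with
    | none => .inr none
    | some (.inl i) => .inl i
    | some (.inr j) => .inr (some j)
  left_inv := by rintro (_ | (_ | _)) <;> rfl
  right_inv := by rintro (_ | (_ | _)) <;> rfl

/-- Exchange the two added points of `(K ⊔ {*'}) ⊔ {*}`. -/
def optSwap (K : Type) : Option (Option K) ≃ Option (Option K) where
  toFun x := match x with
    | none => some none
    | some none => none
    | some (some i) => some (some i)
  invFun x := match x with
    | none => some none
    | some none => none
    | some (some i) => some (some i)
  left_inv := by rintro (_ | (_ | _)) <;> rfl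
  right_inv := by rintro (_ | (_ | _)) <;> rfl

/-- Grafting the identity at `*` sends the label `*` to the only input of the identity. -/
def optUnit (K : Type) : Option K ≃ K ⊕ Option Empty where
  toFun x := match x with
    | none => .inr none
    | some i => .inl i
  invFun x := match x with
    | .inl i => some i
    | .inr _ => none
  left_inv := by rintro (_ | _) <;> rfl
  right_inv := by rintro (_ | (_ | x)) <;> first | rfl | exact x.elim

/-- Identify `(K ⊔ L) ⊔ J` with `(K ⊔ J) ⊔ L`. -/
def sumSwap (K L J : Type) : (K ⊕ L) ⊕ J ≃ (K ⊕ J) ⊕ L where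
  toFun x := match x with
    | .inl (.inl i) => .inl (.inl i)
    | .inl (.inr l) => .inr l
    | .inr j => .inl (.inr j)
  invFun x := match x with
    | .inl (.inl i) => .inl (.inl i)
    | .inl (.inr j) => .inr j
    | .inr l => .inl (.inr l)
  left_inv := by rintro ((_ | _) | _) <;> rfl
  right_inv := by rintro ((_ | _) | _) <;> rfl

/-- A symmetric operad in graded `k`-vector spaces, equipped moreover with a weight. -/
structure GradedOperad (k : Type u) [Field k] where
  obj : Type → Type w
  [addCommGroup : ∀ I, AddCommGroup (obj I)]
  [module : ∀ I, Module k (obj I)]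
  deg : ∀ I, ℤ → Submodule k (obj I)
  wt : ∀ I, ℤ → Submodule k (obj I)
  map : ∀ {I J : Type}, (I ≃ J) → obj I →ₗ[k] obj J
  one : obj (Option Empty)
  comp : ∀ {K J : Type}, obj (Option K) →ₗ[k] obj J →ₗ[k] obj (K ⊕ J)
  map_refl : ∀ {I : Type} (x : obj I), map (Equiv.refl I) x = x
  map_trans : ∀ {I J L : Type} (σ : I ≃ J) (τ : J ≃ L) (x : obj I),
    map (σ.trans τ) x = map τ (map σ x)
  comp_map : ∀ {K K' J J' : Type} (σ : K ≃ K') (τ : J ≃ J') (x : obj (Option K)) (y : obj J),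
    comp (map (Equiv.optionCongr σ) x) (map τ y) = map (Equiv.sumCongr σ τ) (comp x y)
  one_comp : ∀ {J : Type} (y : obj J), comp one y = map (Equiv.emptySum Empty J).symm y
  comp_one : ∀ {K : Type} (x : obj (Option K)), comp x one = map (optUnit K) x
  /-- sequential composition -/
  comp_assoc : ∀ {K J L : Type} (x : obj (Option K)) (y : obj (Option J)) (z : obj L),
    comp (map (optRight K J) (comp x y)) z = map (Equiv.sumAssoc K J L).symm (comp x (comp y z))
  /-- parallel composition -/
  comp_comm : ∀ {K J L : Type} (p q : ℤ) (x : obj (Option (Option K))) (y : obj J) (z : obj L),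
    y ∈ deg J p → z ∈ deg L q →
    comp (map (optLeft K J) (comp x y)) z =
      (p * q).negOnePow • map (sumSwap K L J)
        (comp (map (optLeft K L) (comp (map (optSwap K) x) z)) y)
  deg_map : ∀ {I J : Type} (σ : I ≃ J) (p : ℤ) (x : obj I), x ∈ deg I p → map σ x ∈ deg J p
  wt_map : ∀ {I J : Type} (σ : I ≃ J) (p : ℤ) (x : obj I), x ∈ wt I p → map σ x ∈ wt J p
  deg_one : one ∈ deg _ 0
  wt_one : one ∈ wt _ 0
  deg_comp : ∀ {K J : Type} (p q : ℤ) (x : obj (Option K)) (y : obj J),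
    x ∈ deg _ p → y ∈ deg _ q → comp x y ∈ deg _ (p + q)
  wt_comp : ∀ {K J : Type} (p q : ℤ) (x : obj (Option K)) (y : obj J),
    x ∈ wt _ p → y ∈ wt _ q → comp x y ∈ wt _ (p + q)

attribute [instance] GradedOperad.addCommGroup GradedOperad.module

/-- The order preserving labelling of a two-level tree: the inputs `S` belong to the upper vertex,
the remaining ones to the lower vertex. -/
def splitEquiv {n : ℕ} (S : Finset (Fin n)) : Fin Sᶜ.card ⊕ Fin S.card ≃ Fin n :=
  (Equiv.sumComm _ _).trans (finSumEquivOfFinset rfl rfl)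

/-- Partial composition `μ ∘_S ν` in skeletal form: `ν` is grafted at the first input of `μ`, the
inputs of `ν` are labelled by `S` and the other inputs of `μ` by the complement of `S`, both in
increasing order. Together with the symmetric groups these are all partial compositions. -/
def GradedOperad.graft {k : Type u} [Field k] (O : GradedOperad.{u, w} k) {n : ℕ}
    (S : Finset (Fin n)) :
    O.obj (Fin (Sᶜ.card + 1)) →ₗ[k] O.obj (Fin S.card) →ₗ[k] O.obj (Fin n) :=
  ((O.comp (K := Fin Sᶜ.card) (J := Fin S.card)).compr₂ (O.map (splitEquiv S))).comp
    (O.map (finSuccEquiv Sᶜ.card))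

/-- A derivation of degree `-1` of the operad `O` which raises the weight by one. -/
structure OperadDerivation {k : Type u} [Field k] (O : GradedOperad.{u, w} k) where
  toFun : ∀ I, O.obj I →ₗ[k] O.obj I
  map : ∀ {I J : Type} (σ : I ≃ J) (x : O.obj I), toFun J (O.map σ x) = O.map σ (toFun I x)
  leibniz : ∀ {K J : Type} (p : ℤ) (x : O.obj (Option K)) (y : O.obj J), x ∈ O.deg _ p →
    toFun _ (O.comp x y) = O.comp (toFun _ x) y + p.negOnePow • O.comp x (toFun _ y)
  deg : ∀ (I : Type) (p : ℤ) (x : O.obj I), x ∈ O.deg I p → toFun I x ∈ O.deg I (p - 1)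
  wt : ∀ (I : Type) (p : ℤ) (x : O.obj I), x ∈ O.wt I p → toFun I x ∈ O.wt I (p + 1)

/-! ## Operads presented by generators and relations -/

/-- Operadic monomials in generators `X n` of arity `n`, with inputs labelled by `I`. -/
inductive Mono (X : ℕ → Type v) : Type → Type (max 1 v)
  | one : Mono X (Option Empty)
  | gen {n : ℕ} (x : X n) : Mono X (Fin n)
  | map {I J : Type} (σ : I ≃ J) (a : Mono X I) : Mono X J
  | comp {K J : Type} (a : Mono X (Option K)) (b : Mono X J) : Mono X (K ⊕ J)

/-- The total degree of a monomial, for generators of given degrees. -/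
def Mono.degree {X : ℕ → Type v} (d : ∀ n, X n → ℤ) : ∀ {I : Type}, Mono X I → ℤ
  | _, .one => 0
  | _, .gen x => d _ x
  | _, .map _ a => a.degree d
  | _, .comp a b => a.degree d + b.degree d

/-- Substitution of generators in a monomial. -/
def Mono.subst {X : ℕ → Type v} {Y : ℕ → Type w} (f : ∀ n, X n → Y n) :
    ∀ {I : Type}, Mono X I → Mono Y I
  | _, .one => .one
  | _, .gen x => .gen (f _ x)
  | _, .map σ a => .map σ (a.subst f)
  | _, .comp a b => .comp (a.subst f) (b.subst f)

/-- Generators with degree and weight, and linear combinations of monomials imposed to vanish. -/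
structure Presentation (k : Type u) [Field k] where
  X : ℕ → Type v
  dg : ∀ n, X n → ℤ
  wg : ∀ n, X n → ℤ
  rel : ∀ I : Type, (Mono X I →₀ k) → Prop

namespace Presentation

variable {k : Type u} [Field k] (Q : Presentation.{u, v} k)

/-- The congruence generated by the axioms of operads and by the given relations. -/
inductive InIdeal : ∀ {I : Type}, (Mono Q.X I →₀ k) → Prop
  | rel {I : Type} {x : Mono Q.X I →₀ k} : Q.rel I x → InIdeal x
  | zero {I : Type} : InIdeal (0 : Mono Q.X I →₀ k)
  | add {I : Type} {x y : Mono Q.X I →₀ k} : InIdeal x → InIdeal y → InIdeal (x + y)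
  | smul {I : Type} (c : k) {x : Mono Q.X I →₀ k} : InIdeal x → InIdeal (c • x)
  | map {I J : Type} (σ : I ≃ J) {x : Mono Q.X I →₀ k} :
      InIdeal x → InIdeal (x.mapDomain (Mono.map σ))
  | compLeft {K J : Type} {x : Mono Q.X (Option K) →₀ k} (b : Mono Q.X J) :
      InIdeal x → InIdeal (x.mapDomain (fun a => Mono.comp a b))
  | compRight {K J : Type} (a : Mono Q.X (Option K)) {x : Mono Q.X J →₀ k} :
      InIdeal x → InIdeal (x.mapDomain (Mono.comp a))
  | map_refl {I : Type} (a : Mono Q.X I) :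
      InIdeal (.single (.map (Equiv.refl I) a) 1 - .single a 1)
  | map_trans {I J L : Type} (σ : I ≃ J) (τ : J ≃ L) (a : Mono Q.X I) :
      InIdeal (.single (.map (σ.trans τ) a) 1 - .single (.map τ (.map σ a)) 1)
  | comp_map {K K' J J' : Type} (σ : K ≃ K') (τ : J ≃ J') (a : Mono Q.X (Option K))
      (b : Mono Q.X J) :
      InIdeal (.single (.comp (.map (Equiv.optionCongr σ) a) (.map τ b)) 1
        - .single (.map (Equiv.sumCongr σ τ) (.comp a b)) 1)
  | one_comp {J : Type} (b : Mono Q.X J) :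
      InIdeal (.single (.comp .one b) 1 - .single (.map (Equiv.emptySum Empty J).symm b) 1)
  | comp_one {K : Type} (a : Mono Q.X (Option K)) :
      InIdeal (.single (.comp a .one) 1 - .single (.map (optUnit K) a) 1)
  | comp_assoc {K J L : Type} (a : Mono Q.X (Option K)) (b : Mono Q.X (Option J))
      (c : Mono Q.X L) :
      InIdeal (.single (.comp (.map (optRight K J) (.comp a b)) c) 1
        - .single (.map (Equiv.sumAssoc K J L).symm (.comp a (.comp b c))) 1)
  | comp_comm {K J L : Type} (a : Mono Q.X (Option (Option K))) (b : Mono Q.X J)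
      (c : Mono Q.X L) :
      InIdeal (.single (.comp (.map (optLeft K J) (.comp a b)) c) 1
        - (b.degree Q.dg * c.degree Q.dg).negOnePow • .single (.map (sumSwap K L J)
            (.comp (.map (optLeft K L) (.comp (.map (optSwap K) a) c)) b)) 1)

/-- `InIdeal` as a family of subspaces. -/
def ideal (I : Type) : Submodule k (Mono Q.X I →₀ k) where
  carrier := {x | Q.InIdeal x}
  add_mem' := .add
  zero_mem' := .zero
  smul_mem' c _ h := .smul c h

/-- Operations of the presented operad. -/
abbrev Obj (I : Type) : Type (max u v 1) := (Mono Q.X I →₀ k) ⧸ Q.ideal I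

variable {Q} in
/-- The class of a monomial. -/
def mono {I : Type} (a : Mono Q.X I) : Q.Obj I := (Q.ideal I).mkQ (.single a 1)

variable {Q} in
theorem obj_induction {I : Type} {p : Q.Obj I → Prop} (x : Q.Obj I) (hm : ∀ a, p (mono a))
    (h0 : p 0) (ha : ∀ x y, p x → p y → p (x + y)) (hs : ∀ (c : k) x, p x → p (c • x)) : p x := by
  obtain ⟨f, rfl⟩ := (Q.ideal I).mkQ_surjective x
  induction f using Finsupp.induction_linear with
  | zero => simpa using h0
  | add f g hf hg => rw [map_add]; exact ha _ _ hf hg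
  | single a c =>
    have : (Finsupp.single a c : Mono Q.X I →₀ k) = c • Finsupp.single a 1 := by simp
    rw [this, map_smul]
    exact hs _ _ (hm a)

/-- Relabelling. -/
def mapQ {I J : Type} (σ : I ≃ J) : Q.Obj I →ₗ[k] Q.Obj J :=
  (Q.ideal I).mapQ (Q.ideal J) (Finsupp.lmapDomain k k (Mono.map σ)) fun _ h => .map σ h

/-- Grafting on a fixed monomial. -/
def compMono {K J : Type} (a : Mono Q.X (Option K)) : Q.Obj J →ₗ[k] Q.Obj (K ⊕ J) :=
  (Q.ideal J).mapQ (Q.ideal (K ⊕ J)) (Finsupp.lmapDomain k k (Mono.comp a))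
    fun _ h => .compRight a h

@[simp] theorem mapQ_mono {I J : Type} (σ : I ≃ J) (a : Mono Q.X I) :
    Q.mapQ σ (mono a) = mono (.map σ a) := by
  change (Q.ideal J).mkQ (Finsupp.mapDomain _ _) = _
  rw [Finsupp.mapDomain_single]
  rfl

@[simp] theorem compMono_mono {K J : Type} (a : Mono Q.X (Option K)) (b : Mono Q.X J) :
    Q.compMono a (mono b) = mono (.comp a b) := by
  change (Q.ideal (K ⊕ J)).mkQ (Finsupp.mapDomain _ _) = _
  rw [Finsupp.mapDomain_single]
  rfl

/-- Partial composition. -/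
def compQ {K J : Type} : Q.Obj (Option K) →ₗ[k] Q.Obj J →ₗ[k] Q.Obj (K ⊕ J) :=
  (Q.ideal (Option K)).liftQ (Finsupp.linearCombination k (fun a => Q.compMono (J := J) a)) (by
    intro x hx
    rw [LinearMap.mem_ker]
    ext b
    have key : ∀ f : Mono Q.X (Option K) →₀ k,
        Finsupp.linearCombination k (fun a => Q.compMono (J := J) a) f (mono b) =
          (Q.ideal (K ⊕ J)).mkQ (f.mapDomain (fun a => Mono.comp a b)) := by
      intro f
      induction f using Finsupp.induction_linear with
      | zero => simp
      | add f g hf hg => rw [map_add, LinearMap.add_apply, hf, hg, Finsupp.mapDomain_add, map_add]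
      | single a c =>
        have : (Finsupp.single (Mono.comp a b) c : Mono Q.X (K ⊕ J) →₀ k)
          = c • Finsupp.single (Mono.comp a b) 1 := by simp
        rw [Finsupp.mapDomain_single, this, map_smul, Finsupp.linearCombination_single,
          LinearMap.smul_apply, compMono_mono]
        rfl
    exact (key x).trans ((Submodule.Quotient.mk_eq_zero _).2 (InIdeal.compLeft b hx)))

@[simp] theorem compQ_mono {K J : Type} (a : Mono Q.X (Option K)) (b : Mono Q.X J) :
    Q.compQ (mono a) (mono b) = mono (.comp a b) := by
  rw [← compMono_mono]
  change Finsupp.linearCombination k (fun a => Q.compMono (J := J) a) (.single a 1) (mono b) = _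
  rw [Finsupp.linearCombination_single, one_smul]

theorem mono_eq {I : Type} {a b : Mono Q.X I}
    (h : Q.InIdeal (.single a 1 - .single b 1)) : (mono a : Q.Obj I) = mono b :=
  (Submodule.Quotient.eq _).2 h

/-- The operad presented by generators and relations. -/
def operad : GradedOperad.{u, max u v 1} k where
  obj := Q.Obj
  deg I p := Submodule.span k {x | ∃ a : Mono Q.X I, a.degree Q.dg = p ∧ x = mono a}
  wt I p := Submodule.span k {x | ∃ a : Mono Q.X I, a.degree Q.wg = p ∧ x = mono a}
  map := Q.mapQ
  one := mono .one
  comp := Q.compQ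
  map_refl x := by
    induction x using obj_induction with
    | hm a => simpa using Q.mono_eq (.map_refl a)
    | h0 => simp only [map_zero, LinearMap.zero_apply]
    | ha x y hx hy => simp only [map_add, LinearMap.add_apply, hx, hy]
    | hs c x hx => simp only [map_smul, LinearMap.smul_apply, hx]
  map_trans σ τ x := by
    induction x using obj_induction with
    | hm a => simpa using Q.mono_eq (.map_trans σ τ a)
    | h0 => simp only [map_zero, LinearMap.zero_apply]
    | ha x y hx hy => simp only [map_add, LinearMap.add_apply, hx, hy]
    | hs c x hx => simp only [map_smul, LinearMap.smul_apply, hx]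
  comp_map σ τ x y := by
    induction x using obj_induction with
    | hm a =>
      induction y using obj_induction with
      | hm b => simpa using Q.mono_eq (.comp_map σ τ a b)
      | h0 => simp only [map_zero, LinearMap.zero_apply]
      | ha x y hx hy => simp only [map_add, LinearMap.add_apply, hx, hy]
      | hs c x hx => simp only [map_smul, LinearMap.smul_apply, hx]
    | h0 => simp only [map_zero, LinearMap.zero_apply]
    | ha x y hx hy => simp only [map_add, LinearMap.add_apply, hx, hy]
    | hs c x hx => simp only [map_smul, LinearMap.smul_apply, hx]
  one_comp y := by
    induction y using obj_induction with
    | hm b => simpa using Q.mono_eq (.one_comp b)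
    | h0 => simp only [map_zero, LinearMap.zero_apply]
    | ha x y hx hy => simp only [map_add, LinearMap.add_apply, hx, hy]
    | hs c x hx => simp only [map_smul, LinearMap.smul_apply, hx]
  comp_one x := by
    induction x using obj_induction with
    | hm b => simpa using Q.mono_eq (.comp_one b)
    | h0 => simp only [map_zero, LinearMap.zero_apply]
    | ha x y hx hy => simp only [map_add, LinearMap.add_apply, hx, hy]
    | hs c x hx => simp only [map_smul, LinearMap.smul_apply, hx]
  comp_assoc x y z := by
    induction x using obj_induction with
    | hm a =>
      induction y using obj_induction with
      | hm b =>
        induction z using obj_induction with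
        | hm c => simpa using Q.mono_eq (.comp_assoc a b c)
        | h0 => simp only [map_zero, LinearMap.zero_apply]
        | ha x y hx hy => simp only [map_add, LinearMap.add_apply, hx, hy]
        | hs c x hx => simp only [map_smul, LinearMap.smul_apply, hx]
      | h0 => simp only [map_zero, LinearMap.zero_apply]
      | ha x y hx hy => simp only [map_add, LinearMap.add_apply, hx, hy]
      | hs c x hx => simp only [map_smul, LinearMap.smul_apply, hx]
    | h0 => simp only [map_zero, LinearMap.zero_apply]
    | ha x y hx hy => simp only [map_add, LinearMap.add_apply, hx, hy]
    | hs c x hx => simp only [map_smul, LinearMap.smul_apply, hx]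
  comp_comm {K J L} p q x y z hy hz := by
    induction hy using Submodule.span_induction with
    | mem y hy =>
      obtain ⟨b, rfl, rfl⟩ := hy
      induction hz using Submodule.span_induction with
      | mem z hz =>
        obtain ⟨c, rfl, rfl⟩ := hz
        induction x using obj_induction with
        | hm a =>
          have h := (Submodule.Quotient.eq (Q.ideal _)).2
            (show _ - _ ∈ Q.ideal _ from InIdeal.comp_comm a b c)
          simp only [compQ_mono, mapQ_mono]
          refine h.trans ?_
          rcases Int.even_or_odd (b.degree Q.dg * c.degree Q.dg) with e | e
          · rw [Int.negOnePow_even _ e, one_smul, one_smul]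
            rfl
          · rw [Int.negOnePow_odd _ e, Units.neg_smul, Units.neg_smul, one_smul, one_smul]
            rfl
        | h0 => simp only [map_zero, LinearMap.zero_apply, smul_zero]
        | ha x y hx hy => simp only [map_add, LinearMap.add_apply, hx, hy, smul_add]
        | hs c x hx =>
          simp only [map_smul, LinearMap.smul_apply, hx]
          exact smul_comm _ _ _
      | zero => simp only [map_zero, LinearMap.zero_apply, smul_zero]
      | add x y _ _ hx hy => simp only [map_add, LinearMap.add_apply, hx, hy, smul_add]
      | smul c x _ hx =>
        simp only [map_smul, LinearMap.smul_apply, hx]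
        exact smul_comm _ _ _
    | zero => simp only [map_zero, LinearMap.zero_apply, smul_zero]
    | add x y _ _ hx hy => simp only [map_add, LinearMap.add_apply, hx, hy, smul_add]
    | smul c x _ hx =>
      simp only [map_smul, LinearMap.smul_apply, hx]
      exact smul_comm _ _ _
  deg_map σ p x hx := by
    induction hx using Submodule.span_induction with
    | mem x hx =>
      obtain ⟨a, rfl, rfl⟩ := hx
      exact Submodule.subset_span ⟨.map σ a, by simp [Mono.degree]⟩
    | zero => simp
    | add x y _ _ hx hy => rw [map_add]; exact add_mem hx hy
    | smul c x _ hx => rw [map_smul]; exact Submodule.smul_mem _ _ hx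
  wt_map σ p x hx := by
    induction hx using Submodule.span_induction with
    | mem x hx =>
      obtain ⟨a, rfl, rfl⟩ := hx
      exact Submodule.subset_span ⟨.map σ a, by simp [Mono.degree]⟩
    | zero => simp
    | add x y _ _ hx hy => rw [map_add]; exact add_mem hx hy
    | smul c x _ hx => rw [map_smul]; exact Submodule.smul_mem _ _ hx
  deg_one := Submodule.subset_span ⟨_, rfl, rfl⟩
  wt_one := Submodule.subset_span ⟨_, rfl, rfl⟩
  deg_comp p q x y hx hy := by
    induction hx using Submodule.span_induction with
    | mem x hx =>
      obtain ⟨a, rfl, rfl⟩ := hx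
      induction hy using Submodule.span_induction with
      | mem y hy =>
        obtain ⟨b, rfl, rfl⟩ := hy
        exact Submodule.subset_span ⟨.comp a b, by simp [Mono.degree]⟩
      | zero => simp
      | add x y _ _ hx hy => rw [map_add]; exact add_mem hx hy
      | smul c x _ hx => rw [map_smul]; exact Submodule.smul_mem _ _ hx
    | zero => simp
    | add x y _ _ hx hy => rw [map_add, LinearMap.add_apply]; exact add_mem hx hy
    | smul c x _ hx => rw [map_smul, LinearMap.smul_apply]; exact Submodule.smul_mem _ _ hx
  wt_comp p q x y hx hy := by
    induction hx using Submodule.span_induction with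
    | mem x hx =>
      obtain ⟨a, rfl, rfl⟩ := hx
      induction hy using Submodule.span_induction with
      | mem y hy =>
        obtain ⟨b, rfl, rfl⟩ := hy
        exact Submodule.subset_span ⟨.comp a b, by simp [Mono.degree]⟩
      | zero => simp
      | add x y _ _ hx hy => rw [map_add]; exact add_mem hx hy
      | smul c x _ hx => rw [map_smul]; exact Submodule.smul_mem _ _ hx
    | zero => simp
    | add x y _ _ hx hy => rw [map_add, LinearMap.add_apply]; exact add_mem hx hy
    | smul c x _ hx => rw [map_smul, LinearMap.smul_apply]; exact Submodule.smul_mem _ _ hx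

/-- A substitution of generators which preserves degrees and relations induces a map of operads. -/
theorem InIdeal.subst {Q : Presentation.{u, v} k} {Q' : Presentation.{u, w} k}
    (f : ∀ n, Q.X n → Q'.X n) (hd : ∀ n x, Q'.dg n (f n x) = Q.dg n x)
    (hr : ∀ I x, Q.rel I x → Q'.InIdeal (x.mapDomain (Mono.subst f)))
    {I : Type} {x : Mono Q.X I →₀ k} (h : Q.InIdeal x) :
    Q'.InIdeal (x.mapDomain (Mono.subst f)) := by
  have hdeg : ∀ {I : Type} (a : Mono Q.X I), (a.subst f).degree Q'.dg = a.degree Q.dg := by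
    intro I a
    induction a with
    | one => rfl
    | gen x => exact hd _ x
    | map σ a ih => simpa [Mono.subst, Mono.degree] using ih
    | comp a b iha ihb => simp [Mono.subst, Mono.degree, iha, ihb]
  have hsub : ∀ {I : Type} (x y : Mono Q.X I →₀ k), (x - y).mapDomain (Mono.subst f) =
      x.mapDomain (Mono.subst f) - y.mapDomain (Mono.subst f) :=
    fun {I} x y => map_sub (Finsupp.lmapDomain k k (Mono.subst f (I := I))) x y
  induction h with
  | rel h => exact hr _ _ h
  | zero => simpa using InIdeal.zero
  | add _ _ hx hy => rw [Finsupp.mapDomain_add]; exact hx.add hy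
  | smul c _ hx => rw [Finsupp.mapDomain_smul]; exact hx.smul c
  | map σ _ hx =>
    have := hx.map σ
    rw [← Finsupp.mapDomain_comp] at this ⊢
    exact this
  | compLeft b _ hx =>
    have := hx.compLeft (b.subst f)
    rw [← Finsupp.mapDomain_comp] at this ⊢
    exact this
  | compRight a _ hx =>
    have := hx.compRight (a.subst f)
    rw [← Finsupp.mapDomain_comp] at this ⊢
    exact this
  | map_refl a =>
    simpa only [hsub, Finsupp.mapDomain_single, Mono.subst] using InIdeal.map_refl (a.subst f)
  | map_trans σ τ a =>
    simpa only [hsub, Finsupp.mapDomain_single, Mono.subst] using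
      InIdeal.map_trans σ τ (a.subst f)
  | comp_map σ τ a b =>
    simpa only [hsub, Finsupp.mapDomain_single, Mono.subst] using
      InIdeal.comp_map σ τ (a.subst f) (b.subst f)
  | one_comp b =>
    simpa only [hsub, Finsupp.mapDomain_single, Mono.subst] using InIdeal.one_comp (b.subst f)
  | comp_one a =>
    simpa only [hsub, Finsupp.mapDomain_single, Mono.subst] using InIdeal.comp_one (a.subst f)
  | comp_assoc a b c =>
    simpa only [hsub, Finsupp.mapDomain_single, Mono.subst] using
      InIdeal.comp_assoc (a.subst f) (b.subst f) (c.subst f)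
  | comp_comm a b c =>
    have := InIdeal.comp_comm (a.subst f) (b.subst f) (c.subst f)
    rw [hdeg, hdeg] at this
    rcases Int.even_or_odd (b.degree Q.dg * c.degree Q.dg) with e | e
    · rw [Int.negOnePow_even _ e, one_smul] at this ⊢
      simpa only [hsub, Finsupp.mapDomain_single, Mono.subst] using this
    · rw [Int.negOnePow_odd _ e, Units.neg_smul, one_smul, sub_neg_eq_add] at this ⊢
      simpa only [Finsupp.mapDomain_add, Finsupp.mapDomain_single, Mono.subst] using this

/-- The map of operads induced by a substitution of generators. -/
def substMap (Q : Presentation.{u, v} k) (Q' : Presentation.{u, w} k)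
    (f : ∀ n, Q.X n → Q'.X n) (hd : ∀ n x, Q'.dg n (f n x) = Q.dg n x)
    (hr : ∀ I x, Q.rel I x → Q'.InIdeal (x.mapDomain (Mono.subst f))) (I : Type) :
    Q.operad.obj I →ₗ[k] Q'.operad.obj I :=
  (Q.ideal I).mapQ (Q'.ideal I) (Finsupp.lmapDomain k k (Mono.subst f))
    fun _ h => InIdeal.subst f hd hr h

theorem wt_substMap (Q : Presentation.{u, v} k) (Q' : Presentation.{u, w} k)
    (f : ∀ n, Q.X n → Q'.X n) (hd : ∀ n x, Q'.dg n (f n x) = Q.dg n x)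
    (hr : ∀ I x, Q.rel I x → Q'.InIdeal (x.mapDomain (Mono.subst f)))
    (hw : ∀ n x, Q'.wg n (f n x) = Q.wg n x) (I : Type) (q : ℤ) (x : Q.operad.obj I)
    (hx : x ∈ Q.operad.wt I q) : Q.substMap Q' f hd hr I x ∈ Q'.operad.wt I q := by
  have key : ∀ {I : Type} (a : Mono Q.X I), (a.subst f).degree Q'.wg = a.degree Q.wg := by
    intro I a
    induction a with
    | one => rfl
    | gen x => exact hw _ x
    | map σ a ih => simpa [Mono.subst, Mono.degree] using ih
    | comp a b iha ihb => simp [Mono.subst, Mono.degree, iha, ihb]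
  induction hx using Submodule.span_induction with
  | mem x hx =>
    obtain ⟨a, rfl, rfl⟩ := hx
    have h : Q.substMap Q' f hd hr I (mono a) = mono (a.subst f) := by
      change (Q'.ideal I).mkQ (Finsupp.mapDomain _ _) = _
      rw [Finsupp.mapDomain_single]
      rfl
    rw [h]
    exact Submodule.subset_span (M := Q'.Obj I) ⟨a.subst f, key a, rfl⟩
  | zero => rw [map_zero]; exact zero_mem _
  | add x y _ _ hx hy => rw [map_add]; exact add_mem hx hy
  | smul c x _ hx => rw [map_smul]; exact Submodule.smul_mem _ _ hx

end Presentation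

/-! ## Graded S-modules, operads `P(E, R)` and Koszul dual operads -/

/-- A graded S-module: graded representations of the symmetric groups (left actions, the right
action being `e ^ σ = σ⁻¹ e`). The component of arity `n` and degree `p` is `obj n p`. -/
structure GradedSModule (k : Type u) [Field k] where
  obj : ℕ → ℤ → Type v
  [addCommGroup : ∀ n p, AddCommGroup (obj n p)]
  [module : ∀ n p, Module k (obj n p)]
  act : ∀ n p, Representation k (Equiv.Perm (Fin n)) (obj n p)

attribute [instance] GradedSModule.addCommGroup GradedSModule.module

namespace GradedSModule

variable {k : Type u} [Field k] (E : GradedSModule.{u, v} k)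

/-- Homogeneous elements of arity `n`. -/
abbrev Homog (n : ℕ) : Type v := Σ p : ℤ, E.obj n p

/-- Linearity and equivariance of the generators, together with extra relations. -/
inductive OpRel (extra : ∀ n : ℕ, (Mono E.Homog (Fin n) →₀ k) → Prop) :
    ∀ I : Type, (Mono E.Homog I →₀ k) → Prop
  | add {n : ℕ} {p : ℤ} (e e' : E.obj n p) : OpRel extra (Fin n)
      (.single (.gen ⟨p, e + e'⟩) 1 - (.single (.gen ⟨p, e⟩) 1 + .single (.gen ⟨p, e'⟩) 1))
  | smul {n : ℕ} {p : ℤ} (c : k) (e : E.obj n p) : OpRel extra (Fin n)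
      (.single (.gen ⟨p, c • e⟩) 1 - c • .single (.gen ⟨p, e⟩) 1)
  | act {n : ℕ} {p : ℤ} (σ : Equiv.Perm (Fin n)) (e : E.obj n p) : OpRel extra (Fin n)
      (.single (.gen ⟨p, E.act n p σ e⟩) 1 - .single (.map σ (.gen ⟨p, e⟩)) 1)
  | extra {n : ℕ} {x : Mono E.Homog (Fin n) →₀ k} : extra n x → OpRel extra (Fin n) x

/-- The operad generated by the graded S-module `E` (in weight one) with extra relations. -/
def pres (extra : ∀ n : ℕ, (Mono E.Homog (Fin n) →₀ k) → Prop) : Presentation.{u, v} k where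
  X := E.Homog
  dg _ x := x.1
  wg _ _ := 1
  rel := E.OpRel extra

/-- The generators as elements of the operad. -/
def gen (extra : ∀ n : ℕ, (Mono E.Homog (Fin n) →₀ k) → Prop) (n : ℕ) (p : ℤ) :
    E.obj n p →ₗ[k] (E.pres extra).operad.obj (Fin n) where
  toFun e := Presentation.mono (Q := E.pres extra) (.gen ⟨p, e⟩)
  map_add' e e' := (Submodule.Quotient.eq ((E.pres extra).ideal _)).2
    (show _ - (_ + _) ∈ (E.pres extra).ideal _ from .rel (.add e e'))
  map_smul' c e := (Submodule.Quotient.eq ((E.pres extra).ideal _)).2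
    (show _ - _ • _ ∈ (E.pres extra).ideal _ from .rel (.smul c e))

/-- `E(n)`. -/
abbrev T1 (n : ℕ) : Type v := ⨁ p : ℤ, E.obj n p

/-- The weight two part `T(E)^{(2)}(n)` of the free operad on `E` (with `E(0) = 0`): trees with two
vertices, `S` being the set of inputs of the upper vertex. -/
abbrev T2 (n : ℕ) : Type v :=
  ⨁ i : Finset (Fin n) × ℤ × ℤ, E.obj (i.1ᶜ.card + 1) i.2.1 ⊗[k] E.obj i.1.card i.2.2

/-- `E(n)` inside the operad. -/
def ev1 (extra : ∀ n : ℕ, (Mono E.Homog (Fin n) →₀ k) → Prop) (n : ℕ) :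
    E.T1 n →ₗ[k] (E.pres extra).operad.obj (Fin n) :=
  DirectSum.toModule k ℤ _ fun p => E.gen extra n p

/-- Evaluation of two-vertex trees in the operad. -/
def ev2 (extra : ∀ n : ℕ, (Mono E.Homog (Fin n) →₀ k) → Prop) (n : ℕ) :
    E.T2 n →ₗ[k] (E.pres extra).operad.obj (Fin n) :=
  DirectSum.toModule k _ _ fun i => TensorProduct.lift
    (((E.pres extra).operad.graft i.1).compl₁₂ (E.gen extra _ i.2.1) (E.gen extra _ i.2.2))

/-- No extra relation. -/
def noRel : ∀ n : ℕ, (Mono E.Homog (Fin n) →₀ k) → Prop := fun _ _ => False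

/-- The free operad `T(E)`. -/
abbrev free : GradedOperad.{u, max u v 1} k := (E.pres E.noRel).operad

/-- The relators of `T(E) / (R)`. -/
def relOf (R : ∀ n : ℕ, Submodule k (E.free.obj (Fin n))) :
    ∀ n : ℕ, (Mono E.Homog (Fin n) →₀ k) → Prop :=
  fun n x => ((E.pres E.noRel).ideal (Fin n)).mkQ x ∈ R n

/-- The operad `P(E, R) = T(E) / (R)`. -/
abbrev quot (R : ∀ n : ℕ, Submodule k (E.free.obj (Fin n))) : GradedOperad.{u, max u v 1} k :=
  (E.pres (E.relOf R)).operad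

/-! ### Unital extensions -/

/-- Generators of the unital extension: those of `E` and the nullary element `u`. -/
inductive UGen : ℕ → Type v
  | op {n : ℕ} (x : E.Homog n) : UGen n
  | u : UGen 0

/-- The relations of `P(E, R)`, the relations `μ ∘_i u = χ(μ) id` for `μ ∈ E(2)` (where `χ` vanishes
on the elements of nonzero degree), and the vanishing of the other composites of elements of `E`
with `u`. -/
inductive UnitalRel (extra : ∀ n : ℕ, (Mono E.Homog (Fin n) →₀ k) → Prop)
    (χ : E.obj 2 0 →ₗ[k] k) : ∀ I : Type, (Mono E.UGen I →₀ k) → Prop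
  | base {I : Type} {x : Mono E.Homog I →₀ k} : E.OpRel extra I x →
      UnitalRel extra χ I (x.mapDomain (Mono.subst fun _ => UGen.op))
  | unit (μ : E.obj 2 0) (i : Fin 2) : UnitalRel extra χ (Fin 1 ⊕ Fin 0)
      (.single (.comp (.map (finSuccEquiv' i) (.gen (.op ⟨0, μ⟩))) (.gen .u)) 1
        - χ μ • .single (.map ((Equiv.ofUnique (Option Empty) (Fin 1)).trans
            (Equiv.sumEmpty (Fin 1) (Fin 0)).symm) .one) 1)
  | kill {m : ℕ} {p : ℤ} (h : ¬ (m = 1 ∧ p = 0)) (μ : E.obj (m + 1) p) (i : Fin (m + 1)) :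
      UnitalRel extra χ (Fin m ⊕ Fin 0)
        (.single (.comp (.map (finSuccEquiv' i) (.gen (.op ⟨p, μ⟩))) (.gen .u)) 1)

/-- Presentation of the unital extension. All relations are homogeneous if `u` has degree `0` and
weight `-1`. -/
def unitalPres (R : ∀ n : ℕ, Submodule k (E.free.obj (Fin n))) (χ : E.obj 2 0 →ₗ[k] k) :
    Presentation.{u, v} k where
  X := E.UGen
  dg _ x := match x with
    | .op y => y.1
    | .u => 0
  wg _ x := match x with
    | .op _ => 1
    | .u => -1
  rel := E.UnitalRel (E.relOf R) χ

/-- The unital extension `u_χ P(E, R)`. -/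
abbrev unital (R : ∀ n : ℕ, Submodule k (E.free.obj (Fin n))) (χ : E.obj 2 0 →ₗ[k] k) :
    GradedOperad.{u, max u v 1} k :=
  (E.unitalPres R χ).operad

/-- The element `u` of arity zero. -/
def unitElt (R : ∀ n : ℕ, Submodule k (E.free.obj (Fin n))) (χ : E.obj 2 0 →ₗ[k] k) :
    (E.unital R χ).obj (Fin 0) :=
  Presentation.mono (Q := E.unitalPres R χ) (.gen .u)

/-- The canonical map `P(E, R) → u_χ P(E, R)`. -/
def toUnital (R : ∀ n : ℕ, Submodule k (E.free.obj (Fin n))) (χ : E.obj 2 0 →ₗ[k] k) (I : Type) :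
    (E.quot R).obj I →ₗ[k] (E.unital R χ).obj I :=
  (E.pres (E.relOf R)).substMap (E.unitalPres R χ) (fun _ => UGen.op) (fun _ _ => rfl)
    (fun _ _ h => .rel (.base h)) I

/-! ### Koszul duality -/

/-- `E^∨ = s⁻¹ End_{k s⁻¹} ⊗ E^*`: in arity `n` the linear dual of `E(n)`, twisted by the signature
and of degree shifted by `n - 2`. -/
def koszulDual : GradedSModule.{u, max u v} k where
  obj n p := Module.Dual k (E.obj n ((n : ℤ) - 2 - p))
  act n p :=
    { toFun := fun σ => (Equiv.Perm.sign σ) • (E.act n ((n : ℤ) - 2 - p)).dual σ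
      map_one' := by rw [map_one, map_one, one_smul]
      map_mul' := fun σ τ => by
        rw [map_mul, map_mul, mul_smul_comm, smul_mul_assoc, smul_smul, mul_comm] }

/-- The sign in the pairing of the tree `(S; ε, ε')` of `T(E^∨)^{(2)}` with the tree `(S; e, e')` of
`T(E)^{(2)}`, for `|e| = p`. It is obtained by moving the suspensions and the operations of
`End_{k s⁻¹}` to the left; the first summand is the signature of the unshuffle given by `S`. -/
def pairSign {n : ℕ} (S : Finset (Fin n)) (p : ℤ) : ℤˣ :=
  (((S ×ˢ Sᶜ).filter fun x => x.2 < x.1).card + Sᶜ.card + S.card * p : ℤ).negOnePow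

/-- The pairing between `T(E^∨)^{(2)}` and `T(E)^{(2)}`. -/
def pair (n : ℕ) : E.koszulDual.T2 n →ₗ[k] E.T2 n →ₗ[k] k :=
  DirectSum.toModule k _ _ fun i =>
    pairSign i.1 (((i.1ᶜ.card + 1 : ℕ) : ℤ) - 2 - i.2.1) •
      (DirectSum.component k _ _ (i.1, ((i.1ᶜ.card + 1 : ℕ) : ℤ) - 2 - i.2.1,
        (i.1.card : ℤ) - 2 - i.2.2)).dualMap.comp
        (TensorProduct.dualDistrib k (E.obj (i.1ᶜ.card + 1) (((i.1ᶜ.card + 1 : ℕ) : ℤ) - 2 - i.2.1))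
          (E.obj i.1.card ((i.1.card : ℤ) - 2 - i.2.2)))

end GradedSModule

/-- Quadratic-linear data `(E, R)`, with `R ⊆ E ⊕ T(E)^{(2)}` a graded sub-S-module subject to the
two conditions under which the Koszul dual is a differential graded object: no relation is
linear, and the relations have no further consequence of weight two. -/
structure QuadraticLinearData (k : Type u) [Field k] where
  E : GradedSModule.{u, v} k
  R : ∀ n : ℕ, Submodule k (E.free.obj (Fin n))
  le : ∀ n, R n ≤ LinearMap.range (E.ev1 E.noRel n) ⊔ LinearMap.range (E.ev2 E.noRel n)
  homogeneous : ∀ n, R n ≤ ⨆ p : ℤ, R n ⊓ E.free.deg (Fin n) p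
  stable : ∀ n (σ : Equiv.Perm (Fin n)), (R n).map (E.free.map σ) ≤ R n
  ql1 : ∀ n, R n ⊓ LinearMap.range (E.ev1 E.noRel n) = ⊥
  ql2 : ∀ n, Submodule.span k
      ({x | ∃ (S : Finset (Fin n)) (r : E.free.obj (Fin (Sᶜ.card + 1))) (e : E.T1 S.card),
          r ∈ R _ ∧ x = E.free.graft S r (E.ev1 E.noRel _ e)} ∪
       {x | ∃ (S : Finset (Fin n)) (e : E.T1 (Sᶜ.card + 1)) (r : E.free.obj (Fin S.card)),
          r ∈ R _ ∧ x = E.free.graft S (E.ev1 E.noRel _ e) r})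
      ⊓ LinearMap.range (E.ev2 E.noRel n) ≤ R n

namespace QuadraticLinearData

variable {k : Type u} [Field k] (D : QuadraticLinearData.{u, v} k)

/-- `E(0) = 0` and `E(n)` is finite dimensional for all `n`. -/
structure ArityFinite : Prop where
  zero : ∀ p, Subsingleton (D.E.obj 0 p)
  finite : ∀ n, Module.Finite k (D.E.T1 n)

/-- `(qR)^⊥`, where `qR` is the projection of `R` to `T(E)^{(2)}`. -/
def perp (n : ℕ) : Submodule k (D.E.koszulDual.T2 n) where
  carrier := {t | ∀ (x : D.E.T1 n) (y : D.E.T2 n),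
    D.E.ev1 D.E.noRel n x + D.E.ev2 D.E.noRel n y ∈ D.R n → D.E.pair n t y = 0}
  add_mem' h h' x y hxy := by rw [map_add, LinearMap.add_apply, h x y hxy, h' x y hxy, add_zero]
  zero_mem' x y _ := by simp
  smul_mem' c t h x y hxy := by rw [map_smul, LinearMap.smul_apply, h x y hxy, smul_zero]

/-- The relations of the Koszul dual operad. -/
def dualRel (n : ℕ) : Submodule k (D.E.koszulDual.free.obj (Fin n)) :=
  (D.perp n).map (D.E.koszulDual.ev2 D.E.koszulDual.noRel n)

/-- The Koszul dual operad `P^! = P(E^∨, (qR)^⊥)`. -/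
abbrev koszulDualOperad : GradedOperad.{u, max u v 1} k := D.E.koszulDual.quot D.dualRel

/-- The differential of the Koszul dual operad: the derivation which on `E^∨` is the transpose of
the map `φ : qR → E`, where `R` is the graph `{y - φ(y) | y ∈ qR}` of `-φ`. -/
def IsKoszulDifferential (d : OperadDerivation D.koszulDualOperad) : Prop :=
  ∀ (n : ℕ) (p : ℤ) (ε : D.E.koszulDual.obj n p) (t : D.E.koszulDual.T2 n),
    (∀ (x : D.E.T1 n) (y : D.E.T2 n),
      D.E.ev1 D.E.noRel n x + D.E.ev2 D.E.noRel n y ∈ D.R n →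
        D.E.pair n t y = - (show Module.Dual k (D.E.obj n ((n : ℤ) - 2 - p)) from ε) (x _)) →
    d.toFun (Fin n) (D.E.koszulDual.gen (D.E.koszulDual.relOf D.dualRel) n p ε) =
      D.E.koszulDual.ev2 (D.E.koszulDual.relOf D.dualRel) n t

/-- The unital extension `u_χ P^!`. -/
abbrev unitalDual (χ : D.E.koszulDual.obj 2 0 →ₗ[k] k) : GradedOperad.{u, max u v 1} k :=
  D.E.koszulDual.unital D.dualRel χ

/-- The canonical map `P^! → u_χ P^!`. -/
abbrev toUnitalDual (χ : D.E.koszulDual.obj 2 0 →ₗ[k] k) (I : Type) :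
    D.koszulDualOperad.obj I →ₗ[k] (D.unitalDual χ).obj I :=
  D.E.koszulDual.toUnital D.dualRel χ I

end QuadraticLinearData

/-! ## Complete graded modules and their endomorphism operad -/

/-- The structure of a complete graded `k`-module on `A`: a grading, and a decreasing filtration
`fil 0 = A ⊇ fil 1 ⊇ ...` by graded submodules, such that `A_p = lim A_p / fil_m A_p` in each degree
`p`. -/
structure CompleteGradedModule (k : Type u) [Field k] (A : Type w) [AddCommGroup A]
    [Module k A] where
  deg : ℤ → Submodule k A
  [dec : DirectSum.Decomposition deg]
  fil : ℕ → Submodule k A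
  fil_zero : fil 0 = ⊤
  fil_anti : Antitone fil
  fil_homogeneous : ∀ (m : ℕ) (x : A), x ∈ fil m → ∀ p, (DirectSum.decompose deg x p : A) ∈ fil m
  complete : ∀ (p : ℤ) (x : ℕ → A), (∀ m, x m ∈ deg p) → (∀ m, x (m + 1) - x m ∈ fil m) →
    ∃! y : A, y ∈ deg p ∧ ∀ m, x m - y ∈ fil m

attribute [instance] CompleteGradedModule.dec

namespace CompleteGradedModule

variable {k : Type u} [Field k] {A : Type w} [AddCommGroup A] [Module k A]
  (M : CompleteGradedModule k A)

/-- Projection to the part of parity `c`. -/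
def proj (c : ZMod 2) : A →ₗ[k] A :=
  (DirectSum.toModule k ℤ A fun p => if (p : ZMod 2) = c then (M.deg p).subtype else 0).comp
    (DirectSum.decomposeLinearEquiv M.deg).toLinearMap

/-- The involution `x ↦ (-1)^|x| x`. -/
def inv : A →ₗ[k] A := M.proj 0 - M.proj 1

/-- The part of a multilinear operation on arguments of parities `c`. -/
def parityPart {n : ℕ} (F : MultilinearMap k (fun _ : Fin n => A) A) (c : Fin n → ZMod 2) :
    MultilinearMap k (fun _ : Fin n => A) A :=
  F.compLinearMap fun i => M.proj (c i)

/-- The left action of the symmetric group on `End_A(n)`, with Koszul signs. -/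
def endAct {n : ℕ} (σ : Equiv.Perm (Fin n)) (F : MultilinearMap k (fun _ : Fin n => A) A) :
    MultilinearMap k (fun _ : Fin n => A) A :=
  ∑ c : Fin n → ZMod 2,
    ((Finset.univ.filter fun x : Fin n × Fin n =>
      x.1 < x.2 ∧ σ x.2 < σ x.1 ∧ c (σ x.1) = 1 ∧ c (σ x.2) = 1).card : ℤ).negOnePow •
    M.parityPart (F.domDomCongr σ) c

/-- Partial composition `F ∘_S G` in `End_A`: `G` takes the arguments labelled by `S`, its value is
the first argument of `F`, and the other arguments of `F` are those labelled by the complement of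
`S`; the sign is the Koszul sign of this permutation of the arguments. -/
def endComp {n : ℕ} (S : Finset (Fin n)) :
    MultilinearMap k (fun _ : Fin (Sᶜ.card + 1) => A) A →ₗ[k]
      MultilinearMap k (fun _ : Fin S.card => A) A →ₗ[k]
        MultilinearMap k (fun _ : Fin n => A) A :=
  LinearMap.mk₂ k
    (fun F G => ∑ c : Fin n → ZMod 2,
      (((S ×ˢ Sᶜ).filter fun x => x.2 < x.1 ∧ c x.1 = 1 ∧ c x.2 = 1).card : ℤ).negOnePow •
      M.parityPart (((F.curryLeft.compMultilinearMap G).uncurrySum).domDomCongr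
        (finSumEquivOfFinset rfl rfl)) c)
    (fun F F' G => by
      simp only [← Finset.sum_add_distrib, ← smul_add]
      refine Finset.sum_congr rfl fun c _ => congrArg _ ?_
      ext y
      rfl)
    (fun r F G => by
      simp only [Finset.smul_sum]
      refine Finset.sum_congr rfl fun c _ => ?_
      rw [smul_comm]
      refine congrArg _ ?_
      ext y
      rfl)
    (fun F G G' => by
      simp only [← Finset.sum_add_distrib, ← smul_add]
      refine Finset.sum_congr rfl fun c _ => congrArg _ ?_
      ext y
      simp [parityPart, MultilinearMap.uncurrySum_apply])
    (fun r F G => by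
      simp only [Finset.smul_sum]
      refine Finset.sum_congr rfl fun c _ => ?_
      rw [smul_comm]
      refine congrArg _ ?_
      ext y
      simp [parityPart, MultilinearMap.uncurrySum_apply])

/-- The operation `(-1)^(q |F|) F` for homogeneous `F`. -/
def endSign (q : ℤ) {n : ℕ} :
    MultilinearMap k (fun _ : Fin n => A) A →ₗ[k] MultilinearMap k (fun _ : Fin n => A) A where
  toFun F := if Even q then F else M.inv.compMultilinearMap (F.compLinearMap fun _ => M.inv)
  map_add' F G := by
    split_ifs
    · rfl
    · ext y
      simp
  map_smul' c F := by
    split_ifs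
    · rfl
    · ext y
      simp

/-- The operations of degree `q` in `End_A(n)`. -/
def endDeg (q : ℤ) {n : ℕ} (F : MultilinearMap k (fun _ : Fin n => A) A) : Prop :=
  ∀ (p : Fin n → ℤ) (x : Fin n → A), (∀ i, x i ∈ M.deg (p i)) → F x ∈ M.deg (∑ i, p i + q)

/-- The filtration of `End_A(n)`. -/
def endFil (m : ℕ) {n : ℕ} (F : MultilinearMap k (fun _ : Fin n => A) A) : Prop :=
  ∀ (l : Fin n → ℕ) (x : Fin n → A), (∀ i, x i ∈ M.fil (l i)) → F x ∈ M.fil (∑ i, l i + m)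

end CompleteGradedModule

/-! ## Linear duals of operads -/

namespace GradedOperad

variable {k : Type u} [Field k] (O : GradedOperad.{u, w} k)

/-- The weight graded linear dual `O^*(n)`, that is, the forms vanishing in all sufficiently large
weights. (The weights of the operads to be considered are bounded below.) A form supported in degree
`p` has degree `-p`. -/
def grDual (n : ℕ) : Submodule k (Module.Dual k (O.obj (Fin n))) where
  carrier := {φ | ∃ N : ℤ, ∀ q, N < q → ∀ x ∈ O.wt (Fin n) q, φ x = 0}
  add_mem' := by
    rintro φ ψ ⟨N, hN⟩ ⟨N', hN'⟩
    refine ⟨max N N', fun q hq x hx => ?_⟩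
    rw [LinearMap.add_apply, hN q (lt_of_le_of_lt (le_max_left _ _) hq) x hx,
      hN' q (lt_of_le_of_lt (le_max_right _ _) hq) x hx, add_zero]
  zero_mem' := ⟨0, fun _ _ _ _ => rfl⟩
  smul_mem' := by
    rintro c φ ⟨N, hN⟩
    exact ⟨N, fun q hq x hx => by rw [LinearMap.smul_apply, hN q hq x hx, smul_zero]⟩

/-- The left action of the symmetric group on `O^*(n)`. -/
def dualAct {n : ℕ} (σ : Equiv.Perm (Fin n)) : O.grDual n →ₗ[k] O.grDual n :=
  (O.map σ.symm).dualMap.restrict (by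
    rintro φ ⟨N, hN⟩
    exact ⟨N, fun q hq x hx => hN q hq _ (O.wt_map _ _ _ hx)⟩)

/-- The differential of `O^*` dual to a derivation of `O`. -/
def dualDiff (d : OperadDerivation O) (n : ℕ) : O.grDual n →ₗ[k] O.grDual n :=
  (d.toFun (Fin n)).dualMap.restrict (by
    rintro φ ⟨N, hN⟩
    exact ⟨N, fun q hq x hx => hN (q + 1) (by omega) _ (d.wt _ _ _ hx)⟩)

/-- The evaluation of `φ ⊗ ψ` on `x ⊗ y`, that is, `φ(x) ψ(y)`. -/
def dualEval (m n : ℕ) : O.grDual m ⊗[k] O.grDual n →ₗ[k]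
    Module.Dual k (O.obj (Fin m) ⊗[k] O.obj (Fin n)) :=
  (TensorProduct.dualDistrib k (O.obj (Fin m)) (O.obj (Fin n))).comp
    (TensorProduct.map (O.grDual m).subtype (O.grDual n).subtype)

/-- A left inverse of an injective linear map. -/
def leftInv {V : Type v} {W : Type w} [AddCommMonoid V] [Module k V] [AddCommMonoid W] [Module k W]
    (f : V →ₗ[k] W) : W →ₗ[k] V :=
  letI : AddCommGroup V := Module.addCommMonoidToAddCommGroup k
  letI : AddCommGroup W := Module.addCommMonoidToAddCommGroup k
  f.leftInverse

theorem leftInv_apply {V : Type v} {W : Type w} [AddCommMonoid V] [Module k V] [AddCommMonoid W]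
    [Module k W] (f : V →ₗ[k] W) (hf : Function.Injective f) (x : V) : leftInv f (f x) = x := by
  let _ : AddCommGroup V := Module.addCommMonoidToAddCommGroup k
  let _ : AddCommGroup W := Module.addCommMonoidToAddCommGroup k
  exact LinearMap.leftInverse_apply_of_inj (LinearMap.ker_eq_bot.2 hf) x

/-- The component at `S` of the infinitesimal decomposition `Δ_(1)` of the cooperad `O^*`: the
tensor `∑ φ' ⊗ φ''` such that `∑ φ'(x) φ''(y) = φ(x ∘_S y)` for all `x` and `y`. (`dualEval` is
injective, and for the operads to be considered, whose components of given arity and weight have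
finite dimension and whose weights are bounded below, such a tensor always exists.) -/
def decomp {n : ℕ} (S : Finset (Fin n)) :
    O.grDual n →ₗ[k] O.grDual (Sᶜ.card + 1) ⊗[k] O.grDual S.card :=
  (leftInv (O.dualEval (Sᶜ.card + 1) S.card)).comp
    ((TensorProduct.lift (O.graft S)).dualMap.comp (O.grDual n).subtype)

end GradedOperad

/-! ## Convolution algebras -/

/-- Collections of maps from `O^*` to `End_A`. -/
abbrev Conv {k : Type u} [Field k] (O : GradedOperad.{u, v} k) (A : Type w) [AddCommGroup A]
    [Module k A] : Type (max u v w) :=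
  ∀ n : ℕ, O.grDual n →ₗ[k] MultilinearMap k (fun _ : Fin n => A) A

namespace CompleteGradedModule

variable {k : Type u} [Field k] {A : Type w} [AddCommGroup A] [Module k A]
  (M : CompleteGradedModule k A) {O : GradedOperad.{u, v} k}

/-- `f ∈ hom_S(O^*, End_A)` has degree `p`: it is equivariant, preserves the filtrations (`O^*`
being discrete) and has degree `p`. -/
structure IsHom (p : ℤ) (f : Conv O A) : Prop where
  equivariant : ∀ n (σ : Equiv.Perm (Fin n)) (φ : O.grDual n),
    f n (O.dualAct σ φ) = M.endAct σ (f n φ)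
  filtered : ∀ n (φ : O.grDual n), M.endFil 0 (f n φ)
  degree : ∀ n (j : ℤ) (φ : O.grDual n),
    (∀ q, q ≠ -j → ∀ x ∈ O.deg (Fin n) q, (φ : Module.Dual k (O.obj (Fin n))) x = 0) →
      M.endDeg (j + p) (f n φ)

/-- The filtration of the convolution algebra. -/
def InFil (m : ℕ) (f : Conv O A) : Prop := ∀ n (φ : O.grDual n), M.endFil m (f n φ)

/-- The pre-Lie product `f ⋆ g = γ_(1) ∘ (f ⊗ g) ∘ Δ_(1)` for `f` of degree `p` and `g` of degree
`q`, where `(f ⊗ g) (c ⊗ c') = (-1)^(q |c|) f(c) ⊗ g(c')`. -/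
def star (p q : ℤ) (f g : Conv O A) : Conv O A := fun n =>
  ∑ S : Finset (Fin n), ((TensorProduct.lift (M.endComp S)).comp
    (TensorProduct.map ((p * q).negOnePow • (M.endSign q).comp (f _)) (g _))).comp (O.decomp S)

/-- The bracket `ad_f(g) = f ⋆ g - (-1)^(p q) g ⋆ f` for `f` of degree `p` and `g` of degree `q`. -/
def ad (p q : ℤ) (f g : Conv O A) : Conv O A :=
  M.star p q f g - (p * q).negOnePow • M.star q p g f

/-- The part `∂ f = - (-1)^p f ∘ d` of the differential of the convolution algebra, for `f` of degree
`p`. (The part given by the differential of `A` is internal.) -/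
def boundary (d : OperadDerivation O) (p : ℤ) (f : Conv O A) : Conv O A := fun n =>
  -(p.negOnePow • (f n).comp (O.dualDiff d n))

/-- The Maurer-Cartan elements of the convolution algebra, in square-zero form: the differential of
`A` is part of `α`, as the value of `α` on the dual of the identity. -/
structure IsMC (d : OperadDerivation O) (α : Conv O A) : Prop where
  hom : M.IsHom (-1) α
  eq : boundary d (-1) α + M.star (-1) (-1) α α = 0

/-- The terms of the series `e^(ad_f) α` for the gauge action; here `ad_f` also acts on the internal
differential, by `- ∂ f`. -/
def gaugeTerm (d : OperadDerivation O) (f α : Conv O A) (n : ℕ) : Conv O A :=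
  ((n.factorial : k)⁻¹) • (M.ad 0 (-1) f)^[n] α -
    (((n + 1).factorial : k)⁻¹) • (M.ad 0 (-1) f)^[n] (boundary d 0 f)

/-- The gauge action of `f` on `α` is `β`: the series converges to `β` in the topology of the
filtration. -/
def IsGauge (d : OperadDerivation O) (f α β : Conv O A) : Prop :=
  ∀ m, ∃ N, ∀ l, N ≤ l → M.InFil m (β - ∑ n ∈ Finset.range l, M.gaugeTerm d f α n)

end CompleteGradedModule

/-! ## The extended convolution algebra -/

namespace QuadraticLinearData

variable {k : Type u} [Field k] (D : QuadraticLinearData.{u, v} k)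
  (χ : D.E.koszulDual.obj 2 0 →ₗ[k] k) {A : Type w} [AddCommGroup A] [Module k A]

theorem wt_toUnitalDual (I : Type) (q : ℤ) (x : D.koszulDualOperad.obj I)
    (hx : x ∈ D.koszulDualOperad.wt I q) : D.toUnitalDual χ I x ∈ (D.unitalDual χ).wt I q :=
  Presentation.wt_substMap (D.E.koszulDual.pres (D.E.koszulDual.relOf D.dualRel))
    (D.E.koszulDual.unitalPres D.dualRel χ) (fun _ => GradedSModule.UGen.op) (fun _ _ => rfl)
    (fun _ _ h => .rel (.base h)) (fun _ _ => rfl) I q x hx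

/-- The transpose `(u_χ P^!)^* → (P^!)^*` of the canonical map. -/
def res (n : ℕ) : (D.unitalDual χ).grDual n →ₗ[k] D.koszulDualOperad.grDual n :=
  (D.toUnitalDual χ (Fin n)).dualMap.restrict (by
    rintro φ ⟨N, hN⟩
    exact ⟨N, fun q hq x hx => hN q hq _ (D.wt_toUnitalDual χ _ _ _ hx)⟩)

/-- The inclusion of `hom_S((P^!)^*, End_A)` in `hom_S((u_χ P^!)^*, End_A)`. -/
def extend (f : Conv D.koszulDualOperad A) : Conv (D.unitalDual χ) A :=
  fun n => (f n).comp (D.res χ n)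

/-- The element `u` of `u_χ P^!`. -/
abbrev u : (D.unitalDual χ).obj (Fin 0) := D.E.koszulDual.unitElt D.dualRel χ

/-- The element `a` of `A` viewed in the extended convolution algebra: it sends `u^*` to `a` and
vanishes in positive arities. -/
def ofArityZero (a : A) : Conv (D.unitalDual χ) A
  | 0 =>
    { toFun := fun φ => (φ : Module.Dual k ((D.unitalDual χ).obj (Fin 0))) (D.u χ) •
        MultilinearMap.constOfIsEmpty k (fun _ : Fin 0 => A) a
      map_add' := fun φ ψ => by
        rw [Submodule.coe_add, LinearMap.add_apply, add_smul]
      map_smul' := fun c φ => by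
        rw [Submodule.coe_smul, LinearMap.smul_apply, smul_eq_mul, mul_smul, RingHom.id_apply] }
  | _ + 1 => 0

end QuadraticLinearData

end OperadTwist

end

open OperadTwist

/-! The operad `u_χ P^!` differs from `P^!` only in arity zero. In a tree some of whose inputs are
filled by `u`, each `u` is absorbed by the vertex on which it sits, through `μ ∘ u = χ(μ) id` or `μ
∘ u = 0`. So every monomial is a multiple of a monomial of `P^!` or of `u` (`isStd_comp_u`,
`isStd_mon`). Together with the injectivity of `ι`, this identifies the two operads in positive
arities. In arity zero `P^!` vanishes because `E(0) = 0`, and `u_χ P^!` is the line spanned by `u ≠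
0` (`u_ne_zero`). Hence an element of the larger convolution algebra comes from the smaller one as
soon as its arity zero part vanishes (`exists_extend`), and the inclusion preserves and reflects
Maurer–Cartan elements (`isMC_extend_iff`).

As for the gauge action, `a` has no input, so `a ⋆ G = 0`, while `G ⋆ a` is the contraction of `G`:
it puts `a` in the first input on the side of `End_A` and `u` in the first input on the side of the
operad. Thus `ad_a` is minus the contraction. Since `d' u` would have weight `0`, and arity zero is
concentrated in weight `-1`, one has `d' u = 0`. Therefore `∂ a = 0` and the contraction commutes
with `∂`. It also satisfies the Leibniz rule for `⋆` (`contract_star`), because in a two-level tree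
an added input belongs either to the upper or to the lower vertex. Its exponential formally
preserves the Maurer–Cartan equation; as `a ∈ F_1`, the `n`-th term of the series lies in `F_n`, so
that the series converges and the equation passes to the limit (`exists_exp`, `gaugeTerm_eq`).

Two points need care. The decomposition `Δ_(1)` is defined by a left inverse, and has its meaning
only where the required tensor exists; this follows from the finiteness of the weight pieces
(`exists_tensor`). And `A` is complete only degree by degree, so limits are taken on homogeneous
forms and arguments. That every form is a sum of homogeneous ones (`grDual_mem_span`) rests on the
same finiteness and on the gradedness of all relations. -/

noncomputable section

namespace OperadTwist

/-! ## Presented operads with homogeneous relations -/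

namespace Presentation

variable {k : Type u} [Field k] (Q : Presentation.{u, v} k)

/-- The class of a monomial as an operation of the presented operad. -/
def mon {I : Type} (a : Mono Q.X I) : Q.operad.obj I := mono a

theorem map_mon {I J : Type} (σ : I ≃ J) (a : Mono Q.X I) :
    Q.operad.map σ (Q.mon a) = Q.mon (.map σ a) := Q.mapQ_mono σ a

theorem comp_mon {K J : Type} (a : Mono Q.X (Option K)) (b : Mono Q.X J) :
    Q.operad.comp (Q.mon a) (Q.mon b) = Q.mon (.comp a b) := Q.compQ_mono a b

theorem one_eq_mon : Q.operad.one = Q.mon .one := rfl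

theorem mon_mem_deg {I : Type} (a : Mono Q.X I) : Q.mon a ∈ Q.operad.deg I (a.degree Q.dg) :=
  Submodule.subset_span (M := Q.Obj I) ⟨a, rfl, rfl⟩

theorem mon_mem_wt {I : Type} (a : Mono Q.X I) : Q.mon a ∈ Q.operad.wt I (a.degree Q.wg) :=
  Submodule.subset_span (M := Q.Obj I) ⟨a, rfl, rfl⟩

/-- The degree pieces are spans of classes of monomials by construction. The instances are given
explicitly so that the additive structure is the one stored in `Q.operad` and not the one of the
quotient module. -/
theorem deg_induction {I : Type} {q : ℤ} {p : ∀ x, x ∈ Q.operad.deg I q → Prop}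
    (hm : ∀ (a : Mono Q.X I) (h : a.degree Q.dg = q), p (Q.mon a) (h ▸ Q.mon_mem_deg a))
    (h0 : p 0 (zero_mem _)) (ha : ∀ x y hx hy, p x hx → p y hy → p (x + y) (add_mem hx hy))
    (hs : ∀ (c : k) x hx, p x hx → p (c • x) (Submodule.smul_mem _ c hx))
    {x : Q.operad.obj I} (hx : x ∈ Q.operad.deg I q) : p x hx :=
  @Submodule.span_induction k (Q.operad.obj I) _ (Q.operad.addCommGroup I).toAddCommMonoid
    (Q.operad.module I) (s := {x | ∃ a : Mono Q.X I, a.degree Q.dg = q ∧ x = Q.mon a}) (p := p) (fun x hx => by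
      obtain ⟨a, h, rfl⟩ := hx
      exact hm a h) h0 ha hs _ hx

theorem wt_induction {I : Type} {q : ℤ} {p : ∀ x, x ∈ Q.operad.wt I q → Prop}
    (hm : ∀ (a : Mono Q.X I) (h : a.degree Q.wg = q), p (Q.mon a) (h ▸ Q.mon_mem_wt a))
    (h0 : p 0 (zero_mem _)) (ha : ∀ x y hx hy, p x hx → p y hy → p (x + y) (add_mem hx hy))
    (hs : ∀ (c : k) x hx, p x hx → p (c • x) (Submodule.smul_mem _ c hx))
    {x : Q.operad.obj I} (hx : x ∈ Q.operad.wt I q) : p x hx :=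
  @Submodule.span_induction k (Q.operad.obj I) _ (Q.operad.addCommGroup I).toAddCommMonoid
    (Q.operad.module I) (s := {x | ∃ a : Mono Q.X I, a.degree Q.wg = q ∧ x = Q.mon a}) (p := p) (fun x hx => by
      obtain ⟨a, h, rfl⟩ := hx
      exact hm a h) h0 ha hs _ hx

theorem operad_induction {I : Type} {p : Q.operad.obj I → Prop} (x : Q.operad.obj I)
    (hm : ∀ a : Mono Q.X I, p (Q.mon a)) (h0 : p 0) (ha : ∀ x y, p x → p y → p (x + y))
    (hs : ∀ (c : k) x, p x → p (c • x)) : p x :=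
  obj_induction (Q := Q) (p := p) x hm h0 ha hs

theorem iSup_wt (I : Type) : ⨆ p, Q.operad.wt I p = ⊤ := by
  refine eq_top_iff.2 fun x _ => ?_
  induction x using operad_induction with
  | hm a => exact Submodule.mem_iSup_of_mem _ (Q.mon_mem_wt a)
  | h0 => exact zero_mem _
  | ha x y hx hy => exact add_mem (hx trivial) (hy trivial)
  | hs c x hx => exact Submodule.smul_mem _ _ (hx trivial)

/-- Projection of linear combinations of monomials to the part of degree `p`. -/
def degProj (p : ℤ) (I : Type) : (Mono Q.X I →₀ k) →ₗ[k] (Mono Q.X I →₀ k) :=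
  Finsupp.linearCombination k fun a => if a.degree Q.dg = p then .single a 1 else 0

theorem degProj_single (p : ℤ) {I : Type} (a : Mono Q.X I) (c : k) :
    Q.degProj p I (.single a c) = if a.degree Q.dg = p then .single a c else 0 := by
  rw [degProj, Finsupp.linearCombination_single]
  split_ifs <;> simp

/-- The shift `r` allows a single statement to serve relabelling and substitution (`r = 0`) as well
as grafting with a fixed monomial (`r` its degree). -/
theorem degProj_mapDomain {Q : Presentation.{u, v} k} {Q' : Presentation.{u, w} k} (p r : ℤ)
    {I J : Type} (f : Mono Q.X I → Mono Q'.X J)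
    (hf : ∀ a, (f a).degree Q'.dg = a.degree Q.dg + r) (x : Mono Q.X I →₀ k) :
    Q'.degProj p J (x.mapDomain f) = (Q.degProj (p - r) I x).mapDomain f := by
  induction x using Finsupp.induction_linear with
  | zero => simp
  | add x y hx hy => rw [Finsupp.mapDomain_add, map_add, map_add, Finsupp.mapDomain_add, hx, hy]
  | single a c =>
    rw [Finsupp.mapDomain_single, degProj_single, degProj_single, hf, apply_ite
      (Finsupp.mapDomain f), Finsupp.mapDomain_single, Finsupp.mapDomain_zero]
    exact if_congr eq_sub_iff_add_eq.symm rfl rfl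

theorem degProj_single_sub (p : ℤ) {I : Type} (a b : Mono Q.X I) (c c' : k)
    (h : a.degree Q.dg = b.degree Q.dg) (hI : Q.InIdeal (.single a c - .single b c')) :
    Q.InIdeal (Q.degProj p I (.single a c - .single b c')) := by
  rw [map_sub, degProj_single, degProj_single, h]
  split_ifs
  · exact hI
  · rw [sub_zero]
    exact .zero

/-- Linear combinations of monomials of degree `r`. -/
def homog (r : ℤ) (I : Type) : Submodule k (Mono Q.X I →₀ k) :=
  Submodule.span k {x | ∃ a : Mono Q.X I, a.degree Q.dg = r ∧ x = .single a 1}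

variable {Q} in
theorem single_mem_homog {r : ℤ} {I : Type} {a : Mono Q.X I} (h : a.degree Q.dg = r) :
    Finsupp.single a 1 ∈ Q.homog r I := Submodule.subset_span ⟨a, h, rfl⟩

variable {Q} in
theorem InIdeal.degProj_of_homog {r : ℤ} {I : Type} {x : Mono Q.X I →₀ k} (h : x ∈ Q.homog r I)
    (hI : Q.InIdeal x) (p : ℤ) : Q.InIdeal (Q.degProj p I x) := by
  have : Q.degProj p I x = if r = p then x else 0 := by
    clear hI
    induction h using Submodule.span_induction with
    | mem x hx =>
      obtain ⟨a, rfl, rfl⟩ := hx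
      exact degProj_single _ _ _ _
    | zero => rw [map_zero, ite_self]
    | add x y _ _ hx hy =>
      rw [map_add, hx, hy]
      split_ifs
      · rfl
      · rw [add_zero]
    | smul c x _ hx =>
      rw [map_smul, hx]
      split_ifs
      · rfl
      · rw [smul_zero]
  rw [this]
  split_ifs
  · exact hI
  · exact .zero

/-- All relations are sums of homogeneous relations. -/
def IsHomogeneous : Prop := ∀ I x, Q.rel I x → ∀ p, Q.InIdeal (Q.degProj p I x)

variable {Q}

/-- Both sides of every operad axiom have the same total degree, and the closure operations shift
degrees by constants. Hence homogeneous relations generate a graded ideal, and the degree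
projections descend to the quotient. -/
theorem InIdeal.degProj (hQ : Q.IsHomogeneous) {I : Type} {x : Mono Q.X I →₀ k}
    (h : Q.InIdeal x) : ∀ p, Q.InIdeal (Q.degProj p I x) := by
  induction h with
  | rel h => exact hQ _ _ h
  | zero => intro p; rw [map_zero]; exact .zero
  | add _ _ hx hy => intro p; rw [map_add]; exact (hx p).add (hy p)
  | smul c _ hx => intro p; rw [map_smul]; exact (hx p).smul c
  | map σ _ hx =>
    intro p
    rw [degProj_mapDomain (Q := Q) (Q' := Q) p 0 (Mono.map σ) (fun a => (add_zero _).symm)]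
    exact (hx _).map σ
  | compLeft b _ hx =>
    intro p
    rw [degProj_mapDomain p (b.degree Q.dg) _ (fun a => rfl)]
    exact (hx _).compLeft b
  | compRight a _ hx =>
    intro p
    rw [degProj_mapDomain p (a.degree Q.dg) _ (fun b => add_comm _ _)]
    exact (hx _).compRight a
  | map_refl a => exact fun p => Q.degProj_single_sub p _ _ _ _ rfl (.map_refl a)
  | map_trans σ τ a => exact fun p => Q.degProj_single_sub p _ _ _ _ rfl (.map_trans σ τ a)
  | comp_map σ τ a b => exact fun p => Q.degProj_single_sub p _ _ _ _ rfl (.comp_map σ τ a b)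
  | one_comp b => exact fun p => Q.degProj_single_sub p _ _ _ _ (zero_add _) (.one_comp b)
  | comp_one a => exact fun p => Q.degProj_single_sub p _ _ _ _ (add_zero _) (.comp_one a)
  | comp_assoc a b c =>
    exact fun p => Q.degProj_single_sub p _ _ _ _ (add_assoc _ _ _) (.comp_assoc a b c)
  | @comp_comm K J L a b c =>
    intro p
    have := InIdeal.comp_comm a b c
    -- The Koszul sign is absorbed in the coefficient of the second monomial, so that the two-term
    -- lemma applies.
    rw [Units.smul_def, ← Int.cast_smul_eq_zsmul k, Finsupp.smul_single] at this ⊢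
    exact Q.degProj_single_sub p _ _ _ _ (add_right_comm _ _ _) this

/-- Projection to the part of degree `p` of an operad presented by homogeneous relations. -/
def proj (hQ : Q.IsHomogeneous) (p : ℤ) (I : Type) : Q.operad.obj I →ₗ[k] Q.operad.obj I :=
  (Q.ideal I).mapQ (Q.ideal I) (Q.degProj p I) fun _ h => InIdeal.degProj hQ h p

theorem proj_mon (hQ : Q.IsHomogeneous) (p : ℤ) {I : Type} (a : Mono Q.X I) :
    proj hQ p I (Q.mon a) = if a.degree Q.dg = p then Q.mon a else 0 := by
  change (Q.ideal I).mkQ (Q.degProj p I _) = _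
  rw [degProj_single]
  split_ifs
  · rfl
  · exact map_zero _

theorem proj_of_mem (hQ : Q.IsHomogeneous) (p q : ℤ) {I : Type} {x : Q.operad.obj I}
    (hx : x ∈ Q.operad.deg I p) : proj hQ q I x = if p = q then x else 0 := by
  induction hx using deg_induction with
  | hm a h => rw [proj_mon, h]
  | h0 => rw [map_zero, ite_self]
  | ha x y _ _ hx hy =>
    rw [map_add, hx, hy]
    split_ifs
    · rfl
    · exact add_zero _
  | hs c x _ hx =>
    rw [map_smul, hx]
    split_ifs
    · rfl
    · exact smul_zero _

theorem proj_mem_wt (hQ : Q.IsHomogeneous) (p q : ℤ) {I : Type} {x : Q.operad.obj I}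
    (hx : x ∈ Q.operad.wt I q) : proj hQ p I x ∈ Q.operad.wt I q := by
  induction hx using wt_induction with
  | hm a h =>
    rw [proj_mon]
    split_ifs
    · exact h ▸ Q.mon_mem_wt a
    · exact zero_mem _
  | h0 => rw [map_zero]; exact zero_mem _
  | ha x y _ _ hx hy => rw [map_add]; exact add_mem hx hy
  | hs c x _ hx => rw [map_smul]; exact Submodule.smul_mem _ c hx

/-- Allowing every larger set `P'` makes the statement stable under sums, by taking unions. -/
theorem exists_finset_proj (hQ : Q.IsHomogeneous) {I : Type} (x : Q.operad.obj I) :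
    ∃ P : Finset ℤ, ∀ P', P ⊆ P' → ∑ p ∈ P', proj hQ p I x = x := by
  induction x using operad_induction with
  | hm a =>
    refine ⟨{a.degree Q.dg}, fun P' h => ?_⟩
    rw [Finset.sum_eq_single (a.degree Q.dg)]
    · rw [proj_mon, if_pos rfl]
    · intro p _ hp
      rw [proj_mon, if_neg hp.symm]
    · exact fun h' => (h' (h (Finset.mem_singleton_self _))).elim
  | h0 => exact ⟨∅, fun P' _ => by simp⟩
  | ha x y hx hy =>
    obtain ⟨P, hP⟩ := hx
    obtain ⟨P', hP'⟩ := hy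
    refine ⟨P ∪ P', fun R hR => ?_⟩
    simp only [map_add, Finset.sum_add_distrib]
    rw [hP R (Finset.union_subset_left hR), hP' R (Finset.union_subset_right hR)]
  | hs c x hx =>
    obtain ⟨P, hP⟩ := hx
    refine ⟨P, fun R hR => ?_⟩
    simp only [map_smul, ← Finset.smul_sum]
    rw [hP R hR]

/-- Parallel composition with an operation of degree zero. -/
theorem operad_comp_comm_zero {K J L : Type} (x : Q.operad.obj (Option (Option K)))
    (y : Q.operad.obj J) (z : Q.operad.obj L) (hz : z ∈ Q.operad.deg L 0) :
    Q.operad.comp (Q.operad.map (optLeft K J) (Q.operad.comp x y)) z =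
      Q.operad.map (sumSwap K L J) (Q.operad.comp (Q.operad.map (optLeft K L)
        (Q.operad.comp (Q.operad.map (optSwap K) x) z)) y) := by
  -- The sign is `(-1)^(q * 0)` whatever the degree `q` of `y`, so the identity is linear in `y` and
  -- may be checked on monomials.
  induction y using operad_induction with
  | hm b =>
    rw [Q.operad.comp_comm _ 0 x _ z (Q.mon_mem_deg b) hz, mul_zero, Int.negOnePow_zero, one_smul]
  | h0 => simp only [map_zero, LinearMap.zero_apply]
  | ha x y hx hy => simp only [map_add, LinearMap.add_apply, hx, hy]
  | hs c x hx => simp only [map_smul, LinearMap.smul_apply, hx]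

end Presentation

end OperadTwist
end

noncomputable section

namespace OperadTwist

/-! ## Homogeneity of the relations of Koszul dual operads -/

namespace GradedSModule

variable {k : Type u} [Field k] (E : GradedSModule.{u, v} k)

open Presentation

variable {E} in
theorem pres_isHomogeneous {extra : ∀ n : ℕ, (Mono E.Homog (Fin n) →₀ k) → Prop}
    (h : ∀ n x, extra n x → ∀ p, (E.pres extra).InIdeal ((E.pres extra).degProj p _ x)) :
    (E.pres extra).IsHomogeneous := by
  intro I x hx p
  cases hx with
  | @add n q e e' =>
    exact InIdeal.degProj_of_homog (Q := E.pres extra) (r := q) (sub_mem (single_mem_homog rfl)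
      (add_mem (single_mem_homog rfl) (single_mem_homog rfl))) (.rel (.add e e')) p
  | @smul n q c e =>
    exact InIdeal.degProj_of_homog (Q := E.pres extra) (r := q) (sub_mem (single_mem_homog rfl)
      (Submodule.smul_mem _ c (single_mem_homog rfl))) (.rel (.smul c e)) p
  | @act n q σ e =>
    exact InIdeal.degProj_of_homog (Q := E.pres extra) (r := q) (sub_mem (single_mem_homog rfl)
      (single_mem_homog rfl)) (.rel (.act σ e)) p
  | extra hx => exact h _ _ hx p

theorem free_isHomogeneous : (E.pres E.noRel).IsHomogeneous :=
  pres_isHomogeneous fun _ _ h => h.elim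

variable {E} in
theorem quot_isHomogeneous {R : ∀ n : ℕ, Submodule k (E.free.obj (Fin n))}
    (hR : ∀ n p z, z ∈ R n → proj E.free_isHomogeneous p (Fin n) z ∈ R n) :
    (E.pres (E.relOf R)).IsHomogeneous := by
  refine pres_isHomogeneous fun n x hx p => .rel (.extra ?_)
  exact hR n p _ hx

variable {E} in
-- The relation `μ ∘ u = χ(μ) id` is homogeneous because it is imposed only for `μ` of degree `0`
-- and `u` has degree `0`. Each vanishing relation is a single monomial.
theorem unital_isHomogeneous {R : ∀ n : ℕ, Submodule k (E.free.obj (Fin n))}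
    (hR : ∀ n p z, z ∈ R n → proj E.free_isHomogeneous p (Fin n) z ∈ R n)
    (χ : E.obj 2 0 →ₗ[k] k) : (E.unitalPres R χ).IsHomogeneous := by
  have hdeg : ∀ {I : Type} (a : Mono E.Homog I), (a.subst fun _ => UGen.op).degree
      (E.unitalPres R χ).dg = a.degree (E.pres (E.relOf R)).dg + 0 := by
    intro I a
    induction a with
    | one => rfl
    | gen x => exact (add_zero _).symm
    | map σ a ih => exact ih
    | comp a b iha ihb =>
      refine (congrArg₂ (· + ·) iha ihb).trans ?_
      rw [add_zero, add_zero, add_zero]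
      rfl
  intro I x hx p
  cases hx with
  | @base _ x hx =>
    refine (congrArg (E.unitalPres R χ).InIdeal (degProj_mapDomain (Q := E.pres (E.relOf R))
      (Q' := E.unitalPres R χ) p 0 (Mono.subst fun _ => UGen.op) hdeg x)).mpr ?_
    exact InIdeal.subst (Q := E.pres (E.relOf R)) (Q' := E.unitalPres R χ) _ (fun _ _ => rfl)
      (fun _ _ h => .rel (.base h))
      (quot_isHomogeneous hR _ _ hx _)
  | unit μ i =>
    exact InIdeal.degProj_of_homog (Q := E.unitalPres R χ) (r := 0) (sub_mem (single_mem_homog rfl)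
      (Submodule.smul_mem _ _ (single_mem_homog rfl))) (.rel (.unit μ i)) p
  | kill h μ i =>
    exact InIdeal.degProj_of_homog (Q := E.unitalPres R χ) (single_mem_homog rfl) (.rel (.kill h μ i)) p

/-- Projection of `E(n)` to degree `p`. -/
def T1proj (p : ℤ) (n : ℕ) : E.T1 n →ₗ[k] E.T1 n :=
  DirectSum.toModule k _ _ fun i => if i = p then DirectSum.lof k _ _ i else 0

/-- Projection of `T(E)^{(2)}(n)` to total degree `p`. -/
def T2proj (p : ℤ) (n : ℕ) : E.T2 n →ₗ[k] E.T2 n :=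
  DirectSum.toModule k _ _ fun i => if i.2.1 + i.2.2 = p then
    DirectSum.lof k _ (fun i : Finset (Fin n) × ℤ × ℤ =>
      E.obj (i.1ᶜ.card + 1) i.2.1 ⊗[k] E.obj i.1.card i.2.2) i else 0

variable {E} in
theorem graft_gen (extra : ∀ n : ℕ, (Mono E.Homog (Fin n) →₀ k) → Prop) {n : ℕ}
    (S : Finset (Fin n)) (p q : ℤ) (e : E.obj (Sᶜ.card + 1) p) (e' : E.obj S.card q) :
    (E.pres extra).operad.graft S (E.gen extra _ p e) (E.gen extra _ q e') =
      (E.pres extra).mon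
        (.map (splitEquiv S) (.comp (.map (finSuccEquiv _) (.gen ⟨p, e⟩)) (.gen ⟨q, e'⟩))) := by
  rw [← map_mon, ← comp_mon, ← map_mon]
  rfl

theorem proj_ev1 (p : ℤ) (n : ℕ) (x : E.T1 n) :
    proj E.free_isHomogeneous p (Fin n) (E.ev1 E.noRel n x) =
      E.ev1 E.noRel n (E.T1proj p n x) := by
  have : (proj E.free_isHomogeneous p (Fin n)).comp (E.ev1 E.noRel n) =
      (E.ev1 E.noRel n).comp (E.T1proj p n) := by
    refine DirectSum.linearMap_ext k fun i => LinearMap.ext fun e => ?_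
    rw [LinearMap.comp_apply, LinearMap.comp_apply, LinearMap.comp_apply, LinearMap.comp_apply,
      T1proj, DirectSum.toModule_lof, ev1, DirectSum.toModule_lof]
    refine (proj_mon E.free_isHomogeneous p _).trans ?_
    change (if i = p then _ else _) = _
    split_ifs
    · rw [DirectSum.toModule_lof]
      rfl
    · rw [LinearMap.zero_apply, map_zero]
  exact LinearMap.congr_fun this x

theorem proj_ev2 (p : ℤ) (n : ℕ) (x : E.T2 n) :
    proj E.free_isHomogeneous p (Fin n) (E.ev2 E.noRel n x) =
      E.ev2 E.noRel n (E.T2proj p n x) := by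
  have : (proj E.free_isHomogeneous p (Fin n)).comp (E.ev2 E.noRel n) =
      (E.ev2 E.noRel n).comp (E.T2proj p n) := by
    refine DirectSum.linearMap_ext k fun i => TensorProduct.ext' fun e e' => ?_
    rw [LinearMap.comp_apply, LinearMap.comp_apply, LinearMap.comp_apply, LinearMap.comp_apply,
      T2proj, DirectSum.toModule_lof, ev2, DirectSum.toModule_lof, TensorProduct.lift.tmul]
    refine (congrArg _ (graft_gen E.noRel i.1 i.2.1 i.2.2 e e')).trans ?_
    refine (proj_mon E.free_isHomogeneous p _).trans ?_
    change (if i.2.1 + i.2.2 = p then _ else _) = _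
    split_ifs
    · rw [DirectSum.toModule_lof, TensorProduct.lift.tmul]
      exact (graft_gen E.noRel i.1 i.2.1 i.2.2 e e').symm
    · rw [LinearMap.zero_apply, map_zero]
  exact LinearMap.congr_fun this x

theorem component_T2proj (p : ℤ) (n : ℕ) (i : Finset (Fin n) × ℤ × ℤ) (y : E.T2 n) :
    DirectSum.component k _ (fun i : Finset (Fin n) × ℤ × ℤ =>
      E.obj (i.1ᶜ.card + 1) i.2.1 ⊗[k] E.obj i.1.card i.2.2) i (E.T2proj p n y) =
      if i.2.1 + i.2.2 = p then DirectSum.component k _ _ i y else 0 := by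
  induction y using DirectSum.induction_on with
  | zero => rw [map_zero, map_zero, ite_self]
  | of j y =>
    change DirectSum.component k _ _ i (E.T2proj p n (DirectSum.lof k _ _ j y)) = if _ then
      DirectSum.component k _ (fun i : Finset (Fin n) × ℤ × ℤ =>
        E.obj (i.1ᶜ.card + 1) i.2.1 ⊗[k] E.obj i.1.card i.2.2) i (DirectSum.lof k _ _ j y) else _
    rw [T2proj, DirectSum.toModule_lof]
    by_cases h : i = j
    · subst h
      split_ifs
      · rfl
      · rw [LinearMap.zero_apply, map_zero]
    · have : ∀ z, DirectSum.component k _ (fun i : Finset (Fin n) × ℤ × ℤ =>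
          E.obj (i.1ᶜ.card + 1) i.2.1 ⊗[k] E.obj i.1.card i.2.2) i (DirectSum.lof k _ _ j z) = 0 :=
        fun z => by rw [DirectSum.component.of, dif_neg (Ne.symm h)]
      rw [this, ite_self]
      split_ifs
      · exact this y
      · rw [LinearMap.zero_apply, map_zero]
  | add x y hx hy =>
    rw [map_add, map_add, hx, hy, map_add]
    split_ifs
    · rfl
    · rw [add_zero]

/-- A dual tree of bidegree `(p₁, p₂)` is paired with trees of bidegree `(|Sᶜ| + 1 - 2 - p₁, |S| - 2
- p₂)`. The sum of the latter is `n - 3 - (p₁ + p₂)`, so the two total degree projections are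
adjoint. -/
theorem pair_T2proj (p : ℤ) (n : ℕ) (t : E.koszulDual.T2 n) (y : E.T2 n) :
    E.pair n (E.koszulDual.T2proj p n t) y = E.pair n t (E.T2proj (n - 3 - p) n y) := by
  have : (E.pair n).comp (E.koszulDual.T2proj p n) =
      (E.pair n).compl₂ (E.T2proj (n - 3 - p) n) := by
    refine DirectSum.linearMap_ext k fun i => LinearMap.ext fun t => LinearMap.ext fun y => ?_
    have hc : (i.1ᶜ.card : ℤ) + i.1.card = n := by
      have := Finset.card_compl_add_card i.1
      rw [Fintype.card_fin] at this
      exact_mod_cast this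
    have key : ((((i.1ᶜ.card + 1 : ℕ) : ℤ) - 2 - i.2.1) + ((i.1.card : ℤ) - 2 - i.2.2) =
        n - 3 - p) ↔ i.2.1 + i.2.2 = p := by
      push_cast
      constructor <;> intro h <;> linarith
    rw [LinearMap.comp_apply, LinearMap.comp_apply, LinearMap.comp_apply, LinearMap.compl₂_apply,
      T2proj, DirectSum.toModule_lof, pair, DirectSum.toModule_lof]
    have e := E.component_T2proj (n - 3 - p) n
      (i.1, ((i.1ᶜ.card + 1 : ℕ) : ℤ) - 2 - i.2.1, (i.1.card : ℤ) - 2 - i.2.2) y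
    by_cases h : i.2.1 + i.2.2 = p
    · rw [if_pos h, DirectSum.toModule_lof]
      rw [if_pos (key.2 h)] at e
      exact congrArg (fun z => pairSign i.1 (((i.1ᶜ.card + 1 : ℕ) : ℤ) - 2 - i.2.1) •
        TensorProduct.dualDistrib k _ _ t z) e.symm
    · rw [if_neg h, LinearMap.zero_apply, map_zero, LinearMap.zero_apply]
      rw [if_neg (fun h' => h (key.1 h'))] at e
      refine Eq.trans ?_ (congrArg (fun z => pairSign i.1 (((i.1ᶜ.card + 1 : ℕ) : ℤ) - 2 - i.2.1) •
        TensorProduct.dualDistrib k _ _ t z) e.symm)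
      rw [map_zero, smul_zero]
  exact LinearMap.congr_fun (LinearMap.congr_fun this t) y

end GradedSModule

/-! ### Gradedness of the orthogonal relations. -/

namespace QuadraticLinearData

open Presentation

variable {k : Type u} [Field k] (D : QuadraticLinearData.{u, v} k)

theorem proj_mem_R (n : ℕ) (p : ℤ) {z : D.E.free.obj (Fin n)} (hz : z ∈ D.R n) :
    proj D.E.free_isHomogeneous p (Fin n) z ∈ D.R n := by
  refine Submodule.iSup_induction (fun p : ℤ => D.R n ⊓ D.E.free.deg (Fin n) p)
    (motive := fun z => proj D.E.free_isHomogeneous p (Fin n) z ∈ D.R n) (D.homogeneous n hz)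
    ?_ ?_ ?_
  · intro q x hx
    rw [proj_of_mem _ q p hx.2]
    by_cases h : q = p
    · rw [if_pos h]
      exact hx.1
    · rw [if_neg h]
      exact zero_mem _
  · rw [map_zero]
    exact zero_mem _
  · intro x y hx hy
    rw [map_add]
    exact add_mem hx hy

/-- By adjunction the projection moves to the other argument. The linear part `x` is projected to
the same degree as `y`, which gives a homogeneous component of a relation; it lies in `R` because
`R` is graded. -/
theorem T2proj_mem_perp (n : ℕ) (p : ℤ) {t : D.E.koszulDual.T2 n} (ht : t ∈ D.perp n) :
    D.E.koszulDual.T2proj p n t ∈ D.perp n := by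
  intro x y hxy
  rw [GradedSModule.pair_T2proj]
  refine ht (D.E.T1proj (n - 3 - p) n x) _ ?_
  rw [← D.E.proj_ev1, ← D.E.proj_ev2, ← map_add]
  exact D.proj_mem_R n (n - 3 - p) hxy

theorem proj_mem_dualRel (n : ℕ) (p : ℤ) (z : D.E.koszulDual.free.obj (Fin n))
    (hz : z ∈ D.dualRel n) :
    proj D.E.koszulDual.free_isHomogeneous p (Fin n) z ∈ D.dualRel n := by
  obtain ⟨t, ht, rfl⟩ := hz
  exact ⟨_, D.T2proj_mem_perp n p ht, (D.E.koszulDual.proj_ev2 p n t).symm⟩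

theorem unitalDual_isHomogeneous (χ : D.E.koszulDual.obj 2 0 →ₗ[k] k) :
    (D.E.koszulDual.unitalPres D.dualRel χ).IsHomogeneous :=
  GradedSModule.unital_isHomogeneous D.proj_mem_dualRel χ

end QuadraticLinearData

end OperadTwist
end

noncomputable section

namespace OperadTwist

/-! ## Characters of presented operads -/

/-- The multiplicative extension to monomials of a function on generators. -/
def Mono.character {k : Type u} [Field k] {X : ℕ → Type v} (c : ∀ n, X n → k) :
    ∀ {I : Type}, Mono X I → k
  | _, .one => 1
  | _, .gen x => c _ x
  | _, .map _ a => a.character c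
  | _, .comp a b => a.character c * b.character c

theorem Mono.degree_eq_zero_of_character {k : Type u} [Field k] {X : ℕ → Type v}
    {c : ∀ n, X n → k} {d : ∀ n, X n → ℤ} (hc : ∀ n x, c n x ≠ 0 → d n x = 0) {I : Type}
    (a : Mono X I) (h : a.character c ≠ 0) : a.degree d = 0 := by
  induction a with
  | one => rfl
  | gen x => exact hc _ _ h
  | map σ a ih => exact ih h
  | comp a b iha ihb =>
    change a.degree d + b.degree d = 0
    rw [iha (left_ne_zero_of_mul h), ihb (right_ne_zero_of_mul h), add_zero]

/-- Label sets are arbitrary types; this is what allows the inputs to be counted in the finiteness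
argument. -/
theorem Mono.finite {X : ℕ → Type v} {I : Type} (a : Mono X I) : Finite I := by
  induction a with
  | one => infer_instance
  | gen x => infer_instance
  | map σ a ih => exact Finite.of_equiv _ σ
  | @comp K J a b iha ihb =>
    have : Finite K := Finite.of_injective some (Option.some_injective K)
    infer_instance

namespace Presentation

variable {k : Type u} [Field k] {Q : Presentation.{u, v} k}

theorem substMap_mon {Q : Presentation.{u, v} k} {Q' : Presentation.{u, w} k}
    (f : ∀ n, Q.X n → Q'.X n) (hd : ∀ n x, Q'.dg n (f n x) = Q.dg n x)
    (hr : ∀ I x, Q.rel I x → Q'.InIdeal (x.mapDomain (Mono.subst f))) {I : Type}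
    (a : Mono Q.X I) : Q.substMap Q' f hd hr I (Q.mon a) = Q'.mon (a.subst f) := by
  change (Q'.ideal I).mkQ (Finsupp.mapDomain _ _) = _
  rw [Finsupp.mapDomain_single]
  rfl

/-- The linear extension of a character. -/
def charLin {X : ℕ → Type v} (c : ∀ n, X n → k) (I : Type) : (Mono X I →₀ k) →ₗ[k] k :=
  Finsupp.linearCombination k fun a => a.character c

theorem charLin_single {X : ℕ → Type v} (c : ∀ n, X n → k) {I : Type} (a : Mono X I) (r : k) :
    charLin c I (.single a r) = r * a.character c := Finsupp.linearCombination_single _ _ _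

theorem charLin_mapDomain {X : ℕ → Type v} {Y : ℕ → Type w} (c : ∀ n, X n → k) (c' : ∀ n, Y n → k)
    {I J : Type} (f : Mono X I → Mono Y J) (r : k)
    (hf : ∀ a, (f a).character c' = r * a.character c) (x : Mono X I →₀ k) :
    charLin c' J (x.mapDomain f) = r * charLin c I x := by
  induction x using Finsupp.induction_linear with
  | zero => simp
  | add x y hx hy => rw [Finsupp.mapDomain_add, map_add, map_add, hx, hy, mul_add]
  | single a s =>
    rw [Finsupp.mapDomain_single, charLin_single, charLin_single, hf]
    ring

/-- A character multiplies the values at the vertices, and scalars commute. The only obstruction is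
the Koszul sign of parallel composition; it is trivial wherever the value is nonzero, since only
generators of degree zero have nonzero value. -/
theorem InIdeal.charLin_eq_zero (c : ∀ n, Q.X n → k) (hc : ∀ n x, c n x ≠ 0 → Q.dg n x = 0)
    (hr : ∀ I x, Q.rel I x → charLin c I x = 0) {I : Type} {x : Mono Q.X I →₀ k}
    (h : Q.InIdeal x) : charLin c I x = 0 := by
  induction h with
  | rel h => exact hr _ _ h
  | zero => exact map_zero _
  | add _ _ hx hy => rw [map_add, hx, hy, add_zero]
  | smul r _ hx => rw [map_smul, hx, smul_zero]
  | map σ _ hx => rw [charLin_mapDomain c c (Mono.map σ) 1 (fun a => (one_mul _).symm), hx, mul_zero]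
  | compLeft b _ hx =>
    rw [charLin_mapDomain c c _ (b.character c) (fun a => mul_comm _ _), hx, mul_zero]
  | compRight a _ hx =>
    rw [charLin_mapDomain c c _ (a.character c) (fun b => rfl), hx, mul_zero]
  | map_refl a => simp [charLin_single, Mono.character]
  | map_trans σ τ a => simp [charLin_single, Mono.character]
  | comp_map σ τ a b => simp [charLin_single, Mono.character]
  | one_comp b => simp [charLin_single, Mono.character]
  | comp_one a => simp [charLin_single, Mono.character]
  | comp_assoc a b d => simp [charLin_single, Mono.character, mul_assoc]
  | comp_comm a b d =>
    rw [Units.smul_def, map_sub, map_zsmul, charLin_single, charLin_single, one_mul, one_mul]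
    change a.character c * b.character c * d.character c -
      _ • (a.character c * d.character c * b.character c) = 0
    by_cases hb : b.character c = 0
    · simp [hb]
    · rw [Mono.degree_eq_zero_of_character hc b hb, zero_mul, Int.negOnePow_zero, Units.val_one,
        one_smul]
      ring

/-- A character which respects the relations gives a linear form on operations. -/
def charQ (c : ∀ n, Q.X n → k) (hc : ∀ n x, c n x ≠ 0 → Q.dg n x = 0)
    (hr : ∀ I x, Q.rel I x → charLin c I x = 0) (I : Type) : Q.operad.obj I →ₗ[k] k :=
  (Q.ideal I).liftQ (charLin c I) fun _ h => InIdeal.charLin_eq_zero c hc hr h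

theorem charQ_mon (c : ∀ n, Q.X n → k) (hc : ∀ n x, c n x ≠ 0 → Q.dg n x = 0)
    (hr : ∀ I x, Q.rel I x → charLin c I x = 0) {I : Type} (a : Mono Q.X I) :
    charQ c hc hr I (Q.mon a) = a.character c := by
  change charLin c I (.single a 1) = _
  rw [charLin_single, one_mul]

end Presentation

namespace GradedSModule

open Presentation

variable {k : Type u} [Field k] (E : GradedSModule.{u, v} k)

theorem charLin_zero_of_opRel {extra : ∀ n : ℕ, (Mono E.Homog (Fin n) →₀ k) → Prop}
    (h : ∀ n x, extra n x → charLin (fun _ _ => (0 : k)) (Fin n) x = 0) (I : Type)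
    (x : Mono E.Homog I →₀ k) (hx : E.OpRel extra I x) :
    charLin (fun _ _ => (0 : k)) I x = 0 := by
  cases hx with
  | add e e' => simp [charLin_single, Mono.character]
  | smul c e => simp [charLin_single, Mono.character]
  | act σ e => simp [charLin_single, Mono.character]
  | extra hx => exact h _ _ hx

end GradedSModule

/-! ### The augmentation of `P^!`, and the nonvanishing of `u`. -/

namespace QuadraticLinearData

open Presentation

variable {k : Type u} [Field k] (D : QuadraticLinearData.{u, v} k)

/-- The presentation of the Koszul dual operad. -/
abbrev dualPres : Presentation.{u, max u v} k := D.E.koszulDual.pres (D.E.koszulDual.relOf D.dualRel)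

/-- The presentation of the unital extension of the Koszul dual operad. -/
abbrev uPres (χ : D.E.koszulDual.obj 2 0 →ₗ[k] k) : Presentation.{u, max u v} k :=
  D.E.koszulDual.unitalPres D.dualRel χ

theorem charLin_zero_of_relOf (n : ℕ) (x : Mono D.E.koszulDual.Homog (Fin n) →₀ k)
    (hx : D.E.koszulDual.relOf D.dualRel n x) : charLin (fun _ _ => (0 : k)) (Fin n) x = 0 := by
  obtain ⟨t, -, ht⟩ := hx
  -- The relators are given through their classes in the free operad, so the character must first
  -- descend to it. There it kills every tree with two vertices.
  let f := charQ (Q := D.E.koszulDual.pres D.E.koszulDual.noRel) (fun _ _ => (0 : k))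
    (fun _ _ h => (h rfl).elim) (D.E.koszulDual.charLin_zero_of_opRel fun _ _ h => h.elim) (Fin n)
  have h0 : f.comp (D.E.koszulDual.ev2 D.E.koszulDual.noRel n) = 0 := by
    refine DirectSum.linearMap_ext k fun i => TensorProduct.ext' fun e e' => ?_
    rw [LinearMap.comp_apply, LinearMap.comp_apply, GradedSModule.ev2, DirectSum.toModule_lof,
      TensorProduct.lift.tmul]
    refine (congrArg f (GradedSModule.graft_gen D.E.koszulDual.noRel i.1 i.2.1 i.2.2 e e')).trans ?_
    refine (charQ_mon _ _ _ _).trans ?_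
    exact mul_zero _
  have h1 : f (D.E.koszulDual.ev2 D.E.koszulDual.noRel n t) = 0 := LinearMap.congr_fun h0 t
  rw [ht] at h1
  exact h1

/-- The augmentation, that is, the character vanishing on all generators, has value `1` on the
identity. -/
theorem koszulDualOperad_one_ne_zero : D.koszulDualOperad.one ≠ 0 := by
  intro h
  have := charQ_mon (Q := D.E.koszulDual.pres (D.E.koszulDual.relOf D.dualRel))
    (fun _ _ => (0 : k)) (fun _ _ h => (h rfl).elim)
    (D.E.koszulDual.charLin_zero_of_opRel D.charLin_zero_of_relOf) .one
  rw [← one_eq_mon, h, map_zero] at this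
  exact zero_ne_one this

variable (χ : D.E.koszulDual.obj 2 0 →ₗ[k] k)

/-- A monomial in `E^∨` as a monomial in the generators of the unital extension. -/
def opMono {I : Type} (a : Mono D.dualPres.X I) : Mono (D.uPres χ).X I :=
  Mono.subst (X := D.dualPres.X) (Y := (D.uPres χ).X) (fun _ => GradedSModule.UGen.op) a

theorem toUnitalDual_mon {I : Type} (a : Mono D.dualPres.X I) :
    D.toUnitalDual χ I (D.dualPres.mon a) = (D.uPres χ).mon (D.opMono χ a) :=
  substMap_mon (Q := D.dualPres) (Q' := D.uPres χ) _ _ _ a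

theorem character_opMono (c : ∀ n, (D.uPres χ).X n → k)
    (hc : ∀ n (x : D.E.koszulDual.Homog n), c n (.op x) = 0) {I : Type} (a : Mono D.dualPres.X I) :
    (D.opMono χ a).character c = a.character fun _ _ => (0 : k) := by
  induction a with
  | one => rfl
  | gen x => exact hc _ x
  | map σ a ih => exact ih
  | comp a b iha ihb => exact congrArg₂ _ iha ihb

theorem toUnitalDual_one : D.toUnitalDual χ _ D.koszulDualOperad.one = (D.unitalDual χ).one :=
  D.toUnitalDual_mon χ .one

theorem toUnitalDual_map {I J : Type} (σ : I ≃ J) (x : D.koszulDualOperad.obj I) :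
    D.toUnitalDual χ J (D.koszulDualOperad.map σ x) =
      (D.unitalDual χ).map σ (D.toUnitalDual χ I x) := by
  induction x using operad_induction with
  | hm a =>
    rw [map_mon, toUnitalDual_mon, toUnitalDual_mon, map_mon]
    rfl
  | h0 => simp only [map_zero]
  | ha x y hx hy => simp only [map_add, hx, hy]
  | hs c x hx => simp only [map_smul, hx]

theorem toUnitalDual_comp {K J : Type} (x : D.koszulDualOperad.obj (Option K))
    (y : D.koszulDualOperad.obj J) :
    D.toUnitalDual χ _ (D.koszulDualOperad.comp x y) =
      (D.unitalDual χ).comp (D.toUnitalDual χ _ x) (D.toUnitalDual χ _ y) := by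
  induction x using operad_induction with
  | hm a =>
    induction y using operad_induction with
    | hm b =>
      rw [comp_mon, toUnitalDual_mon, toUnitalDual_mon, toUnitalDual_mon, comp_mon]
      rfl
    | h0 => simp only [map_zero]
    | ha x y hx hy => simp only [map_add, hx, hy]
    | hs c x hx => simp only [map_smul, hx]
  | h0 => simp only [map_zero, LinearMap.zero_apply]
  | ha x y hx hy => simp only [map_add, LinearMap.add_apply, hx, hy]
  | hs c x hx => simp only [map_smul, LinearMap.smul_apply, hx]

/-- The generators of the unital extension coming from `E^∨`. -/
abbrev opElt {n : ℕ} {p : ℤ} (μ : D.E.koszulDual.obj n p) : (D.unitalDual χ).obj (Fin n) :=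
  (D.uPres χ).mon (.gen (.op ⟨p, μ⟩))

theorem comp_opElt_u (μ : D.E.koszulDual.obj 2 0) (i : Fin 2) :
    (D.unitalDual χ).comp ((D.unitalDual χ).map (finSuccEquiv' i) (D.opElt χ μ)) (D.u χ) =
      χ μ • (D.unitalDual χ).map ((Equiv.ofUnique (Option Empty) (Fin 1)).trans
            (Equiv.sumEmpty (Fin 1) (Fin 0)).symm) (D.unitalDual χ).one := by
  change (D.unitalDual χ).comp ((D.unitalDual χ).map _ (D.opElt χ μ))
    ((D.uPres χ).mon (.gen .u)) = _
  rw [map_mon, comp_mon, one_eq_mon, map_mon]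
  exact (Submodule.Quotient.eq ((D.uPres χ).ideal _)).2
    (show _ ∈ (D.uPres χ).ideal _ from
      InIdeal.rel (Q := D.uPres χ) (.unit μ i))

theorem comp_opElt_u_eq_zero {m : ℕ} {p : ℤ} (h : ¬ (m = 1 ∧ p = 0))
    (μ : D.E.koszulDual.obj (m + 1) p) (i : Fin (m + 1)) :
    (D.unitalDual χ).comp ((D.unitalDual χ).map (finSuccEquiv' i) (D.opElt χ μ)) (D.u χ) = 0 := by
  change (D.unitalDual χ).comp ((D.unitalDual χ).map _ (D.opElt χ μ))
    ((D.uPres χ).mon (.gen .u)) = _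
  rw [map_mon, comp_mon]
  exact (Submodule.Quotient.mk_eq_zero ((D.uPres χ).ideal _)).2
    (show _ ∈ (D.uPres χ).ideal _ from
      InIdeal.rel (Q := D.uPres χ) (.kill h μ i))

theorem u_ne_zero (hinj : Function.Injective (D.toUnitalDual χ (Fin 1))) : D.u χ ≠ 0 := by
  intro hu
  by_cases hχ : χ = 0
  -- If `χ = 0`, every monomial occurring with nonzero coefficient in a relation with `u` also
  -- contains a vertex from `E^∨`. So killing `E^∨` and sending `u` to `1` defines a character.
  · let c : ∀ n, D.E.koszulDual.UGen n → k := fun _ x => match x with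
      | .op _ => 0
      | .u => 1
    have hr : ∀ I x, (D.uPres χ).rel I x → charLin c I x = 0 := by
      intro I x hx
      cases hx with
      | base hx =>
        rw [charLin_mapDomain (fun _ _ => (0 : k)) c _ 1, one_mul]
        · exact D.E.koszulDual.charLin_zero_of_opRel D.charLin_zero_of_relOf _ _ hx
        · exact fun a => (D.character_opMono χ c (fun _ _ => rfl) a).trans (one_mul _).symm
      | unit μ i => simp [hχ, charLin_single, Mono.character, c]
      | kill h μ i => simp [charLin_single, Mono.character, c]
    have := charQ_mon (Q := D.uPres χ) c (fun n x h => by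
      cases x with
      | op x => exact (h rfl).elim
      | u => rfl) hr (.gen .u)
    rw [show (D.uPres χ).mon (.gen .u) = D.u χ from rfl, hu,
      map_zero] at this
    exact zero_ne_one this
  -- If `χ(μ) ≠ 0`, then `u = 0` would give `χ(μ) id = 0` in `u_χ P^!`, and by injectivity the
  -- identity of `P^!` would vanish. The identity is relabelled to arity `Fin 1`, where injectivity
  -- is available.
  · obtain ⟨μ, hμ⟩ : ∃ μ, χ μ ≠ 0 := by
      by_contra! h
      exact hχ (LinearMap.ext h)
    have h := D.comp_opElt_u χ μ 0
    rw [hu, map_zero] at h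
    have h1 := (smul_eq_zero.1 h.symm).resolve_left hμ
    have h2 := congrArg ((D.unitalDual χ).map (Equiv.sumEmpty (Fin 1) (Fin 0))) h1
    rw [map_zero, ← (D.unitalDual χ).map_trans, ← toUnitalDual_one, ← toUnitalDual_map] at h2
    have h3 := hinj (h2.trans (map_zero _).symm)
    have h4 := congrArg (D.koszulDualOperad.map (Equiv.ofUnique (Fin 1) (Option Empty))) h3
    rw [map_zero, ← D.koszulDualOperad.map_trans] at h4
    refine D.koszulDualOperad_one_ne_zero (Eq.trans ?_ h4)
    rw [Subsingleton.elim (Equiv.trans _ _) (Equiv.refl (Option Empty)),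
      D.koszulDualOperad.map_refl]

end QuadraticLinearData

end OperadTwist
end

noncomputable section

namespace OperadTwist

/-! ## The structure of unital extensions -/

/-- Used to split an arbitrary labelling into the standard one of an operad axiom and a relabelling
which fixes the grafted input. -/
theorem exists_optionCongr {A B : Type} (f : Option A ≃ Option B) (h : f none = none) :
    ∃ σ : A ≃ B, f = Equiv.optionCongr σ := by
  refine ⟨Equiv.removeNone f, Equiv.ext fun x => ?_⟩
  cases x with
  | none => exact h
  | some a =>
    have : ∃ b, f (some a) = some b := by
      cases hb : f (some a) with
      | none => exact absurd (f.injective (hb.trans h.symm)) (by simp)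
      | some b => exact ⟨b, rfl⟩
    exact (Equiv.removeNone_some f this).symm

namespace GradedOperad

variable {k : Type u} [Field k] (O : GradedOperad.{u, w} k)

theorem comp_map_left {K K' J : Type} (σ : K ≃ K') (x : O.obj (Option K)) (y : O.obj J) :
    O.comp (O.map (Equiv.optionCongr σ) x) y =
      O.map (Equiv.sumCongr σ (Equiv.refl J)) (O.comp x y) := by
  rw [← O.comp_map, O.map_refl]

theorem comp_map_right {K J J' : Type} (τ : J ≃ J') (x : O.obj (Option K)) (y : O.obj J) :
    O.comp x (O.map τ y) = O.map (Equiv.sumCongr (Equiv.refl K) τ) (O.comp x y) := by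
  rw [← O.comp_map, Equiv.optionCongr_refl, O.map_refl]

/-- Sequential composition, with arbitrary labels. -/
theorem map_comp_comp_right {K J J' L K' : Type} (e : K ⊕ J ≃ Option K') (f : J ≃ Option J')
    (h : e.symm none = .inr (f.symm none)) : ∃ σ : K ⊕ J' ≃ K',
      ∀ (x : O.obj (Option K)) (y : O.obj J) (z : O.obj L),
        O.comp (O.map e (O.comp x y)) z = O.map ((Equiv.sumAssoc K J' L).symm.trans
          (Equiv.sumCongr σ (Equiv.refl L))) (O.comp x (O.comp (O.map f y) z)) := by
  obtain ⟨σ, hσ⟩ := exists_optionCongr ((optRight K J').symm.trans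
    ((Equiv.sumCongr (Equiv.refl K) f.symm).trans e)) (by
      change e (.inr (f.symm none)) = none
      rw [← h, Equiv.apply_symm_apply])
  refine ⟨σ, fun x y z => ?_⟩
  have he : e = (Equiv.sumCongr (Equiv.refl K) f).trans
      ((optRight K J').trans (Equiv.optionCongr σ)) := by
    rw [← hσ]
    ext1 x
    simp only [Equiv.trans_apply, Equiv.symm_apply_apply]
    rcases x with x | x <;> simp
  rw [he, O.map_trans, ← comp_map_right, O.map_trans, comp_map_left, O.comp_assoc, ← O.map_trans]

theorem map_refl_comp {K J : Type} (x : O.obj (Option K)) (y : O.obj J) :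
    O.comp x y = O.comp (O.map (Equiv.refl _) x) y := by rw [O.map_refl]

end GradedOperad

/-- Parallel composition with an operation of degree zero, with arbitrary labels. -/
theorem Presentation.map_comp_comp_left {k : Type u} [Field k] (Q : Presentation.{u, v} k)
    {K J L K' K'' : Type} (e : K ⊕ J ≃ Option K') (f : K ≃ Option K'')
    (h : e.symm none = .inl (f.symm none)) : ∃ σ : K'' ⊕ J ≃ K',
      ∀ (x : Q.operad.obj (Option K)) (y : Q.operad.obj J) (z : Q.operad.obj L),
        z ∈ Q.operad.deg L 0 →
        Q.operad.comp (Q.operad.map e (Q.operad.comp x y)) z =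
          Q.operad.map ((sumSwap K'' L J).trans (Equiv.sumCongr σ (Equiv.refl L)))
            (Q.operad.comp (Q.operad.map (optLeft K'' L) (Q.operad.comp
              (Q.operad.map ((Equiv.optionCongr f).trans (optSwap K'')) x) z)) y) := by
  obtain ⟨σ, hσ⟩ := exists_optionCongr ((optLeft K'' J).symm.trans
    ((Equiv.sumCongr f.symm (Equiv.refl J)).trans e)) (by
      change e (.inl (f.symm none)) = none
      rw [← h, Equiv.apply_symm_apply])
  refine ⟨σ, fun x y z hz => ?_⟩
  have he : e = (Equiv.sumCongr f (Equiv.refl J)).trans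
      ((optLeft K'' J).trans (Equiv.optionCongr σ)) := by
    rw [← hσ]
    ext1 x
    simp only [Equiv.trans_apply, Equiv.symm_apply_apply]
    rcases x with x | x <;> simp
  rw [he, Q.operad.map_trans, ← Q.operad.comp_map_left, Q.operad.map_trans,
    Q.operad.comp_map_left, operad_comp_comm_zero _ _ _ hz, ← Q.operad.map_trans,
    ← Q.operad.map_trans]

namespace QuadraticLinearData

open Presentation

variable {k : Type u} [Field k] (D : QuadraticLinearData.{u, v} k)
  (χ : D.E.koszulDual.obj 2 0 →ₗ[k] k)

/-- Standard elements of `u_χ P^!`: multiples of monomials of `P^!` and multiples of `u`. -/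
def IsStd (I : Type) (p q : ℤ) (z : (D.unitalDual χ).obj I) : Prop :=
  (∃ (c : k) (a : Mono D.dualPres.X I), a.degree D.dualPres.dg = p ∧ a.degree D.dualPres.wg = q ∧
    z = c • D.toUnitalDual χ I (D.dualPres.mon a)) ∨
  (p = 0 ∧ q = -1 ∧ ∃ (c : k) (e : Fin 0 ≃ I), z = c • (D.unitalDual χ).map e (D.u χ)) ∨ z = 0

variable {D χ}

theorem IsStd.map {I J : Type} {p q : ℤ} {z : (D.unitalDual χ).obj I} (h : D.IsStd χ I p q z)
    (σ : I ≃ J) : D.IsStd χ J p q ((D.unitalDual χ).map σ z) := by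
  rcases h with ⟨c, a, hp, hq, rfl⟩ | ⟨hp, hq, c, e, rfl⟩ | rfl
  · refine .inl ⟨c, .map σ a, hp, hq, ?_⟩
    rw [map_smul, ← toUnitalDual_map, map_mon]
  · refine .inr (.inl ⟨hp, hq, c, e.trans σ, ?_⟩)
    rw [map_smul, ← (D.unitalDual χ).map_trans]
  · exact .inr (.inr (map_zero _))

theorem IsStd.smul {I : Type} {p q : ℤ} {z : (D.unitalDual χ).obj I} (h : D.IsStd χ I p q z)
    (r : k) : D.IsStd χ I p q (r • z) := by
  rcases h with ⟨c, a, hp, hq, rfl⟩ | ⟨hp, hq, c, e, rfl⟩ | rfl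
  · exact .inl ⟨r * c, a, hp, hq, smul_smul _ _ _⟩
  · exact .inr (.inl ⟨hp, hq, r * c, e, smul_smul _ _ _⟩)
  · exact .inr (.inr (smul_zero _))

/-- A relabelling of `u` has no inputs, so it cannot occur here. -/
theorem IsStd.exists_of_nonempty {I : Type} [Nonempty I] {p q : ℤ} {z : (D.unitalDual χ).obj I}
    (h : D.IsStd χ I p q z) : z = 0 ∨ ∃ (c : k) (a : Mono D.dualPres.X I),
      a.degree D.dualPres.dg = p ∧ a.degree D.dualPres.wg = q ∧
      z = c • D.toUnitalDual χ I (D.dualPres.mon a) := by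
  rcases h with h | ⟨-, -, -, e, -⟩ | h
  · exact .inr h
  · exact (IsEmpty.false (e.symm (Classical.arbitrary I))).elim
  · exact .inl h

variable (D χ)

theorem u_mem_deg : D.u χ ∈ (D.unitalDual χ).deg (Fin 0) 0 := (D.uPres χ).mon_mem_deg (.gen .u)

/-- The absorption of `u`. A `u` grafted on a composite moves to the factor which owns that input,
until it meets an identity, which returns `u`, or a generator, where the relations apply.
Quantifying over `e` inside the induction lets `u` be grafted at any input. Degree and weight are
recorded for later use with graded forms. -/
theorem isStd_comp_u {I : Type} (a : Mono D.dualPres.X I) : ∀ (K : Type) (e : I ≃ Option K),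
    D.IsStd χ (K ⊕ Fin 0) (a.degree D.dualPres.dg) (a.degree D.dualPres.wg - 1)
      ((D.unitalDual χ).comp ((D.unitalDual χ).map e (D.toUnitalDual χ I (D.dualPres.mon a)))
        (D.u χ)) := by
  induction a with
  | one =>
    intro K e
    obtain ⟨σ, rfl⟩ := exists_optionCongr e (by
      cases h : e none with
      | none => rfl
      | some x =>
        obtain ⟨y, hy⟩ := e.surjective none
        rcases y with _ | y
        · exact h.symm.trans hy
        · exact y.elim)
    rw [← one_eq_mon, toUnitalDual_one, GradedOperad.comp_map_left, (D.unitalDual χ).one_comp,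
      ← (D.unitalDual χ).map_trans]
    exact .inr (.inl ⟨rfl, rfl, 1, _, (one_smul _ _).symm⟩)
  | @gen n x =>
    intro K e
    obtain ⟨p, μ⟩ := x
    cases n with
    | zero => exact (e.symm none).elim0
    | succ m =>
      obtain ⟨σ, hσ⟩ := exists_optionCongr ((finSuccEquiv' (e.symm none)).symm.trans e) (by simp)
      have he : e = (finSuccEquiv' (e.symm none)).trans (Equiv.optionCongr σ) := by
        rw [← hσ, ← Equiv.trans_assoc, Equiv.self_trans_symm, Equiv.refl_trans]
      rw [he, (D.unitalDual χ).map_trans, GradedOperad.comp_map_left]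
      refine IsStd.map ?_ _
      by_cases h : m = 1 ∧ p = 0
      · obtain ⟨rfl, rfl⟩ := h
        refine .inl ⟨χ μ, .map ((Equiv.ofUnique (Option Empty) (Fin 1)).trans
            (Equiv.sumEmpty (Fin 1) (Fin 0)).symm) .one, rfl, rfl, ?_⟩
        rw [← map_mon, toUnitalDual_map, ← one_eq_mon, toUnitalDual_one, toUnitalDual_mon]
        exact D.comp_opElt_u χ μ _
      · refine .inr (.inr ?_)
        rw [toUnitalDual_mon]
        exact D.comp_opElt_u_eq_zero χ h μ _
  | map σ a ih =>
    intro K e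
    rw [← map_mon, toUnitalDual_map, ← (D.unitalDual χ).map_trans]
    exact ih K (σ.trans e)
  | @comp K' J a b iha ihb =>
    intro K e
    rw [← comp_mon, toUnitalDual_comp]
    change D.IsStd χ _ (a.degree D.dualPres.dg + b.degree D.dualPres.dg)
      (a.degree D.dualPres.wg + b.degree D.dualPres.wg - 1) _
    classical
    cases h : e.symm none with
    | inr j =>
      obtain ⟨σ, hσ⟩ := (D.unitalDual χ).map_comp_comp_right (L := Fin 0) e
        (Equiv.optionSubtypeNe j).symm (h.trans (by simp))
      rw [hσ]
      refine IsStd.map ?_ _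
      -- Here the input lies in the upper factor `b`. If `b ∘ u` is itself a multiple of `u`, this
      -- new `u` is grafted on `a`, and the induction hypothesis for `a` finishes.
      rcases ihb _ (Equiv.optionSubtypeNe j).symm with ⟨c, b', hp, hq, hb⟩ | ⟨hp, hq, c, f, hb⟩ | hb
      · rw [hb, map_smul, ← toUnitalDual_comp, comp_mon]
        refine .inl ⟨c, _, ?_, ?_, rfl⟩
        · exact congrArg _ hp
        · refine (congrArg _ hq).trans ?_
          rw [add_sub_assoc]
      · rw [hb, map_smul, GradedOperad.comp_map_right, GradedOperad.map_refl_comp]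
        refine IsStd.smul (IsStd.map ?_ _) _
        rw [hp, add_zero, show a.degree D.dualPres.wg + b.degree D.dualPres.wg - 1 =
          a.degree D.dualPres.wg - 1 by linarith]
        exact iha _ _
      · rw [hb, map_zero]
        exact .inr (.inr rfl)
    | inl i =>
      obtain ⟨σ, hσ⟩ := (D.uPres χ).map_comp_comp_left (L := Fin 0) e
        (Equiv.optionSubtypeNe i).symm (h.trans (by simp))
      rw [hσ _ _ _ (D.u_mem_deg χ)]
      refine IsStd.map ?_ _
      -- Here the input lies in the lower factor `a`. After absorbing `u`, it still has the input on
      -- which `b` is grafted, which excludes the case of a multiple of `u`.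
      rcases (iha _ ((Equiv.optionCongr (Equiv.optionSubtypeNe i).symm).trans
        (optSwap _))).exists_of_nonempty with ha | ⟨c, a', hp, hq, ha⟩
      · rw [ha, map_zero, map_zero, LinearMap.zero_apply]
        exact .inr (.inr rfl)
      · rw [ha, map_smul, map_smul, LinearMap.smul_apply, ← toUnitalDual_map,
          ← toUnitalDual_comp, map_mon, comp_mon]
        refine .inl ⟨c, _, ?_, ?_, rfl⟩
        · exact congrArg (· + _) hp
        · refine (congrArg (· + _) hq).trans ?_
          rw [sub_add_eq_add_sub]

/-- In a composite the lower factor has an input, so it is a multiple of a monomial of `P^!`. If the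
upper factor is a multiple of `u`, the absorption lemma applies. -/
theorem isStd_mon {I : Type} (a : Mono (D.uPres χ).X I) :
    D.IsStd χ I (a.degree (D.uPres χ).dg) (a.degree (D.uPres χ).wg) ((D.uPres χ).mon a) := by
  induction a with
  | one => exact .inl ⟨1, .one, rfl, rfl, (one_smul _ _).symm.trans
      (congrArg _ (D.toUnitalDual_mon χ .one).symm)⟩
  | gen x =>
    cases x with
    | op x => exact .inl ⟨1, .gen x, rfl, rfl, (one_smul _ _).symm.trans
        (congrArg _ (D.toUnitalDual_mon χ (.gen x)).symm)⟩
    | u =>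
      refine .inr (.inl ⟨rfl, rfl, 1, Equiv.refl _, ?_⟩)
      rw [(D.unitalDual χ).map_refl, one_smul]
      rfl
  | map σ a ih =>
    rw [← map_mon]
    exact ih.map σ
  | comp a b iha ihb =>
    rw [← comp_mon]
    change D.IsStd χ _ (a.degree (D.uPres χ).dg + b.degree (D.uPres χ).dg)
      (a.degree (D.uPres χ).wg + b.degree (D.uPres χ).wg) _
    rcases iha.exists_of_nonempty with ha | ⟨c, a', hp, hq, ha⟩
    · rw [ha, map_zero, LinearMap.zero_apply]
      exact .inr (.inr rfl)
    · rw [ha, map_smul, LinearMap.smul_apply]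
      refine IsStd.smul ?_ c
      rcases ihb with ⟨c, b', hp', hq', hb⟩ | ⟨hp', hq', c, f, hb⟩ | hb
      · rw [hb, map_smul, ← toUnitalDual_comp, comp_mon]
        exact .inl ⟨c, _, congrArg₂ _ hp hp', congrArg₂ _ hq hq', rfl⟩
      · rw [hb, map_smul, GradedOperad.comp_map_right, GradedOperad.map_refl_comp]
        refine IsStd.smul (IsStd.map ?_ _) _
        rw [hp', hq', add_zero, ← hp, ← hq]
        exact D.isStd_comp_u χ a' _ _
      · rw [hb, map_zero]
        exact .inr (.inr rfl)

theorem exists_toUnitalDual_of_mem_deg {I : Type} [Nonempty I] {p : ℤ}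
    {x : (D.unitalDual χ).obj I} (hx : x ∈ (D.unitalDual χ).deg I p) :
    ∃ y ∈ D.koszulDualOperad.deg I p, D.toUnitalDual χ I y = x := by
  change x ∈ (D.uPres χ).operad.deg I p at hx
  induction hx using deg_induction with
  | hm a h =>
    rcases (D.isStd_mon χ a).exists_of_nonempty with ha | ⟨c, b, hp, -, ha⟩
    · exact ⟨0, zero_mem _, (map_zero _).trans ha.symm⟩
    · exact ⟨c • D.dualPres.mon b, Submodule.smul_mem _ c (h ▸ hp ▸ D.dualPres.mon_mem_deg b),
        (map_smul _ _ _).trans ha.symm⟩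
  | h0 => exact ⟨0, zero_mem _, map_zero _⟩
  | ha x y _ _ hx hy =>
    obtain ⟨x', hx', rfl⟩ := hx
    obtain ⟨y', hy', rfl⟩ := hy
    exact ⟨x' + y', add_mem hx' hy', map_add _ _ _⟩
  | hs c x _ hx =>
    obtain ⟨x', hx', rfl⟩ := hx
    exact ⟨c • x', Submodule.smul_mem _ c hx', map_smul _ _ _⟩

theorem exists_toUnitalDual_of_mem_wt {I : Type} [Nonempty I] {p : ℤ}
    {x : (D.unitalDual χ).obj I} (hx : x ∈ (D.unitalDual χ).wt I p) :
    ∃ y ∈ D.koszulDualOperad.wt I p, D.toUnitalDual χ I y = x := by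
  change x ∈ (D.uPres χ).operad.wt I p at hx
  induction hx using wt_induction with
  | hm a h =>
    rcases (D.isStd_mon χ a).exists_of_nonempty with ha | ⟨c, b, -, hp, ha⟩
    · exact ⟨0, zero_mem _, (map_zero _).trans ha.symm⟩
    · exact ⟨c • D.dualPres.mon b, Submodule.smul_mem _ c (h ▸ hp ▸ D.dualPres.mon_mem_wt b),
        (map_smul _ _ _).trans ha.symm⟩
  | h0 => exact ⟨0, zero_mem _, map_zero _⟩
  | ha x y _ _ hx hy =>
    obtain ⟨x', hx', rfl⟩ := hx
    obtain ⟨y', hy', rfl⟩ := hy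
    exact ⟨x' + y', add_mem hx' hy', map_add _ _ _⟩
  | hs c x _ hx =>
    obtain ⟨x', hx', rfl⟩ := hx
    exact ⟨c • x', Submodule.smul_mem _ c hx', map_smul _ _ _⟩

theorem toUnitalDual_surjective (I : Type) [Nonempty I] :
    Function.Surjective (D.toUnitalDual χ I) := by
  intro x
  change (D.uPres χ).operad.obj I at x
  induction x using operad_induction with
  | hm a =>
    obtain ⟨y, -, hy⟩ := D.exists_toUnitalDual_of_mem_wt χ ((D.uPres χ).mon_mem_wt a)
    exact ⟨y, hy⟩
  | h0 => exact ⟨0, map_zero _⟩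
  | ha x y hx hy =>
    obtain ⟨x', rfl⟩ := hx
    obtain ⟨y', rfl⟩ := hy
    exact ⟨x' + y', map_add _ _ _⟩
  | hs c x hx =>
    obtain ⟨x', rfl⟩ := hx
    exact ⟨c • x', map_smul _ _ _⟩

/-! ### Arity zero. -/

variable {D}

/-- A composite without inputs has an upper factor without inputs. Following upper factors, one
reaches a nullary generator, which is zero since `E(0) = 0`. -/
theorem ArityFinite.mon_eq_zero (hD : D.ArityFinite) {I : Type} (hI : IsEmpty I)
    (a : Mono D.dualPres.X I) : D.dualPres.mon a = 0 := by
  induction a with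
  | one => exact hI.elim none
  | @gen n x =>
    obtain ⟨p, μ⟩ := x
    cases n with
    | zero =>
      have : μ = 0 := by
        have := hD.zero (((0 : ℕ) : ℤ) - 2 - p)
        have key : ∀ ν : Module.Dual k (D.E.obj 0 (((0 : ℕ) : ℤ) - 2 - p)), ν = 0 := fun ν =>
          LinearMap.ext fun y => by rw [Subsingleton.elim y 0, map_zero, map_zero]
        exact key μ
      rw [this]
      exact map_zero (D.E.koszulDual.gen (D.E.koszulDual.relOf D.dualRel) 0 p)
    | succ n => exact hI.elim 0
  | map σ a ih =>
    rw [← map_mon, ih σ.isEmpty, map_zero]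
  | comp a b iha ihb =>
    rw [← comp_mon, ihb ⟨fun j => hI.elim (.inr j)⟩, map_zero]

theorem ArityFinite.subsingleton (hD : D.ArityFinite) {I : Type} (hI : IsEmpty I) :
    Subsingleton (D.koszulDualOperad.obj I) := by
  refine subsingleton_of_forall_eq 0 fun x => ?_
  change D.dualPres.operad.obj I at x
  induction x using operad_induction with
  | hm a => exact hD.mon_eq_zero hI a
  | h0 => rfl
  | ha x y hx hy => rw [hx, hy, add_zero]
  | hs c x hx => rw [hx, smul_zero]

theorem ArityFinite.unitalDual_mon (hD : D.ArityFinite) (a : Mono (D.uPres χ).X (Fin 0)) :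
    (D.uPres χ).mon a = 0 ∨ (a.degree (D.uPres χ).dg = 0 ∧ a.degree (D.uPres χ).wg = -1 ∧
      ∃ c : k, (D.uPres χ).mon a = c • D.u χ) := by
  rcases D.isStd_mon χ a with ⟨c, b, hp, hq, hb⟩ | ⟨hp, hq, c, f, hb⟩ | hb
  · refine .inl ?_
    rw [hb, hD.mon_eq_zero inferInstance b, map_zero, smul_zero]
  · refine .inr ⟨hp, hq, c, ?_⟩
    rw [hb, Subsingleton.elim f (Equiv.refl _), (D.unitalDual χ).map_refl]
  · exact .inl hb

theorem ArityFinite.exists_smul_u (hD : D.ArityFinite) (x : (D.unitalDual χ).obj (Fin 0)) :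
    ∃ c : k, x = c • D.u χ := by
  change (D.uPres χ).operad.obj (Fin 0) at x
  induction x using operad_induction with
  | hm a =>
    rcases hD.unitalDual_mon χ a with h | ⟨-, -, h⟩
    · exact ⟨0, h.trans (zero_smul _ _).symm⟩
    · exact h
  | h0 => exact ⟨0, (zero_smul _ _).symm⟩
  | ha x y hx hy =>
    obtain ⟨c, rfl⟩ := hx
    obtain ⟨c', rfl⟩ := hy
    exact ⟨c + c', (add_smul _ _ _).symm⟩
  | hs r x hx =>
    obtain ⟨c, rfl⟩ := hx
    exact ⟨r * c, smul_smul _ _ _⟩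

/-- Needed for the finiteness of `u_χ P^!`, for the dual element `u^*`, and above all for `d' u =
0`. -/
theorem ArityFinite.eq_zero_of_mem_wt (hD : D.ArityFinite) {q : ℤ} (hq : q ≠ -1)
    {x : (D.unitalDual χ).obj (Fin 0)} (hx : x ∈ (D.unitalDual χ).wt (Fin 0) q) : x = 0 := by
  change x ∈ (D.uPres χ).operad.wt (Fin 0) q at hx
  induction hx using wt_induction with
  | hm a h =>
    rcases hD.unitalDual_mon χ a with h' | ⟨-, h', -⟩
    · exact h'
    · exact (hq (h.symm.trans h')).elim
  | h0 => rfl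
  | ha x y _ _ hx hy => rw [hx, hy, add_zero]
  | hs c x _ hx => rw [hx, smul_zero]

end QuadraticLinearData

end OperadTwist
end

noncomputable section

namespace OperadTwist

/-! ## Finiteness -/

/-- The components of given arity and weight are finite dimensional and span, and the weights are
bounded below in each arity. -/
structure GradedOperad.LocallyFinite {k : Type u} [Field k] (O : GradedOperad.{u, w} k) :
    Prop where
  bounded : ∀ n, ∃ B : ℤ, ∀ q < B, O.wt (Fin n) q = ⊥
  finite : ∀ n q, Module.Finite k (O.wt (Fin n) q)
  span : ∀ n, ⨆ q, O.wt (Fin n) q = ⊤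

namespace GradedSModule

open Presentation

variable {k : Type u} [Field k] (E : GradedSModule.{u, v} k)
  (extra : ∀ n : ℕ, (Mono E.Homog (Fin n) →₀ k) → Prop)

theorem degree_wg_nonneg {I : Type} (a : Mono (E.pres extra).X I) :
    0 ≤ a.degree (E.pres extra).wg := by
  induction a with
  | one => exact le_rfl
  | gen x => exact zero_le_one
  | map σ a ih => exact ih
  | comp a b iha ihb => exact add_nonneg iha ihb

variable {E extra} in
/-- A monomial of positive weight is obtained by grafting a generator. -/
theorem exists_top {I : Type} (a : Mono (E.pres extra).X I) :
    (∃ σ : Option Empty ≃ I, a.degree (E.pres extra).wg = 0 ∧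
      (E.pres extra).mon a = (E.pres extra).mon (.map σ .one)) ∨
    ∃ (K : Type) (b : Mono (E.pres extra).X (Option K)) (j : ℕ) (x : (E.pres extra).X j)
      (σ : K ⊕ Fin j ≃ I), a.degree (E.pres extra).wg = b.degree (E.pres extra).wg + 1 ∧
      (E.pres extra).mon a = (E.pres extra).mon (.map σ (.comp b (.gen x))) := by
  induction a with
  | one =>
    refine .inl ⟨Equiv.refl _, rfl, ?_⟩
    rw [← map_mon, (E.pres extra).operad.map_refl]
  | @gen n x =>
    -- A generator is written as itself grafted on the identity.
    refine .inr ⟨Empty, .one, n, x, Equiv.emptySum Empty (Fin n), rfl, ?_⟩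
    rw [← map_mon, ← comp_mon, ← one_eq_mon, (E.pres extra).operad.one_comp,
      ← (E.pres extra).operad.map_trans, Equiv.symm_trans_self, (E.pres extra).operad.map_refl]
  | map τ a ih =>
    rcases ih with ⟨σ, h0, h⟩ | ⟨K, b, j, x, σ, h0, h⟩
    · refine .inl ⟨σ.trans τ, h0, ?_⟩
      rw [← map_mon, h, ← map_mon, ← map_mon, (E.pres extra).operad.map_trans]
    · refine .inr ⟨K, b, j, x, σ.trans τ, h0, ?_⟩
      rw [← map_mon, h, ← map_mon, ← map_mon, (E.pres extra).operad.map_trans]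
  | @comp K J a b iha ihb =>
    rcases ihb with ⟨σ, h0, h⟩ | ⟨K', b', j, x, σ, h0, h⟩
    -- An upper factor of this kind is a relabelled identity; grafting it only relabels `a`, and the
    -- form of `a` is inherited.
    · have hc : (E.pres extra).mon (.comp a b) = (E.pres extra).operad.map ((optUnit K).trans
          (Equiv.sumCongr (Equiv.refl K) σ)) ((E.pres extra).mon a) := by
        rw [← comp_mon, h, ← map_mon, GradedOperad.comp_map_right, ← one_eq_mon,
          (E.pres extra).operad.comp_one, ← (E.pres extra).operad.map_trans]
      have hd : (Mono.comp a b).degree (E.pres extra).wg = a.degree (E.pres extra).wg :=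
        (congrArg _ h0).trans (add_zero _)
      rw [hc, hd]
      rcases iha with ⟨τ, h0', h'⟩ | ⟨K', a', j, x, τ, h0', h'⟩
      · refine .inl ⟨τ.trans ((optUnit K).trans (Equiv.sumCongr (Equiv.refl K) σ)), h0', ?_⟩
        rw [h', ← map_mon, ← map_mon]
        simp only [(E.pres extra).operad.map_trans]
      · refine .inr ⟨K', a', j, x,
          τ.trans ((optUnit K).trans (Equiv.sumCongr (Equiv.refl K) σ)), h0', ?_⟩
        rw [h', ← map_mon, ← map_mon]
        simp only [(E.pres extra).operad.map_trans]
    -- Associativity exposes the generator on top of `b` as the top of the composite.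
    · refine .inr ⟨K ⊕ K', .map (optRight K K') (.comp a b'), j, x,
        (Equiv.sumAssoc K K' (Fin j)).trans (Equiv.sumCongr (Equiv.refl K) σ), ?_, ?_⟩
      · exact (congrArg _ h0).trans (add_assoc _ _ _).symm
      · rw [← comp_mon, h, ← map_mon, GradedOperad.comp_map_right, ← comp_mon, ← map_mon,
          ← comp_mon, ← map_mon, ← comp_mon, (E.pres extra).operad.comp_assoc,
          (E.pres extra).operad.map_trans, ← (E.pres extra).operad.map_trans _ (Equiv.sumAssoc _ _ _),
          Equiv.symm_trans_self, (E.pres extra).operad.map_refl]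

theorem wt_eq_bot {I : Type} {q : ℤ} (hq : q < 0) : (E.pres extra).operad.wt I q = ⊥ := by
  refine eq_bot_iff.2 fun x hx => ?_
  induction hx using wt_induction with
  | hm a h => exact (not_lt.2 (h ▸ E.degree_wg_nonneg extra a) hq).elim
  | h0 => exact zero_mem _
  | ha x y _ _ hx hy => exact add_mem hx hy
  | hs c x _ hx => exact Submodule.smul_mem _ c hx

theorem finite_wt_zero (I : Type) [Finite I] :
    Module.Finite k ((E.pres extra).operad.wt I 0) := by
  have hle : (E.pres extra).operad.wt I 0 ≤
      ⨆ σ : Option Empty ≃ I, Submodule.span k {(E.pres extra).operad.map σ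
        (E.pres extra).operad.one} := by
    intro x hx
    induction hx using wt_induction with
    | hm a h =>
      rcases exists_top a with ⟨σ, h0, h1⟩ | ⟨K, b, j, x, σ, h0, h1⟩
      · rw [h1, ← map_mon]
        exact Submodule.mem_iSup_of_mem σ (Submodule.mem_span_singleton_self _)
      · have := E.degree_wg_nonneg extra b
        omega
    | h0 => exact zero_mem _
    | ha x y _ _ hx hy => exact add_mem hx hy
    | hs c x _ hx => exact Submodule.smul_mem _ c hx
  exact Submodule.finiteDimensional_of_le hle

/-- Weight `q + 1` is spanned by the graftings of elements of `E` on elements of weight `q`. The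
arities of the two factors are bounded by the number of inputs, so finitely many finite dimensional
images suffice. -/
theorem finite_wt (hE : ∀ j, Module.Finite k (E.T1 j)) (q : ℕ) : ∀ (I : Type) [Finite I],
    Module.Finite k ((E.pres extra).operad.wt I q) := by
  induction q with
  | zero => exact fun I _ => E.finite_wt_zero extra I
  | succ q ih =>
    intro I _
    let G : ∀ j, Submodule k ((E.pres extra).operad.obj (Fin j)) := fun j =>
      LinearMap.range (E.ev1 extra j)
    let W : ∀ m, Submodule k ((E.pres extra).operad.obj (Option (Fin m))) := fun m =>
      (E.pres extra).operad.wt (Option (Fin m)) q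
    have hfin : ∀ m, Module.Finite k (W m) := fun m => ih _
    have hle : (E.pres extra).operad.wt I (q + 1 : ℕ) ≤
        ⨆ i : Σ (m : Fin (Nat.card I + 1)) (j : Fin (Nat.card I + 1)), (Fin m ⊕ Fin j ≃ I),
          (Submodule.map₂ (E.pres extra).operad.comp (W i.1) (G i.2.1)).map
            ((E.pres extra).operad.map i.2.2) := by
      intro x hx
      induction hx using wt_induction with
      | hm a h =>
        rcases exists_top a with ⟨σ, h0, h1⟩ | ⟨K, b, j, x, σ, h0, h1⟩
        · rw [h] at h0
          omega
        · have : Finite K := by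
            have := b.finite
            exact Finite.of_injective some (Option.some_injective K)
          -- The label set `K` is arbitrary; replacing it by `Fin m` leaves a finite index set of
          -- shapes and labellings.
          obtain ⟨m, ⟨τ⟩⟩ := Finite.exists_equiv_fin K
          have hcard : m + j = Nat.card I := by
            rw [← Nat.card_congr σ, Nat.card_sum, Nat.card_congr τ, Nat.card_fin, Nat.card_fin]
          refine Submodule.mem_iSup_of_mem ⟨⟨m, by omega⟩, ⟨j, by omega⟩,
            (Equiv.sumCongr τ.symm (Equiv.refl _)).trans σ⟩ ?_
          refine ⟨_, Submodule.apply_mem_map₂ _ (m := (E.pres extra).mon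
            (.map (Equiv.optionCongr τ) b)) (n := (E.pres extra).mon (.gen x)) ?_ ?_, ?_⟩
          · have hb : Mono.degree (E.pres extra).wg (.map (Equiv.optionCongr τ) b) = (q : ℤ) := by
              change b.degree (E.pres extra).wg = q
              rw [h] at h0
              push_cast at h0
              omega
            have := (E.pres extra).mon_mem_wt (.map (Equiv.optionCongr τ) b)
            rw [hb] at this
            exact this
          · refine ⟨DirectSum.lof k ℤ _ x.1 x.2, ?_⟩
            rw [ev1, DirectSum.toModule_lof]
            rfl
          · have hτ : (Equiv.sumCongr τ (Equiv.refl (Fin j))).trans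
                (Equiv.sumCongr τ.symm (Equiv.refl (Fin j))) = Equiv.refl _ := by
              ext1 y
              rcases y with y | y <;> simp
            change (E.pres extra).operad.map ((Equiv.sumCongr τ.symm (Equiv.refl (Fin j))).trans σ)
              _ = _
            rw [h1, ← map_mon, GradedOperad.comp_map_left, (E.pres extra).operad.map_trans,
              ← (E.pres extra).operad.map_trans _ (Equiv.sumCongr τ.symm _), hτ,
              (E.pres extra).operad.map_refl, comp_mon, map_mon]
      | h0 => exact zero_mem _
      | ha x y _ _ hx hy => exact add_mem hx hy
      | hs c x _ hx => exact Submodule.smul_mem _ c hx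
    have hG : ∀ j, (G j).FG := fun j => by
      have := hE j
      exact Module.Finite.iff_fg.1 inferInstance
    have : ∀ i : Σ (m : Fin (Nat.card I + 1)) (j : Fin (Nat.card I + 1)), (Fin m ⊕ Fin j ≃ I),
        Module.Finite k ((Submodule.map₂ (E.pres extra).operad.comp (W i.1) (G i.2.1)).map
            ((E.pres extra).operad.map i.2.2)) := fun i =>
      Module.Finite.iff_fg.2 (((Module.Finite.iff_fg.1 (hfin _)).map₂ _ (hG _)).map _)
    exact Submodule.finiteDimensional_of_le hle

theorem locallyFinite (hE : ∀ j, Module.Finite k (E.T1 j)) :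
    (E.pres extra).operad.LocallyFinite where
  bounded _ := ⟨0, fun _ hq => E.wt_eq_bot extra hq⟩
  finite n q := by
    rcases lt_or_ge q 0 with hq | hq
    · rw [E.wt_eq_bot extra hq]
      infer_instance
    · obtain ⟨q, rfl⟩ := Int.eq_ofNat_of_zero_le hq
      exact E.finite_wt extra hE q _
  span n := (E.pres extra).iSup_wt (Fin n)

/-- The reindexing `p ↦ n - 2 - p` is injective, so `E^∨(n)` embeds in the full linear dual of
`E(n)`. -/
theorem finite_koszulDual (n : ℕ) (h : Module.Finite k (E.T1 n)) :
    Module.Finite k (E.koszulDual.T1 n) := by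
  let f : E.koszulDual.T1 n →ₗ[k] Module.Dual k (E.T1 n) :=
    DirectSum.toModule k ℤ _ fun p => (DirectSum.component k ℤ (E.obj n) ((n : ℤ) - 2 - p)).dualMap
  have hf : ∀ (x : E.koszulDual.T1 n) (p : ℤ) (e : E.obj n ((n : ℤ) - 2 - p)),
      f x (DirectSum.lof k ℤ (E.obj n) _ e) =
        (show Module.Dual k (E.obj n ((n : ℤ) - 2 - p)) from x p) e := by
    intro x p e
    induction x using DirectSum.induction_on with
    | zero => rw [map_zero]; rfl
    | of q y =>
      change f (DirectSum.lof k ℤ _ q y) _ = (show Module.Dual k (E.obj n ((n : ℤ) - 2 - p)) from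
        DirectSum.of (E.koszulDual.obj n) q y p) e
      rw [show f (DirectSum.lof k ℤ _ q y) = _ from DirectSum.toModule_lof _ _ _]
      by_cases hpq : q = p
      · subst hpq
        rw [DirectSum.of_eq_same]
        change (show Module.Dual k (E.obj n ((n : ℤ) - 2 - q)) from y)
          (DirectSum.component k ℤ (E.obj n) _ (DirectSum.lof k ℤ (E.obj n) _ e)) = _
        rw [DirectSum.component.lof_self]
      · rw [DirectSum.of_eq_of_ne _ _ _ (Ne.symm hpq)]
        change (show Module.Dual k (E.obj n ((n : ℤ) - 2 - q)) from y)
          (DirectSum.component k ℤ (E.obj n) _ (DirectSum.lof k ℤ (E.obj n) _ e)) = 0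
        rw [DirectSum.component.of, dif_neg (fun h' => hpq (by omega))]
        exact map_zero (show Module.Dual k (E.obj n ((n : ℤ) - 2 - q)) from y)
    | add x y hx hy =>
      rw [map_add, LinearMap.add_apply, hx, hy]
      rfl
  refine Module.Finite.of_injective f ((injective_iff_map_eq_zero f).2 fun x hx => ?_)
  refine DFinsupp.ext fun p => LinearMap.ext fun e => ?_
  exact (hf x p e).symm.trans (by rw [hx]; rfl)

end GradedSModule

/-! ### Finiteness of `P^!` and of its unital extension. -/

namespace QuadraticLinearData

open Presentation

variable {k : Type u} [Field k] {D : QuadraticLinearData.{u, v} k}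

theorem ArityFinite.locallyFinite (hD : D.ArityFinite) : D.koszulDualOperad.LocallyFinite :=
  D.E.koszulDual.locallyFinite _ fun j => D.E.finite_koszulDual j (hD.finite j)

theorem ArityFinite.locallyFinite_unitalDual (hD : D.ArityFinite)
    (χ : D.E.koszulDual.obj 2 0 →ₗ[k] k) : (D.unitalDual χ).LocallyFinite where
  bounded n := by
    cases n with
    | zero =>
      exact ⟨-1, fun q hq => eq_bot_iff.2 fun x hx => hD.eq_zero_of_mem_wt χ hq.ne hx⟩
    | succ n =>
      obtain ⟨B, hB⟩ := hD.locallyFinite.bounded (n + 1)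
      refine ⟨B, fun q hq => eq_bot_iff.2 fun x hx => ?_⟩
      obtain ⟨y, hy, rfl⟩ := D.exists_toUnitalDual_of_mem_wt χ hx
      rw [hB q hq] at hy
      rw [(Submodule.mem_bot k).1 hy, map_zero]
      exact zero_mem _
  finite n q := by
    cases n with
    | zero =>
      have : (⊤ : Submodule k ((D.unitalDual χ).obj (Fin 0))) ≤ Submodule.span k {D.u χ} := by
        intro x _
        obtain ⟨c, rfl⟩ := hD.exists_smul_u χ x
        exact Submodule.smul_mem _ c (Submodule.mem_span_singleton_self _)
      exact Submodule.finiteDimensional_of_le (le_top.trans this)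
    | succ n =>
      have := hD.locallyFinite.finite (n + 1) q
      have hle : (D.unitalDual χ).wt (Fin (n + 1)) q ≤
          (D.koszulDualOperad.wt (Fin (n + 1)) q).map (D.toUnitalDual χ (Fin (n + 1))) :=
        fun x hx => D.exists_toUnitalDual_of_mem_wt χ hx
      exact Submodule.finiteDimensional_of_le hle
  span n := (D.uPres χ).iSup_wt (Fin n)

end QuadraticLinearData

end OperadTwist
end

noncomputable section

namespace OperadTwist

/-! ## Linear duals of locally finite operads -/

namespace GradedOperad

variable {k : Type u} [Field k] (O : GradedOperad.{u, w} k)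

theorem dualEval_tmul {m n : ℕ} (φ : O.grDual m) (ψ : O.grDual n) (x : O.obj (Fin m))
    (y : O.obj (Fin n)) : O.dualEval m n (φ ⊗ₜ ψ) (x ⊗ₜ y) =
      (φ : Module.Dual k (O.obj (Fin m))) x * (ψ : Module.Dual k (O.obj (Fin n))) y := rfl

/-- A tensor is a finite sum `∑ φᵢ ⊗ bᵢ` over a basis of the second factor. Fixing `x`, its
evaluation is the form `∑ φᵢ(x) bᵢ`, and linear independence recovers each `φᵢ(x)`. No finiteness is
needed. -/
theorem dualEval_injective (m n : ℕ) : Function.Injective (O.dualEval m n) := by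
  intro t t' ht
  let b := Module.Basis.ofVectorSpace k (O.grDual n)
  obtain ⟨c, rfl⟩ := TensorProduct.eq_repr_basis_right b t
  obtain ⟨c', rfl⟩ := TensorProduct.eq_repr_basis_right b t'
  have key : ∀ (c : _ →₀ O.grDual m) (x : O.obj (Fin m)) (y : O.obj (Fin n)),
      O.dualEval m n (c.sum fun i φ => φ ⊗ₜ b i) (x ⊗ₜ y) =
        ((Finsupp.linearCombination k b (c.mapRange
          (fun φ : O.grDual m => (φ : Module.Dual k (O.obj (Fin m))) x) rfl) : O.grDual n) :
            Module.Dual k (O.obj (Fin n))) y := by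
    intro c x y
    rw [Finsupp.linearCombination_apply, Finsupp.sum_mapRange_index (by simp), Finsupp.sum,
      Finsupp.sum, map_sum, LinearMap.sum_apply, Submodule.coe_sum, LinearMap.sum_apply]
    rfl
  have hc : c = c' := by
    refine Finsupp.ext fun i => Subtype.ext (LinearMap.ext fun x => ?_)
    have h : Finsupp.linearCombination k b (c.mapRange
          (fun φ : O.grDual m => (φ : Module.Dual k (O.obj (Fin m))) x) rfl) =
        Finsupp.linearCombination k b (c'.mapRange
          (fun φ : O.grDual m => (φ : Module.Dual k (O.obj (Fin m))) x) rfl) :=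
      Subtype.ext (LinearMap.ext fun y => by rw [← key, ← key, ht])
    have h' := congrArg (fun f => f i) (b.linearIndependent h)
    simpa only [Finsupp.mapRange_apply] using h'
  rw [hc]

/-- Partial composition with arbitrary labels. -/
def graftE {m j n : ℕ} (e : Fin m ⊕ Fin j ≃ Fin n) :
    O.obj (Fin (m + 1)) →ₗ[k] O.obj (Fin j) →ₗ[k] O.obj (Fin n) :=
  ((O.comp (K := Fin m) (J := Fin j)).compr₂ (O.map e)).comp (O.map (finSuccEquiv m))

theorem graftE_apply {m j n : ℕ} (e : Fin m ⊕ Fin j ≃ Fin n) (x : O.obj (Fin (m + 1)))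
    (y : O.obj (Fin j)) :
    O.graftE e x y = O.map e (O.comp (O.map (finSuccEquiv m) x) y) := rfl

/-- The component of the infinitesimal decomposition dual to `graftE e`. -/
def decompE {m j n : ℕ} (e : Fin m ⊕ Fin j ≃ Fin n) :
    O.grDual n →ₗ[k] O.grDual (m + 1) ⊗[k] O.grDual j :=
  (leftInv (O.dualEval (m + 1) j)).comp
    ((TensorProduct.lift (O.graftE e)).dualMap.comp (O.grDual n).subtype)

variable {O}

/-- The working tool for computing decompositions: it suffices to exhibit a tensor with the right
evaluations, since `dualEval` is injective. -/
theorem decompE_eq {m j n : ℕ} (e : Fin m ⊕ Fin j ≃ Fin n) (φ : O.grDual n)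
    (t : O.grDual (m + 1) ⊗[k] O.grDual j)
    (h : ∀ x y, O.dualEval _ _ t (x ⊗ₜ y) =
      (φ : Module.Dual k (O.obj (Fin n))) (O.graftE e x y)) : O.decompE e φ = t := by
  have : (TensorProduct.lift (O.graftE e)).dualMap φ = O.dualEval _ _ t :=
    TensorProduct.ext' fun x y => (h x y).symm
  change leftInv _ ((TensorProduct.lift (O.graftE e)).dualMap φ) = t
  rw [this]
  exact leftInv_apply _ (O.dualEval_injective _ _) t

/-- Bilinear forms of bounded weight are represented by tensors. -/
theorem LocallyFinite.exists_tensor (hO : O.LocallyFinite) (m n : ℕ)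
    (B : O.obj (Fin m) →ₗ[k] Module.Dual k (O.obj (Fin n))) (N : ℤ)
    (hB : ∀ q q', N < q + q' → ∀ x ∈ O.wt (Fin m) q, ∀ y ∈ O.wt (Fin n) q', B x y = 0) :
    ∃ t, ∀ x y, O.dualEval m n t (x ⊗ₜ y) = B x y := by
  obtain ⟨b, hb⟩ := hO.bounded m
  obtain ⟨b', hb'⟩ := hO.bounded n
  -- Weights of the second argument are at least `b'`, so a large weight of the first argument alone
  -- pushes the total weight above `N`. The same holds with the arguments exchanged.
  have hx : ∀ q, N - b' < q → ∀ x ∈ O.wt (Fin m) q, B x = 0 := by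
    intro q hq x hx
    refine LinearMap.ext fun y => ?_
    have hy : y ∈ ⨆ q', O.wt (Fin n) q' := by rw [hO.span]; trivial
    refine Submodule.iSup_induction _ (motive := fun y => B x y = 0) hy ?_ (map_zero _) ?_
    · intro q' y hy
      rcases lt_or_ge q' b' with h | h
      · rw [hb' q' h] at hy
        rw [(Submodule.mem_bot k).1 hy, map_zero]
      · exact hB q q' (by omega) x hx y hy
    · intro y y' h h'
      rw [map_add, h, h', add_zero]
  have hy : ∀ q', N - b < q' → ∀ x, ∀ y ∈ O.wt (Fin n) q', B x y = 0 := by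
    intro q' hq' x y hy
    have hx : x ∈ ⨆ q, O.wt (Fin m) q := by rw [hO.span]; trivial
    refine Submodule.iSup_induction _ (motive := fun x => B x y = 0) hx ?_ (by simp) ?_
    · intro q x hx
      rcases lt_or_ge q b with h | h
      · rw [hb q h] at hx
        rw [(Submodule.mem_bot k).1 hx, map_zero, LinearMap.zero_apply]
      · exact hB q q' (by omega) x hx y hy
    · intro x x' h h'
      rw [map_add, LinearMap.add_apply, h, h', add_zero]
  -- Only the weights between `b` and `N - b'` contribute, each with a finite dimensional piece, so
  -- `B` has finite rank.
  have hfin : Module.Finite k (LinearMap.range B) := by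
    have := hO.finite m
    have hle : LinearMap.range B ≤ ⨆ q : Finset.Icc b (N - b'), (O.wt (Fin m) q).map B := by
      rintro _ ⟨x, rfl⟩
      have hx' : x ∈ ⨆ q, O.wt (Fin m) q := by rw [hO.span]; trivial
      refine Submodule.iSup_induction _ (motive := fun x => B x ∈ _) hx' ?_ ?_ ?_
      · intro q x hxq
        by_cases h : q ∈ Finset.Icc b (N - b')
        · exact Submodule.mem_iSup_of_mem (p := fun q : Finset.Icc b (N - b') =>
            (O.wt (Fin m) q).map B) ⟨q, h⟩ ⟨x, hxq, rfl⟩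
        · have : B x = 0 := by
            rw [Finset.mem_Icc, not_and_or, not_le, not_le] at h
            rcases h with h | h
            · rw [hb q h] at hxq
              rw [(Submodule.mem_bot k).1 hxq, map_zero]
            · exact hx q h x hxq
          rw [this]
          exact zero_mem _
      · rw [map_zero]
        exact zero_mem _
      · intro x y hx hy
        rw [map_add]
        exact add_mem hx hy
    exact Submodule.finiteDimensional_of_le hle
  have : Module.Free k (LinearMap.range B) := by
    let _ : AddCommGroup (LinearMap.range B) := Module.addCommMonoidToAddCommGroup k
    infer_instance
  -- For a basis `cᵢ` of the range, the tensor is `∑ (cᵢ^* ∘ B) ⊗ cᵢ`; both factors vanish in large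
  -- weights by the two bounds above.
  let c := Module.finBasis k (LinearMap.range B)
  let f : ∀ i, O.grDual m := fun i => ⟨(c.coord i).comp B.rangeRestrict, N - b', fun q hq x hxq => by
    have : B.rangeRestrict x = 0 := Subtype.ext (hx q hq x hxq)
    rw [LinearMap.comp_apply, this, map_zero]⟩
  let g : ∀ i, O.grDual n := fun i => ⟨(c i : Module.Dual k (O.obj (Fin n))), N - b,
    fun q hq y hyq => by
      obtain ⟨x, hx⟩ := (c i).2
      rw [← hx]
      exact hy q hq x y hyq⟩
  refine ⟨∑ i, f i ⊗ₜ g i, fun x y => ?_⟩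
  rw [map_sum, LinearMap.sum_apply]
  have h := congrArg (fun z : LinearMap.range B => (z : Module.Dual k (O.obj (Fin n))) y)
    (c.sum_repr (B.rangeRestrict x))
  simp only [Submodule.coe_sum, LinearMap.sum_apply, Submodule.coe_smul, LinearMap.smul_apply] at h
  exact h

theorem wt_graftE {m j n : ℕ} (e : Fin m ⊕ Fin j ≃ Fin n) (p q : ℤ) (x : O.obj (Fin (m + 1)))
    (y : O.obj (Fin j)) (hx : x ∈ O.wt _ p) (hy : y ∈ O.wt _ q) :
    O.graftE e x y ∈ O.wt (Fin n) (p + q) :=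
  O.wt_map _ _ _ (O.wt_comp _ _ _ _ (O.wt_map _ _ _ hx) hy)

theorem LocallyFinite.dualEval_decompE (hO : O.LocallyFinite) {m j n : ℕ}
    (e : Fin m ⊕ Fin j ≃ Fin n) (φ : O.grDual n) (x : O.obj (Fin (m + 1))) (y : O.obj (Fin j)) :
    O.dualEval _ _ (O.decompE e φ) (x ⊗ₜ y) =
      (φ : Module.Dual k (O.obj (Fin n))) (O.graftE e x y) := by
  obtain ⟨φ, N, hφ⟩ := φ
  obtain ⟨t, ht⟩ := hO.exists_tensor (m + 1) j ((O.graftE e).compr₂ φ) N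
    fun q q' h x hx y hy => hφ _ h _ (wt_graftE e q q' x y hx hy)
  rw [decompE_eq e ⟨φ, N, hφ⟩ t ht, ht]
  rfl

/-- A form of degree `j`. -/
def DualDeg (O : GradedOperad.{u, w} k) {n : ℕ} (j : ℤ) (φ : O.grDual n) : Prop :=
  ∀ q, q ≠ -j → ∀ x ∈ O.deg (Fin n) q, (φ : Module.Dual k (O.obj (Fin n))) x = 0

end GradedOperad

/-! ### Decomposition of forms by degree. -/

namespace Presentation

variable {k : Type u} [Field k] {Q : Presentation.{u, v} k}

theorem exists_finset_proj_of_fg (hQ : Q.IsHomogeneous) {I : Type}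
    (W : Submodule k (Q.operad.obj I)) (hW : W.FG) : ∃ P : Finset ℤ, ∀ P', P ⊆ P' → ∀ x ∈ W,
      ∑ p ∈ P', proj hQ p I x = x := by
  induction W, hW using Submodule.fg_induction with
  | singleton x =>
    obtain ⟨P, hP⟩ := exists_finset_proj hQ x
    refine ⟨P, fun P' h y hy => ?_⟩
    obtain ⟨c, rfl⟩ := Submodule.mem_span_singleton.1 hy
    simp only [map_smul, ← Finset.smul_sum]
    rw [hP P' h]
  | sup N₁ N₂ _ _ h₁ h₂ =>
    obtain ⟨P₁, h₁⟩ := h₁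
    obtain ⟨P₂, h₂⟩ := h₂
    refine ⟨P₁ ∪ P₂, fun P' h y hy => ?_⟩
    obtain ⟨y₁, hy₁, y₂, hy₂, rfl⟩ := Submodule.mem_sup.1 hy
    simp only [map_add, Finset.sum_add_distrib]
    rw [h₁ P' (Finset.union_subset_left h) y₁ hy₁, h₂ P' (Finset.union_subset_right h) y₂ hy₂]

/-- Forms on an operad with homogeneous relations are sums of homogeneous forms. -/
theorem grDual_mem_span (hQ : Q.IsHomogeneous) (hO : Q.operad.LocallyFinite) (n : ℕ)
    (φ : Q.operad.grDual n) :
    φ ∈ Submodule.span k {ψ : Q.operad.grDual n | ∃ j, Q.operad.DualDeg j ψ} := by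
  obtain ⟨φ, N, hφ⟩ := φ
  obtain ⟨b, hb⟩ := hO.bounded n
  -- On weight pieces, the form is nonzero only for weights in `[b, N]`. Their sum `W` is finite
  -- dimensional, so finitely many degrees occur in it.
  let W : Submodule k (Q.operad.obj (Fin n)) :=
    ⨆ q : Finset.Icc b N, Q.operad.wt (Fin n) q
  have hW : W.FG := by
    have := hO.finite n
    exact Module.Finite.iff_fg.1 inferInstance
  obtain ⟨P, hP⟩ := exists_finset_proj_of_fg hQ W hW
  let ψ : ℤ → Q.operad.grDual n := fun p => ⟨φ.comp (proj hQ p (Fin n)), N, fun q hq x hx =>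
    hφ q hq _ (proj_mem_wt hQ p q hx)⟩
  have hsum : (⟨φ, N, hφ⟩ : Q.operad.grDual n) = ∑ p ∈ P, ψ p := by
    refine Subtype.ext (LinearMap.ext fun x => ?_)
    rw [Submodule.coe_sum, LinearMap.sum_apply]
    change φ x = ∑ p ∈ P, φ (proj hQ p (Fin n) x)
    have hx : x ∈ ⨆ q, Q.operad.wt (Fin n) q := by rw [hO.span]; trivial
    refine Submodule.iSup_induction _
      (motive := fun x => φ x = ∑ p ∈ P, φ (proj hQ p (Fin n) x)) hx ?_ (by simp) ?_
    · intro q x hx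
      rcases lt_or_ge q b with h | h
      · rw [hb q h] at hx
        rw [(Submodule.mem_bot k).1 hx]
        simp
      · rcases lt_or_ge N q with h' | h'
        · rw [hφ q h' x hx, Finset.sum_eq_zero]
          exact fun p _ => hφ q h' _ (proj_mem_wt hQ p q hx)
        · rw [← map_sum, hP P subset_rfl x (Submodule.mem_iSup_of_mem
            (p := fun q : Finset.Icc b N => Q.operad.wt (Fin n) q)
            ⟨q, Finset.mem_Icc.2 ⟨h, h'⟩⟩ hx)]
    · intro x y hx hy
      simp only [map_add, Finset.sum_add_distrib]
      rw [hx, hy]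
  rw [hsum]
  refine Submodule.sum_mem _ fun p _ => Submodule.subset_span ⟨-p, fun q hq x hx => ?_⟩
  change φ (proj hQ p (Fin n) x) = 0
  rw [proj_of_mem hQ q p hx, if_neg (by rwa [neg_neg] at hq), map_zero]

end Presentation

end OperadTwist
end

noncomputable section

namespace OperadTwist

/-! ## Multilinear operations on complete graded modules -/

namespace CompleteGradedModule

variable {k : Type u} [Field k] {A : Type w} [AddCommGroup A] [Module k A]
  (M : CompleteGradedModule k A)

theorem proj_of_mem {p : ℤ} {x : A} (hx : x ∈ M.deg p) (c : ZMod 2) :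
    M.proj c x = if (p : ZMod 2) = c then x else 0 := by
  rw [proj, LinearMap.comp_apply]
  change DirectSum.toModule k ℤ A _ (DirectSum.decompose M.deg x) = _
  rw [DirectSum.decompose_of_mem M.deg hx]
  refine (DirectSum.toModule_lof k p _).trans ?_
  split_ifs
  · rfl
  · rfl

theorem homogeneous_induction {P : A → Prop} (h0 : P 0) (hadd : ∀ x y, P x → P y → P (x + y))
    (hdeg : ∀ p, ∀ x ∈ M.deg p, P x) (x : A) : P x :=
  DirectSum.Decomposition.inductionOn M.deg h0 (fun m => hdeg _ _ m.2) (fun _ _ => hadd _ _) x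

theorem proj_proj (c c' : ZMod 2) (x : A) :
    M.proj c (M.proj c' x) = if c' = c then M.proj c' x else 0 := by
  induction x using M.homogeneous_induction with
  | h0 => simp
  | hadd x y hx hy =>
    rw [map_add, map_add, hx, hy]
    split_ifs
    · rfl
    · exact add_zero _
  | hdeg p x hx =>
    rw [M.proj_of_mem hx]
    by_cases h : (p : ZMod 2) = c'
    · rw [if_pos h, M.proj_of_mem hx, h]
    · rw [if_neg h, map_zero, ite_self]

theorem sum_proj (x : A) : ∑ c, M.proj c x = x := by
  induction x using M.homogeneous_induction with
  | h0 => simp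
  | hadd x y hx hy => simp only [map_add, Finset.sum_add_distrib, hx, hy]
  | hdeg p x hx => simp only [M.proj_of_mem hx, Finset.sum_ite_eq, Finset.mem_univ, if_true]

theorem inv_of_proj_zero {x : A} (hx : M.proj 0 x = x) : M.inv x = x := by
  have h : M.proj 1 x = 0 := by
    rw [← hx, proj_proj]
    rfl
  rw [inv, LinearMap.sub_apply, hx, h, sub_zero]

theorem decompose_proj (c : ZMod 2) (x : A) (p : ℤ) :
    (DirectSum.decompose M.deg (M.proj c x) p : A) =
      if (p : ZMod 2) = c then (DirectSum.decompose M.deg x p : A) else 0 := by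
  induction x using M.homogeneous_induction with
  | h0 => simp
  | hadd x y hx hy =>
    rw [map_add, DirectSum.decompose_add, DirectSum.add_apply, Submodule.coe_add, hx, hy,
      DirectSum.decompose_add, DirectSum.add_apply, Submodule.coe_add]
    split_ifs
    · rfl
    · exact add_zero _
  | hdeg q x hx =>
    rw [M.proj_of_mem hx]
    by_cases h : p = q
    · subst h
      split_ifs <;> simp
    · have h0 : (DirectSum.decompose M.deg x p : A) = 0 :=
        DirectSum.decompose_of_mem_ne M.deg hx (Ne.symm h)
      rw [h0, ite_self]
      split_ifs
      · exact h0
      · simp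

theorem proj_mem_fil {m : ℕ} {x : A} (hx : x ∈ M.fil m) (c : ZMod 2) : M.proj c x ∈ M.fil m := by
  classical
  rw [← DirectSum.sum_support_decompose M.deg (M.proj c x)]
  refine Submodule.sum_mem _ fun p _ => ?_
  rw [decompose_proj]
  split_ifs
  · exact M.fil_homogeneous m x hx p
  · exact zero_mem _

theorem inv_mem_fil {m : ℕ} {x : A} (hx : x ∈ M.fil m) : M.inv x ∈ M.fil m :=
  sub_mem (M.proj_mem_fil hx 0) (M.proj_mem_fil hx 1)

/-- Multilinear maps are determined by their values on arguments of definite parities. -/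
theorem multilinear_ext {n : ℕ} {F G : MultilinearMap k (fun _ : Fin n => A) A}
    (h : ∀ (c : Fin n → ZMod 2) (x : Fin n → A), (∀ i, M.proj (c i) (x i) = x i) → F x = G x) :
    F = G := by
  refine MultilinearMap.ext fun x => ?_
  have hx : x = fun i => ∑ c ∈ (Finset.univ : Finset (ZMod 2)), M.proj c (x i) :=
    funext fun i => (M.sum_proj (x i)).symm
  rw [hx, F.map_sum_finset (fun i c => M.proj c (x i)), G.map_sum_finset (fun i c => M.proj c (x i))]
  exact Finset.sum_congr rfl fun r _ => h r _ fun i => by rw [proj_proj, if_pos rfl]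

/-- Multiplication of the values on arguments of parities `c` by the sign `s c`. -/
def signed {n : ℕ} (s : (Fin n → ZMod 2) → ℤˣ) (F : MultilinearMap k (fun _ : Fin n => A) A) :
    MultilinearMap k (fun _ : Fin n => A) A :=
  ∑ c : Fin n → ZMod 2, s c • M.parityPart F c

theorem signed_apply {n : ℕ} (s : (Fin n → ZMod 2) → ℤˣ)
    (F : MultilinearMap k (fun _ : Fin n => A) A) (c : Fin n → ZMod 2) (x : Fin n → A)
    (hx : ∀ i, M.proj (c i) (x i) = x i) : M.signed s F x = s c • F x := by
  rw [signed, sum_apply, Finset.sum_eq_single c]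
  · change s c • F (fun i => M.proj (c i) (x i)) = _
    rw [funext hx]
  · intro c' _ hc'
    obtain ⟨i, hi⟩ := Function.ne_iff.1 hc'
    change s c' • F (fun i => M.proj (c' i) (x i)) = 0
    rw [F.map_coord_zero i, smul_zero]
    rw [← hx i, proj_proj, if_neg (Ne.symm hi)]
  · exact fun h => (h (Finset.mem_univ c)).elim

theorem signed_endFil {n m : ℕ} (s : (Fin n → ZMod 2) → ℤˣ)
    {F : MultilinearMap k (fun _ : Fin n => A) A} (hF : M.endFil m F) :
    M.endFil m (M.signed s F) := by
  intro l x hx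
  rw [signed, sum_apply]
  refine Submodule.sum_mem _ fun c _ => ?_
  change s c • F (fun i => M.proj (c i) (x i)) ∈ _
  rw [Units.smul_def]
  exact zsmul_mem (hF l _ fun i => M.proj_mem_fil (hx i) _) _

/-- Partial composition in `End_A` with arbitrary labels and signs. -/
def endCompE {m j n : ℕ} (f : Fin j ⊕ Fin m ≃ Fin n) (s : (Fin n → ZMod 2) → ℤˣ) :
    MultilinearMap k (fun _ : Fin (m + 1) => A) A →ₗ[k]
      MultilinearMap k (fun _ : Fin j => A) A →ₗ[k]
        MultilinearMap k (fun _ : Fin n => A) A :=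
  LinearMap.mk₂ k
    (fun F G => M.signed s (((F.curryLeft.compMultilinearMap G).uncurrySum).domDomCongr f))
    (fun F F' G => by
      simp only [signed, ← Finset.sum_add_distrib, ← smul_add]
      refine Finset.sum_congr rfl fun c _ => congrArg _ ?_
      ext y
      rfl)
    (fun r F G => by
      simp only [signed, Finset.smul_sum]
      refine Finset.sum_congr rfl fun c _ => ?_
      rw [smul_comm]
      refine congrArg _ ?_
      ext y
      rfl)
    (fun F G G' => by
      simp only [signed, ← Finset.sum_add_distrib, ← smul_add]
      refine Finset.sum_congr rfl fun c _ => congrArg _ ?_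
      ext y
      simp [parityPart, MultilinearMap.uncurrySum_apply])
    (fun r F G => by
      simp only [signed, Finset.smul_sum]
      refine Finset.sum_congr rfl fun c _ => ?_
      rw [smul_comm]
      refine congrArg _ ?_
      ext y
      simp [parityPart, MultilinearMap.uncurrySum_apply])

theorem endCompE_apply {m j n : ℕ} (f : Fin j ⊕ Fin m ≃ Fin n) (s : (Fin n → ZMod 2) → ℤˣ)
    (F : MultilinearMap k (fun _ : Fin (m + 1) => A) A)
    (G : MultilinearMap k (fun _ : Fin j => A) A) (c : Fin n → ZMod 2) (x : Fin n → A)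
    (hx : ∀ i, M.proj (c i) (x i) = x i) :
    M.endCompE f s F G x =
      s c • F (Fin.cons (G fun i => x (f (.inl i))) fun i => x (f (.inr i))) :=
  M.signed_apply s _ c x hx

theorem endCompE_endFil {m j n p q : ℕ} (f : Fin j ⊕ Fin m ≃ Fin n)
    (s : (Fin n → ZMod 2) → ℤˣ) {F : MultilinearMap k (fun _ : Fin (m + 1) => A) A}
    {G : MultilinearMap k (fun _ : Fin j => A) A} (hF : M.endFil p F) (hG : M.endFil q G) :
    M.endFil (p + q) (M.endCompE f s F G) := by
  refine M.signed_endFil s fun l x hx => ?_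
  have h := hF (Fin.cons (∑ i, l (f (.inl i)) + q) fun i => l (f (.inr i)))
    (Fin.cons (G fun i => x (f (.inl i))) fun i => x (f (.inr i))) (fun i => by
      refine Fin.cases ?_ (fun i => ?_) i
      · exact hG _ _ fun i => hx _
      · exact hx _)
  rw [Fin.sum_univ_succ] at h
  simp only [Fin.cons_zero, Fin.cons_succ] at h
  rw [← Equiv.sum_comp f, Fintype.sum_sum_type,
    show (∑ i, l (f (.inl i))) + (∑ i, l (f (.inr i))) + (p + q) =
      (∑ i, l (f (.inl i))) + q + (∑ i, l (f (.inr i))) + p by ring]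
  exact h

theorem endAct_eq_signed {n : ℕ} (σ : Equiv.Perm (Fin n))
    (F : MultilinearMap k (fun _ : Fin n => A) A) : M.endAct σ F = M.signed (fun c =>
      ((Finset.univ.filter fun x : Fin n × Fin n => x.1 < x.2 ∧ σ x.2 < σ x.1 ∧
        c (σ x.1) = 1 ∧ c (σ x.2) = 1).card : ℤ).negOnePow) (F.domDomCongr σ) := rfl

/-- The sign of the unshuffle `S`. -/
def unshuffleSign {n : ℕ} (S : Finset (Fin n)) (c : Fin n → ZMod 2) : ℤˣ :=
  (((S ×ˢ Sᶜ).filter fun x => x.2 < x.1 ∧ c x.1 = 1 ∧ c x.2 = 1).card : ℤ).negOnePow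

theorem endSign_endFil {n m : ℕ} (q : ℤ) {F : MultilinearMap k (fun _ : Fin n => A) A}
    (hF : M.endFil m F) : M.endFil m (M.endSign q F) := by
  intro l x hx
  change (if Even q then F else M.inv.compMultilinearMap (F.compLinearMap fun _ => M.inv)) x ∈ _
  split_ifs
  · exact hF l x hx
  · exact M.inv_mem_fil (hF l _ fun i => M.inv_mem_fil (hx i))

/-! ### Insertion of an even element at the first input -/

/-- Insertion of `a` at the first input. -/
def insertAt (a : A) (n : ℕ) : MultilinearMap k (fun _ : Fin (n + 1) => A) A →ₗ[k]
    MultilinearMap k (fun _ : Fin n => A) A where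
  toFun F := F.curryLeft a
  map_add' _ _ := rfl
  map_smul' _ _ := rfl

theorem insertAt_apply (a : A) {n : ℕ} (F : MultilinearMap k (fun _ : Fin (n + 1) => A) A)
    (x : Fin n → A) : insertAt a n F x = F (Fin.cons a x) := rfl

variable {M} {a : A}

theorem proj_cons (ha : M.proj 0 a = a) {n : ℕ} {c : Fin n → ZMod 2} {x : Fin n → A}
    (hx : ∀ i, M.proj (c i) (x i) = x i) (i : Fin (n + 1)) :
    M.proj ((Fin.cons 0 c : Fin (n + 1) → ZMod 2) i) ((Fin.cons a x : Fin (n + 1) → A) i) =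
      (Fin.cons a x : Fin (n + 1) → A) i := by
  refine Fin.cases ?_ (fun i => ?_) i
  · exact ha
  · exact hx i

theorem insertAt_endSign (ha : M.proj 0 a = a) (q : ℤ) {n : ℕ}
    (F : MultilinearMap k (fun _ : Fin (n + 1) => A) A) :
    insertAt a n (M.endSign q F) = M.endSign q (insertAt a n F) := by
  refine MultilinearMap.ext fun x => ?_
  change (if Even q then F else M.inv.compMultilinearMap (F.compLinearMap fun _ => M.inv))
    (Fin.cons a x) = (if Even q then F.curryLeft a else
      M.inv.compMultilinearMap ((F.curryLeft a).compLinearMap fun _ => M.inv)) x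
  split_ifs
  · rfl
  · change M.inv (F fun i => M.inv ((Fin.cons a x : Fin (n + 1) → A) i)) =
      M.inv (F (Fin.cons a fun i => M.inv (x i)))
    refine congrArg _ (congrArg F (funext fun i => ?_))
    refine Fin.cases ?_ (fun i => ?_) i
    · exact M.inv_of_proj_zero ha
    · rfl

/-- Extension of a labelling by a new first label of the upper vertex. -/
def _root_.OperadTwist.extUpper {m j n : ℕ} (f : Fin j ⊕ Fin m ≃ Fin n) :
    Fin (j + 1) ⊕ Fin m ≃ Fin (n + 1) :=
  (Equiv.sumCongr (finSuccEquiv j) (Equiv.refl _)).trans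
    ((optLeft (Fin j) (Fin m)).trans ((Equiv.optionCongr f).trans (finSuccEquiv n).symm))

/-- Extension of a labelling by a new first label of the lower vertex. -/
def _root_.OperadTwist.extLower {m j n : ℕ} (f : Fin j ⊕ Fin m ≃ Fin n) :
    Fin j ⊕ Fin (m + 1) ≃ Fin (n + 1) :=
  (Equiv.sumCongr (Equiv.refl _) (finSuccEquiv m)).trans
    ((optRight (Fin j) (Fin m)).trans ((Equiv.optionCongr f).trans (finSuccEquiv n).symm))

section ext

variable {m j n : ℕ} (f : Fin j ⊕ Fin m ≃ Fin n)

@[simp] theorem _root_.OperadTwist.extUpper_inl_zero : extUpper f (.inl 0) = 0 := rfl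

@[simp] theorem _root_.OperadTwist.extUpper_inl_succ (i : Fin j) :
    extUpper f (.inl i.succ) = (f (.inl i)).succ := by simp [extUpper, optLeft]

@[simp] theorem _root_.OperadTwist.extUpper_inr (i : Fin m) :
    extUpper f (.inr i) = (f (.inr i)).succ := by
  simp [extUpper, optLeft]

@[simp] theorem _root_.OperadTwist.extLower_inr_zero : extLower f (.inr 0) = 0 := rfl

@[simp] theorem _root_.OperadTwist.extLower_inr_succ (i : Fin m) :
    extLower f (.inr i.succ) = (f (.inr i)).succ := by simp [extLower, optRight]

@[simp] theorem _root_.OperadTwist.extLower_inl (i : Fin j) : extLower f (.inl i) = (f (.inl i)).succ := by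
  simp [extLower, optRight]

end ext

/-- The new first argument goes to the upper operation `G`. As `a` is even, its position has parity
`0` in the sign `s`. -/
theorem insertAt_endCompE_extUpper (ha : M.proj 0 a = a) {m j n : ℕ} (f : Fin j ⊕ Fin m ≃ Fin n)
    (s : (Fin (n + 1) → ZMod 2) → ℤˣ) (F : MultilinearMap k (fun _ : Fin (m + 1) => A) A)
    (G : MultilinearMap k (fun _ : Fin (j + 1) => A) A) :
    insertAt a n (M.endCompE (extUpper f) s F G) =
      M.endCompE f (fun c => s (Fin.cons 0 c)) F (insertAt a j G) := by
  refine M.multilinear_ext fun c x hx => ?_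
  rw [insertAt_apply, M.endCompE_apply _ _ _ _ _ _ (proj_cons ha hx), M.endCompE_apply _ _ _ _ c x hx]
  refine congrArg (s _ • ·) (congrArg F ?_)
  rw [insertAt_apply]
  congr 1
  · refine congrArg G (funext fun i => ?_)
    refine Fin.cases ?_ (fun i => ?_) i
    · rfl
    · rw [extUpper_inl_succ, Fin.cons_succ, Fin.cons_succ]

/-- The first argument of `F` is occupied by the value of `G`, so `a` arrives in the second. `F'`
stands for `F` with its first two arguments exchanged, which brings `a` to the front. -/
theorem insertAt_endCompE_extLower (ha : M.proj 0 a = a) {m j n : ℕ} (f : Fin j ⊕ Fin m ≃ Fin n)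
    (s : (Fin (n + 1) → ZMod 2) → ℤˣ) (F F' : MultilinearMap k (fun _ : Fin (m + 2) => A) A)
    (hF : ∀ z x, F (Fin.cons z (Fin.cons a x)) = F' (Fin.cons a (Fin.cons z x)))
    (G : MultilinearMap k (fun _ : Fin j => A) A) :
    insertAt a n (M.endCompE (extLower f) s F G) =
      M.endCompE f (fun c => s (Fin.cons 0 c)) (insertAt a (m + 1) F') G := by
  refine M.multilinear_ext fun c x hx => ?_
  rw [insertAt_apply, M.endCompE_apply _ _ _ _ _ _ (proj_cons ha hx), M.endCompE_apply _ _ _ _ c x hx]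
  refine congrArg (s _ • ·) ?_
  rw [insertAt_apply, ← hF]
  refine congrArg F ?_
  congr 1
  refine funext fun i => ?_
  refine Fin.cases ?_ (fun i => ?_) i
  · rfl
  · rw [extLower_inr_succ, Fin.cons_succ, Fin.cons_succ]

theorem endAct_swap (ha : M.proj 0 a = a) {m : ℕ}
    (F : MultilinearMap k (fun _ : Fin (m + 2) => A) A) (z : A) (x : Fin m → A) :
    M.endAct (Equiv.swap 0 1) F (Fin.cons z (Fin.cons a x)) = F (Fin.cons a (Fin.cons z x)) := by
  let P : Fin (m + 1) → Fin (m + 2) := Fin.succAbove 1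
  have key : ((M.endAct (Equiv.swap 0 1) F).domDomCongr (Equiv.swap 0 1)).curryLeft a =
      F.curryLeft a := by
    refine M.multilinear_ext fun c y hy => ?_
    rw [MultilinearMap.curryLeft_apply, MultilinearMap.curryLeft_apply,
      MultilinearMap.domDomCongr_apply]
    have hc := proj_cons ha hy
    rw [endAct_eq_signed, M.signed_apply _ _ (fun i => (Fin.cons 0 c : Fin (m + 2) → ZMod 2)
      (Equiv.swap 0 1 i)) _ (fun i => hc _), MultilinearMap.domDomCongr_apply,
      Finset.filter_false_of_mem, Finset.card_empty, Nat.cast_zero, Int.negOnePow_zero, one_smul]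
    · simp only [Equiv.swap_apply_self]
    -- The only inversion of the transposition involves the position of `a`, whose parity is `0`;
    -- hence no sign.
    · rintro ⟨i, i'⟩ - ⟨h1, h2, h3, h4⟩
      simp only [Equiv.swap_apply_self] at h1 h2 h3 h4
      have hi : i ≠ 0 := fun h => by rw [h] at h3; exact zero_ne_one h3
      have hi' : i' ≠ 0 := fun h => by rw [h] at h4; exact zero_ne_one h4
      by_cases e : i = 1
      · rw [e, Equiv.swap_apply_right] at h2
        exact absurd h2 (Fin.not_lt_zero _)
      · rw [Equiv.swap_apply_of_ne_of_ne hi e] at h2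
        by_cases e' : i' = 1
        · rw [e'] at h1
          exact hi (Fin.lt_one_iff _ |>.1 h1)
        · rw [Equiv.swap_apply_of_ne_of_ne hi' e'] at h2
          exact lt_asymm h1 h2
  have h := congrArg (fun H => H (Fin.cons z x : Fin (m + 1) → A)) key
  refine Eq.trans ?_ h
  change _ = M.endAct (Equiv.swap 0 1) F fun i =>
    (Fin.cons a (Fin.cons z x : Fin (m + 1) → A) : Fin (m + 2) → A) (Equiv.swap 0 1 i)
  refine congrArg _ (funext fun i => ?_)
  refine Fin.cases ?_ (fun i => Fin.cases ?_ (fun i => ?_) i) i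
  · rw [Equiv.swap_apply_left]
    rfl
  · rw [Fin.succ_zero_eq_one, Equiv.swap_apply_right]
    rfl
  · rw [Equiv.swap_apply_of_ne_of_ne (Fin.succ_ne_zero _) (by simp [Fin.ext_iff])]
    rfl

theorem endSign_endAct_swap (ha : M.proj 0 a = a) (q : ℤ) {m : ℕ}
    (F : MultilinearMap k (fun _ : Fin (m + 2) => A) A) (z : A) (x : Fin m → A) :
    M.endSign q (M.endAct (Equiv.swap 0 1) F) (Fin.cons z (Fin.cons a x)) =
      M.endSign q F (Fin.cons a (Fin.cons z x)) := by
  change (if Even q then M.endAct (Equiv.swap 0 1) F else M.inv.compMultilinearMap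
    ((M.endAct (Equiv.swap 0 1) F).compLinearMap fun _ => M.inv)) _ = (if Even q then F else
      M.inv.compMultilinearMap (F.compLinearMap fun _ => M.inv)) _
  split_ifs
  · exact endAct_swap ha F z x
  · change M.inv (M.endAct (Equiv.swap 0 1) F _) = M.inv (F _)
    have h1 : ∀ (z z' : A) (x : Fin m → A), (fun i => M.inv
        ((Fin.cons z (Fin.cons z' x : Fin (m + 1) → A) : Fin (m + 2) → A) i)) =
        Fin.cons (M.inv z) (Fin.cons (M.inv z') fun i => M.inv (x i) : Fin (m + 1) → A) := by
      intro z z' x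
      refine funext fun i => ?_
      refine Fin.cases ?_ (fun i => Fin.cases ?_ (fun i => ?_) i) i <;> rfl
    rw [h1, h1, M.inv_of_proj_zero ha, endAct_swap ha]

/-- Extension of a permutation by a fixed first point. -/
def _root_.OperadTwist.extPerm {n : ℕ} (σ : Equiv.Perm (Fin n)) :
    Equiv.Perm (Fin (n + 1)) :=
  (finSuccEquiv n).trans ((Equiv.optionCongr σ).trans (finSuccEquiv n).symm)

@[simp] theorem _root_.OperadTwist.extPerm_zero {n : ℕ} (σ : Equiv.Perm (Fin n)) :
    extPerm σ 0 = 0 := by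
  simp [extPerm]

@[simp] theorem _root_.OperadTwist.extPerm_succ {n : ℕ} (σ : Equiv.Perm (Fin n)) (i : Fin n) :
    extPerm σ i.succ = (σ i).succ := by
  simp [extPerm]

/-- The fixed first point carries an even argument and does not count in the sign; the remaining
sign-producing inversions correspond under `Fin.succ`. -/
theorem insertAt_endAct_extPerm (ha : M.proj 0 a = a) {n : ℕ} (σ : Equiv.Perm (Fin n))
    (F : MultilinearMap k (fun _ : Fin (n + 1) => A) A) :
    insertAt a n (M.endAct (extPerm σ) F) = M.endAct σ (insertAt a n F) := by
  refine M.multilinear_ext fun c x hx => ?_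
  rw [insertAt_apply, endAct_eq_signed, endAct_eq_signed, M.signed_apply _ _ _ _ (proj_cons ha hx),
    M.signed_apply _ _ c x hx]
  congr 1
  · have h : (Finset.univ.filter fun y : Fin (n + 1) × Fin (n + 1) => y.1 < y.2 ∧
        extPerm σ y.2 < extPerm σ y.1 ∧ (Fin.cons 0 c : Fin (n + 1) → ZMod 2) (extPerm σ y.1) = 1 ∧
          (Fin.cons 0 c : Fin (n + 1) → ZMod 2) (extPerm σ y.2) = 1) =
        (Finset.univ.filter fun y : Fin n × Fin n => y.1 < y.2 ∧ σ y.2 < σ y.1 ∧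
          c (σ y.1) = 1 ∧ c (σ y.2) = 1).map ((Fin.succEmb n).prodMap
            (Fin.succEmb n)) := by
      ext ⟨i, i'⟩
      simp only [Finset.mem_filter, Finset.mem_univ, true_and, Finset.mem_map, Prod.exists]
      constructor
      · rintro ⟨h1, h2, h3, h4⟩
        induction i using Fin.cases with
        | zero => simp at h3
        | succ i =>
          induction i' using Fin.cases with
          | zero => simp at h4
          | succ i' =>
            simp only [extPerm_succ, Fin.cons_succ, Fin.succ_lt_succ_iff] at h1 h2 h3 h4
            exact ⟨i, i', ⟨h1, h2, h3, h4⟩, rfl⟩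
      · rintro ⟨b, b', ⟨h1, h2, h3, h4⟩, h⟩
        obtain ⟨rfl, rfl⟩ := Prod.mk.inj h
        refine ⟨Fin.succ_lt_succ_iff.2 h1, ?_, ?_, ?_⟩
        · change extPerm σ b'.succ < extPerm σ b.succ
          rw [extPerm_succ, extPerm_succ]
          exact Fin.succ_lt_succ_iff.2 h2
        · change (Fin.cons 0 c : Fin (n + 1) → ZMod 2) (extPerm σ b.succ) = 1
          rw [extPerm_succ]
          exact h3
        · change (Fin.cons 0 c : Fin (n + 1) → ZMod 2) (extPerm σ b'.succ) = 1
          rw [extPerm_succ]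
          exact h4
    rw [h, Finset.card_map]
  · rw [MultilinearMap.domDomCongr_apply, MultilinearMap.domDomCongr_apply, insertAt_apply]
    refine congrArg F (funext fun i => ?_)
    refine Fin.cases ?_ (fun i => ?_) i
    · rw [extPerm_zero]
      rfl
    · rw [extPerm_succ]
      rfl

/-- The source of convergence: with `m' = 1` every insertion of `a` gains one step of the
filtration. -/
theorem endFil_insertAt {m m' n : ℕ} (ha : a ∈ M.fil m')
    {F : MultilinearMap k (fun _ : Fin (n + 1) => A) A} (hF : M.endFil m F) :
    M.endFil (m + m') (insertAt a n F) := by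
  intro l x hx
  have h := hF (Fin.cons m' l) (Fin.cons a x) (fun i => by
    refine Fin.cases ?_ (fun i => ?_) i
    · exact ha
    · exact hx i)
  rw [Fin.sum_univ_succ] at h
  simp only [Fin.cons_zero, Fin.cons_succ] at h
  rwa [show (∑ i, l i) + (m + m') = m' + (∑ i, l i) + m by ring]

theorem endDeg_insertAt {q : ℤ} {n : ℕ} (ha : a ∈ M.deg 0)
    {F : MultilinearMap k (fun _ : Fin (n + 1) => A) A} (hF : M.endDeg q F) :
    M.endDeg q (insertAt a n F) := by
  intro p x hx
  have h := hF (Fin.cons 0 p) (Fin.cons a x) (fun i => by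
    refine Fin.cases ?_ (fun i => ?_) i
    · exact ha
    · exact hx i)
  rw [Fin.sum_univ_succ] at h
  simp only [Fin.cons_zero, Fin.cons_succ, zero_add] at h
  exact h

/-- Position `0` is even and contributes no sign, whether it belongs to `S'` or not; so both ways of
extending `S` are covered. -/
theorem unshuffleSign_ext {n : ℕ} (S : Finset (Fin n)) (S' : Finset (Fin (n + 1)))
    (h : ∀ i : Fin n, i.succ ∈ S' ↔ i ∈ S) (c : Fin n → ZMod 2) :
    unshuffleSign S' (Fin.cons 0 c) = unshuffleSign S c := by
  rw [unshuffleSign, unshuffleSign]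
  have h : ((S' ×ˢ S'ᶜ).filter fun x => x.2 < x.1 ∧
      (Fin.cons 0 c : Fin (n + 1) → ZMod 2) x.1 = 1 ∧
        (Fin.cons 0 c : Fin (n + 1) → ZMod 2) x.2 = 1) =
      ((S ×ˢ Sᶜ).filter fun x => x.2 < x.1 ∧ c x.1 = 1 ∧ c x.2 = 1).map
        ((Fin.succEmb n).prodMap (Fin.succEmb n)) := by
    ext ⟨i, i'⟩
    simp only [Finset.mem_filter, Finset.mem_product, Finset.mem_compl, Finset.mem_map,
      Prod.exists]
    constructor
    · rintro ⟨⟨h1, h1'⟩, h2, h3, h4⟩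
      induction i using Fin.cases with
      | zero => simp at h3
      | succ i =>
        induction i' using Fin.cases with
        | zero => simp at h4
        | succ i' =>
          simp only [Fin.cons_succ, Fin.succ_lt_succ_iff] at h2 h3 h4
          exact ⟨i, i', ⟨⟨(h i).1 h1, fun h' => h1' ((h i').2 h')⟩, h2, h3, h4⟩, rfl⟩
    · rintro ⟨b, b', ⟨⟨h1, h1'⟩, h2, h3, h4⟩, h'⟩
      obtain ⟨rfl, rfl⟩ := Prod.mk.inj h'
      exact ⟨⟨(h b).2 h1, fun h' => h1' ((h b').1 h')⟩, Fin.succ_lt_succ_iff.2 h2, h3, h4⟩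
  rw [h, Finset.card_map]

end CompleteGradedModule

end OperadTwist
end

noncomputable section

namespace OperadTwist

/-! ## Insertion of a nullary operation -/

namespace Presentation

variable {k : Type u} [Field k] {Q : Presentation.{u, v} k} (u : Q.operad.obj (Fin 0))

/-- Grafting of the nullary operation `u` at the first input. -/
def plug (n : ℕ) : Q.operad.obj (Fin (n + 1)) →ₗ[k] Q.operad.obj (Fin n) :=
  (Q.operad.map (Equiv.sumEmpty (Fin n) (Fin 0))).comp
    ((Q.operad.comp.flip u).comp (Q.operad.map (finSuccEquiv n)))

theorem plug_apply (n : ℕ) (x : Q.operad.obj (Fin (n + 1))) :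
    plug u n x = Q.operad.map (Equiv.sumEmpty (Fin n) (Fin 0))
      (Q.operad.comp (Q.operad.map (finSuccEquiv n) x) u) := rfl

/-- Sequential associativity: the input filled by `u` belongs to the upper vertex. -/
theorem plug_graftE_extUpper {m j n : ℕ} (f : Fin j ⊕ Fin m ≃ Fin n)
    (x : Q.operad.obj (Fin (m + 1))) (y : Q.operad.obj (Fin (j + 1))) :
    plug u n (Q.operad.graftE ((Equiv.sumComm _ _).trans (extUpper f)) x y) =
      Q.operad.graftE ((Equiv.sumComm _ _).trans f) x (plug u j y) := by
  rw [plug_apply, GradedOperad.graftE_apply, GradedOperad.graftE_apply, plug_apply,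
    ← Q.operad.map_trans]
  have h : ((Equiv.sumComm (Fin m) (Fin (j + 1))).trans (extUpper f)).trans (finSuccEquiv n) =
      (Equiv.sumCongr (Equiv.refl (Fin m)) (finSuccEquiv j)).trans ((optRight (Fin m) (Fin j)).trans
        (Equiv.optionCongr ((Equiv.sumComm _ _).trans f))) := by
    ext1 i
    rcases i with i | i
    · simp [optRight]
    · refine Fin.cases ?_ (fun i => ?_) i
      · simp [optRight]
      · simp [optRight]
  rw [h, Q.operad.map_trans, ← Q.operad.comp_map_right, Q.operad.map_trans,
    Q.operad.comp_map_left, Q.operad.comp_assoc, Q.operad.comp_map_right]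
  simp only [← Q.operad.map_trans]
  congr 2
  ext1 i
  rcases i with i | i | i
  · rfl
  · rfl
  · exact i.elim0

/-- Parallel composition: `y` occupies the first input of `x` and `u` the second. Both `graftE` and
`plug` use the first input, which forces the transposition. No sign appears since `u` has degree
zero. -/
theorem plug_graftE_extLower (hu : u ∈ Q.operad.deg (Fin 0) 0) {m j n : ℕ}
    (f : Fin j ⊕ Fin m ≃ Fin n) (x : Q.operad.obj (Fin (m + 2))) (y : Q.operad.obj (Fin j)) :
    plug u n (Q.operad.graftE ((Equiv.sumComm _ _).trans (extLower f)) x y) =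
      Q.operad.graftE ((Equiv.sumComm _ _).trans f)
        (plug u (m + 1) (Q.operad.map (Equiv.swap 0 1) x)) y := by
  rw [plug_apply, GradedOperad.graftE_apply, GradedOperad.graftE_apply, plug_apply,
    ← Q.operad.map_trans]
  have h : ((Equiv.sumComm (Fin (m + 1)) (Fin j)).trans (extLower f)).trans (finSuccEquiv n) =
      (Equiv.sumCongr (finSuccEquiv m) (Equiv.refl (Fin j))).trans ((optLeft (Fin m) (Fin j)).trans
        (Equiv.optionCongr ((Equiv.sumComm _ _).trans f))) := by
    ext1 i
    rcases i with i | i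
    · refine Fin.cases ?_ (fun i => ?_) i
      · simp [optLeft]
      · simp [optLeft]
    · simp [optLeft]
  have hs : ((finSuccEquiv (m + 1)).trans (Equiv.optionCongr (finSuccEquiv m))).trans
      (optSwap (Fin m)) = (Equiv.swap 0 1).trans ((finSuccEquiv (m + 1)).trans
        (Equiv.optionCongr (finSuccEquiv m))) := by
    ext1 i
    refine Fin.cases ?_ (fun i => Fin.cases ?_ (fun i => ?_) i) i
    · simp [optSwap]
    · rw [Equiv.trans_apply, Equiv.trans_apply, Equiv.trans_apply, Fin.succ_zero_eq_one,
        Equiv.swap_apply_right, ← Fin.succ_zero_eq_one]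
      simp [optSwap, -Fin.succ_zero_eq_one, -Fin.succ_zero_eq_one']
    · have : Equiv.swap (0 : Fin (m + 2)) 1 i.succ.succ = i.succ.succ :=
        Equiv.swap_apply_of_ne_of_ne (Fin.succ_ne_zero _) (by simp [Fin.ext_iff])
      rw [Equiv.trans_apply, Equiv.trans_apply, Equiv.trans_apply, this]
      simp [optSwap]
  rw [h, Q.operad.map_trans, ← Q.operad.comp_map_left, Q.operad.map_trans,
    Q.operad.comp_map_left, operad_comp_comm_zero _ _ _ hu, ← Q.operad.map_trans _ (optSwap _),
    ← Q.operad.map_trans _ (Equiv.trans _ (optSwap _))]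
  rw [← Equiv.trans_assoc, hs, Q.operad.map_trans, Q.operad.map_trans, Q.operad.comp_map_left,
    ← Q.operad.map_trans]
  have h' : (Equiv.sumCongr (finSuccEquiv m) (Equiv.refl (Fin 0))).trans (optLeft (Fin m) (Fin 0)) =
      ((Equiv.sumEmpty (Fin (m + 1)) (Fin 0)).trans (finSuccEquiv m)).trans
        (Equiv.optionCongr (Equiv.sumEmpty (Fin m) (Fin 0)).symm) := by
    ext1 i
    rcases i with i | i
    · refine Fin.cases ?_ (fun i => ?_) i
      · simp [optLeft]
        rfl
      · simp [optLeft]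
        rfl
    · exact i.elim0
  rw [← Q.operad.map_trans (Equiv.sumCongr _ _) (optLeft _ _), h',
    Q.operad.map_trans (Equiv.trans _ _) (Equiv.optionCongr _), Q.operad.comp_map_left]
  simp only [← Q.operad.map_trans]
  congr 2
  ext1 i
  rcases i with i | i
  · rfl
  · rfl

theorem plug_map_extPerm {n : ℕ} (σ : Equiv.Perm (Fin n)) (x : Q.operad.obj (Fin (n + 1))) :
    plug u n (Q.operad.map (extPerm σ) x) = Q.operad.map σ (plug u n x) := by
  rw [plug_apply, plug_apply, ← Q.operad.map_trans]
  have h : (extPerm σ).trans (finSuccEquiv n) = (finSuccEquiv n).trans (Equiv.optionCongr σ) := by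
    ext1 i
    refine Fin.cases ?_ (fun i => ?_) i
    · simp
    · simp
  rw [h, Q.operad.map_trans, Q.operad.comp_map_left, ← Q.operad.map_trans, ← Q.operad.map_trans]
  congr 2
  ext1 i
  rcases i with i | i
  · rfl
  · exact i.elim0

theorem graftE_nullary {n : ℕ} (f : Fin 0 ⊕ Fin n ≃ Fin n) (hf : ∀ i, f (.inr i) = i)
    (x : Q.operad.obj (Fin (n + 1))) :
    Q.operad.graftE ((Equiv.sumComm _ _).trans f) x u = plug u n x := by
  rw [plug_apply, GradedOperad.graftE_apply]
  congr 2
  ext1 i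
  rcases i with i | i
  · exact hf i
  · exact i.elim0

theorem plug_mem_wt (hw : u ∈ Q.operad.wt (Fin 0) (-1)) {n : ℕ} {q : ℤ}
    {x : Q.operad.obj (Fin (n + 1))} (hx : x ∈ Q.operad.wt _ q) :
    plug u n x ∈ Q.operad.wt (Fin n) (q - 1) :=
  Q.operad.wt_map _ _ _ (Q.operad.wt_comp _ _ _ _ (Q.operad.wt_map _ _ _ hx) hw)

theorem plug_mem_deg (hu : u ∈ Q.operad.deg (Fin 0) 0) {n : ℕ} {q : ℤ}
    {x : Q.operad.obj (Fin (n + 1))} (hx : x ∈ Q.operad.deg _ q) :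
    plug u n x ∈ Q.operad.deg (Fin n) q := by
  have := Q.operad.deg_comp _ _ _ _ (Q.operad.deg_map (finSuccEquiv n) _ _ hx) hu
  rw [add_zero] at this
  exact Q.operad.deg_map _ _ _ this

/-- The Leibniz rule, whose second term vanishes with `d u`. It is stated for homogeneous elements,
whence the reduction to monomials. -/
theorem derivation_plug (d : OperadDerivation Q.operad) (hd : d.toFun (Fin 0) u = 0) {n : ℕ}
    (x : Q.operad.obj (Fin (n + 1))) :
    d.toFun (Fin n) (plug u n x) = plug u n (d.toFun (Fin (n + 1)) x) := by
  rw [plug_apply, plug_apply, d.map]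
  refine congrArg _ ?_
  rw [← d.map]
  induction Q.operad.map (finSuccEquiv n) x using operad_induction with
  | hm a => rw [d.leibniz _ _ _ (Q.mon_mem_deg a), hd, map_zero, smul_zero, add_zero]
  | h0 => simp only [map_zero, LinearMap.zero_apply]
  | ha x y hx hy => simp only [map_add, LinearMap.add_apply, hx, hy]
  | hs c x hx => simp only [map_smul, LinearMap.smul_apply, hx]

variable {u} (hw : u ∈ Q.operad.wt (Fin 0) (-1))

/-- The transpose of the insertion of `u`. -/
def plugDual (n : ℕ) : Q.operad.grDual n →ₗ[k] Q.operad.grDual (n + 1) :=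
  (plug u n).dualMap.restrict (by
    rintro φ ⟨N, hN⟩
    exact ⟨N + 1, fun q hq x hx => hN (q - 1) (by omega) _ (plug_mem_wt u hw hx)⟩)

theorem plugDual_apply {n : ℕ} (φ : Q.operad.grDual n) (x : Q.operad.obj (Fin (n + 1))) :
    (plugDual hw n φ : Module.Dual k (Q.operad.obj (Fin (n + 1)))) x =
      (φ : Module.Dual k (Q.operad.obj (Fin n))) (plug u n x) := rfl

theorem plugDual_dualAct {n : ℕ} (σ : Equiv.Perm (Fin n)) (φ : Q.operad.grDual n) :
    plugDual hw n (Q.operad.dualAct σ φ) = Q.operad.dualAct (extPerm σ) (plugDual hw n φ) := by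
  refine Subtype.ext (LinearMap.ext fun x => ?_)
  change (φ : Module.Dual k (Q.operad.obj (Fin n))) (Q.operad.map σ.symm (plug u n x)) =
    (φ : Module.Dual k (Q.operad.obj (Fin n))) (plug u n (Q.operad.map (extPerm σ).symm x))
  rw [← plug_map_extPerm]
  rfl

theorem plugDual_dualDiff (d : OperadDerivation Q.operad) (hd : d.toFun (Fin 0) u = 0) {n : ℕ}
    (φ : Q.operad.grDual n) :
    plugDual hw n (Q.operad.dualDiff d n φ) = Q.operad.dualDiff d (n + 1) (plugDual hw n φ) := by
  refine Subtype.ext (LinearMap.ext fun x => ?_)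
  exact congrArg (φ : Module.Dual k (Q.operad.obj (Fin n))) (derivation_plug u d hd x)

theorem dualDeg_plugDual (hu : u ∈ Q.operad.deg (Fin 0) 0) {n : ℕ} {j : ℤ} {φ : Q.operad.grDual n}
    (hφ : Q.operad.DualDeg j φ) : Q.operad.DualDeg j (plugDual hw n φ) :=
  fun q hq _ hx => hφ q hq _ (plug_mem_deg u hu hx)

/-- The transpose of `plug_graftE_extUpper`. Local finiteness guarantees that the tensor on the
right really represents the composite. -/
theorem decompE_extUpper (hO : Q.operad.LocallyFinite) {m j n : ℕ} (f : Fin j ⊕ Fin m ≃ Fin n)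
    (φ : Q.operad.grDual n) :
    Q.operad.decompE ((Equiv.sumComm _ _).trans (extUpper f)) (plugDual hw n φ) =
      (plugDual hw j).lTensor _ (Q.operad.decompE ((Equiv.sumComm _ _).trans f) φ) := by
  refine GradedOperad.decompE_eq _ _ _ fun x y => ?_
  rw [plugDual_apply, plug_graftE_extUpper, ← hO.dualEval_decompE]
  induction Q.operad.decompE ((Equiv.sumComm _ _).trans f) φ using TensorProduct.induction_on with
  | zero => simp only [map_zero, LinearMap.zero_apply]
  | tmul ψ ω => rfl
  | add t t' ht ht' => simp only [map_add, LinearMap.add_apply, ht, ht']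

theorem decompE_extLower (hO : Q.operad.LocallyFinite) (hu : u ∈ Q.operad.deg (Fin 0) 0)
    {m j n : ℕ} (f : Fin j ⊕ Fin m ≃ Fin n) (φ : Q.operad.grDual n) :
    Q.operad.decompE ((Equiv.sumComm _ _).trans (extLower f)) (plugDual hw n φ) =
      ((Q.operad.dualAct (Equiv.swap 0 1)).comp (plugDual hw (m + 1))).rTensor _
        (Q.operad.decompE ((Equiv.sumComm _ _).trans f) φ) := by
  refine GradedOperad.decompE_eq _ _ _ fun x y => ?_
  rw [plugDual_apply, plug_graftE_extLower u hu, ← hO.dualEval_decompE]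
  induction Q.operad.decompE ((Equiv.sumComm _ _).trans f) φ using TensorProduct.induction_on with
  | zero => simp only [map_zero, LinearMap.zero_apply]
  | tmul ψ ω =>
    rw [LinearMap.rTensor_tmul, GradedOperad.dualEval_tmul, GradedOperad.dualEval_tmul]
    refine congrArg (· * _) ?_
    change (ψ : Module.Dual k (Q.operad.obj (Fin (m + 1))))
      (plug u (m + 1) (Q.operad.map (Equiv.swap 0 1).symm x)) = _
    rw [Equiv.symm_swap]
  | add t t' ht ht' => simp only [map_add, LinearMap.add_apply, ht, ht']

end Presentation

end OperadTwist
end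

noncomputable section

namespace OperadTwist

/-! ## The pre-Lie product -/

theorem finSumEquivOfFinset_eq {m j n : ℕ} {S : Finset (Fin n)} (hj : S.card = j)
    (hm : Sᶜ.card = m) (f : Fin j ⊕ Fin m ≃ Fin n) (h : ∀ i, f (.inl i) ∈ S)
    (h' : ∀ i, f (.inr i) ∉ S) (hl : StrictMono fun i => f (.inl i))
    (hr : StrictMono fun i => f (.inr i)) : finSumEquivOfFinset hj hm = f := by
  ext1 i
  rcases i with i | i
  · rw [finSumEquivOfFinset_inl]
    exact (congrFun (Finset.orderEmbOfFin_unique hj h hl) i).symm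
  · rw [finSumEquivOfFinset_inr]
    exact (congrFun (Finset.orderEmbOfFin_unique hm
      (fun i => Finset.mem_compl.2 (h' i)) hr) i).symm

/-- The dichotomy `0 ∈ S` or `0 ∉ S` becomes the two terms of the Leibniz rule for the contraction.
-/
theorem sum_finset_succ {V : Type*} [AddCommMonoid V] {n : ℕ} (g : Finset (Fin (n + 1)) → V) :
    ∑ S, g S = ∑ S : Finset (Fin n), (g (insert 0 (S.map (Fin.succEmb n))) +
      g (S.map (Fin.succEmb n))) := by
  rw [← Finset.powerset_univ, Fin.univ_succ, Finset.cons_eq_insert, Finset.sum_powerset_insert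
    (by simp), add_comm, ← Finset.sum_add_distrib]
  symm
  refine Finset.sum_nbij (fun S => S.map (Fin.succEmb n)) ?_ ?_ ?_ fun _ _ => rfl
  · intro S _
    rw [Finset.mem_powerset]
    exact Finset.map_subset_map.2 (Finset.subset_univ S)
  · exact fun S _ S' _ h => Finset.map_injective _ h
  · intro S hS
    obtain ⟨S', -, rfl⟩ := Finset.subset_map_iff.1 (Finset.mem_powerset.1 hS)
    exact ⟨S', Finset.mem_coe.2 (Finset.mem_univ _), rfl⟩

namespace CompleteGradedModule

variable {k : Type u} [Field k] {A : Type w} [AddCommGroup A] [Module k A]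
  (M : CompleteGradedModule k A)

theorem endFil_add {m n : ℕ} {F G : MultilinearMap k (fun _ : Fin n => A) A} (hF : M.endFil m F)
    (hG : M.endFil m G) : M.endFil m (F + G) :=
  fun l x hx => add_mem (hF l x hx) (hG l x hx)

theorem endFil_zero {m n : ℕ} : M.endFil m (0 : MultilinearMap k (fun _ : Fin n => A) A) :=
  fun _ _ _ => zero_mem _

theorem endFil_smul {m n : ℕ} (c : k) {F : MultilinearMap k (fun _ : Fin n => A) A}
    (hF : M.endFil m F) : M.endFil m (c • F) :=
  fun l x hx => Submodule.smul_mem _ _ (hF l x hx)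

theorem endFil_units_smul {m n : ℕ} (c : ℤˣ) {F : MultilinearMap k (fun _ : Fin n => A) A}
    (hF : M.endFil m F) : M.endFil m (c • F) := fun l x hx => by
  change c • F x ∈ _
  rw [Units.smul_def]
  exact zsmul_mem (hF l x hx) _

theorem endSign_zero {n : ℕ} (F : MultilinearMap k (fun _ : Fin n => A) A) :
    M.endSign 0 F = F := by
  change (if Even (0 : ℤ) then F else
    M.inv.compMultilinearMap (F.compLinearMap fun _ => M.inv)) = F
  rw [if_pos Even.zero]

section operad

variable {O : GradedOperad.{u, v} k}

/-- The summand of the pre-Lie product given by a two-level tree. -/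
def convE {m j n : ℕ} (f : Fin j ⊕ Fin m ≃ Fin n) (s : (Fin n → ZMod 2) → ℤˣ)
    (F : O.grDual (m + 1) →ₗ[k] MultilinearMap k (fun _ : Fin (m + 1) => A) A)
    (G : O.grDual j →ₗ[k] MultilinearMap k (fun _ : Fin j => A) A) :
    O.grDual n →ₗ[k] MultilinearMap k (fun _ : Fin n => A) A :=
  ((TensorProduct.lift (M.endCompE f s)).comp (TensorProduct.map F G)).comp
    (O.decompE ((Equiv.sumComm _ _).trans f))

/-- The summand of the pre-Lie product given by `S`. -/
def starAt (p q : ℤ) (F G : Conv O A) {n : ℕ} (S : Finset (Fin n)) :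
    O.grDual n →ₗ[k] MultilinearMap k (fun _ : Fin n => A) A :=
  M.convE (finSumEquivOfFinset (s := S) rfl rfl) (unshuffleSign S)
    ((p * q).negOnePow • (M.endSign q).comp (F _)) (G _)

theorem star_eq (p q : ℤ) (F G : Conv O A) (n : ℕ) :
    M.star p q F G n = ∑ S, M.starAt p q F G S := rfl

/-- The arities are freed from the literal cardinalities of `S` and its complement, so that summands
for different subsets can be compared. -/
theorem starAt_eq (p q : ℤ) (F G : Conv O A) {m j n : ℕ} (S : Finset (Fin n)) (hj : S.card = j)
    (hm : Sᶜ.card = m) : M.starAt p q F G S = M.convE (finSumEquivOfFinset hj hm)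
      (unshuffleSign S) ((p * q).negOnePow • (M.endSign q).comp (F (m + 1))) (G j) := by
  subst hj hm
  rfl

theorem convE_fil {m j n p q : ℕ} (f : Fin j ⊕ Fin m ≃ Fin n) (s : (Fin n → ZMod 2) → ℤˣ)
    {F : O.grDual (m + 1) →ₗ[k] MultilinearMap k (fun _ : Fin (m + 1) => A) A}
    {G : O.grDual j →ₗ[k] MultilinearMap k (fun _ : Fin j => A) A}
    (hF : ∀ φ, M.endFil p (F φ)) (hG : ∀ φ, M.endFil q (G φ)) (φ : O.grDual n) :
    M.endFil (p + q) (M.convE f s F G φ) := by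
  change M.endFil _ (TensorProduct.lift (M.endCompE f s) (TensorProduct.map F G _))
  induction O.decompE ((Equiv.sumComm _ _).trans f) φ using TensorProduct.induction_on with
  | zero =>
    simp only [map_zero]
    exact M.endFil_zero
  | tmul ψ ω =>
    rw [TensorProduct.map_tmul, TensorProduct.lift.tmul]
    exact M.endCompE_endFil f s (hF ψ) (hG ω)
  | add t t' ht ht' =>
    simp only [map_add]
    exact M.endFil_add ht ht'

theorem star_inFil {p q : ℤ} {m m' : ℕ} {F G : Conv O A} (hF : M.InFil m F) (hG : M.InFil m' G) :
    M.InFil (m + m') (M.star p q F G) := by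
  intro n φ
  rw [star_eq, LinearMap.sum_apply]
  refine Finset.sum_induction _ (M.endFil (m + m')) (fun _ _ => M.endFil_add) M.endFil_zero
    fun S _ => ?_
  exact M.convE_fil _ _ (fun ψ => M.endFil_units_smul _ (M.endSign_endFil q (hF _ ψ))) (hG _) φ

/-- The pre-Lie product as a bilinear map. -/
def starL (p q : ℤ) : Conv O A →ₗ[k] Conv O A →ₗ[k] Conv O A :=
  LinearMap.mk₂ k (M.star p q)
    (fun F F' G => by
      funext n
      rw [Pi.add_apply, star_eq, star_eq, star_eq, ← Finset.sum_add_distrib]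
      refine Finset.sum_congr rfl fun S _ => ?_
      rw [starAt, starAt, starAt, convE, convE, convE, Pi.add_apply, LinearMap.comp_add, smul_add,
        TensorProduct.map_add_left, LinearMap.comp_add, LinearMap.add_comp])
    (fun c F G => by
      funext n
      rw [Pi.smul_apply, star_eq, star_eq, Finset.smul_sum]
      refine Finset.sum_congr rfl fun S _ => ?_
      rw [starAt, starAt, convE, convE, Pi.smul_apply, LinearMap.comp_smul, smul_comm,
        TensorProduct.map_smul_left, LinearMap.comp_smul, LinearMap.smul_comp])
    (fun F G G' => by
      funext n
      rw [Pi.add_apply, star_eq, star_eq, star_eq, ← Finset.sum_add_distrib]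
      refine Finset.sum_congr rfl fun S _ => ?_
      rw [starAt, starAt, starAt, convE, convE, convE, Pi.add_apply,
        TensorProduct.map_add_right, LinearMap.comp_add, LinearMap.add_comp])
    (fun c F G => by
      funext n
      rw [Pi.smul_apply, star_eq, star_eq, Finset.smul_sum]
      refine Finset.sum_congr rfl fun S _ => ?_
      rw [starAt, starAt, convE, convE, Pi.smul_apply,
        TensorProduct.map_smul_right, LinearMap.comp_smul, LinearMap.smul_comp])

theorem starL_apply (p q : ℤ) (F G : Conv O A) : M.starL p q F G = M.star p q F G := rfl

end operad

/-! ### Contraction with an element of arity zero -/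

section plugging

open Presentation

variable {Q : Presentation.{u, v} k} {u : Q.operad.obj (Fin 0)}
  (hw : u ∈ Q.operad.wt (Fin 0) (-1)) (a : A)

/-- Contraction with the element of arity zero which sends the form dual to `u` to `a`. -/
def contract : Conv Q.operad A →ₗ[k] Conv Q.operad A where
  toFun F n := (insertAt a n).comp ((F (n + 1)).comp (plugDual hw n))
  map_add' _ _ := funext fun n => LinearMap.ext fun _ => (insertAt a n).map_add _ _
  map_smul' c _ := funext fun n => LinearMap.ext fun _ => (insertAt a n).map_smul c _

variable {a}

theorem contract_apply (F : Conv Q.operad A) (n : ℕ) (φ : Q.operad.grDual n) :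
    contract hw a F n φ = insertAt a n (F (n + 1) (plugDual hw n φ)) := rfl

theorem insertAt_convE_extUpper (ha : M.proj 0 a = a) (hO : Q.operad.LocallyFinite) {m j n : ℕ}
    (f : Fin j ⊕ Fin m ≃ Fin n) (s : (Fin (n + 1) → ZMod 2) → ℤˣ)
    (F : Q.operad.grDual (m + 1) →ₗ[k] MultilinearMap k (fun _ : Fin (m + 1) => A) A)
    (G : Q.operad.grDual (j + 1) →ₗ[k] MultilinearMap k (fun _ : Fin (j + 1) => A) A) :
    (insertAt a n).comp ((M.convE (extUpper f) s F G).comp (plugDual hw n)) =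
      M.convE f (fun c => s (Fin.cons 0 c)) F ((insertAt a j).comp (G.comp (plugDual hw j))) := by
  refine LinearMap.ext fun φ => ?_
  change insertAt a n (TensorProduct.lift (M.endCompE (extUpper f) s) (TensorProduct.map F G
    (Q.operad.decompE _ (plugDual hw n φ)))) = TensorProduct.lift (M.endCompE f _)
      (TensorProduct.map F _ (Q.operad.decompE _ φ))
  rw [decompE_extUpper hw hO]
  induction Q.operad.decompE ((Equiv.sumComm _ _).trans f) φ using TensorProduct.induction_on with
  | zero => simp only [map_zero]
  | tmul ψ ω =>
    rw [LinearMap.lTensor_tmul, TensorProduct.map_tmul, TensorProduct.map_tmul,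
      TensorProduct.lift.tmul, TensorProduct.lift.tmul, insertAt_endCompE_extUpper ha]
    rfl
  | add t t' ht ht' => simp only [map_add, ht, ht']

/-- The transposition created on the side of the operad is carried by equivariance of `F` to
`End_A`, where it cancels the exchange of `a` with the value of `G`. -/
theorem insertAt_convE_extLower (ha : M.proj 0 a = a) (hO : Q.operad.LocallyFinite)
    (hu : u ∈ Q.operad.deg (Fin 0) 0) {m j n : ℕ}
    (f : Fin j ⊕ Fin m ≃ Fin n) (s : (Fin (n + 1) → ZMod 2) → ℤˣ) (c : ℤˣ) (q : ℤ)
    (F : Q.operad.grDual (m + 2) →ₗ[k] MultilinearMap k (fun _ : Fin (m + 2) => A) A)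
    (hF : ∀ φ, F (Q.operad.dualAct (Equiv.swap 0 1) φ) = M.endAct (Equiv.swap 0 1) (F φ))
    (G : Q.operad.grDual j →ₗ[k] MultilinearMap k (fun _ : Fin j => A) A) :
    (insertAt a n).comp ((M.convE (extLower f) s (c • (M.endSign q).comp F) G).comp
      (plugDual hw n)) = M.convE f (fun c => s (Fin.cons 0 c)) (c • (M.endSign q).comp
        ((insertAt a (m + 1)).comp (F.comp (plugDual hw (m + 1))))) G := by
  refine LinearMap.ext fun φ => ?_
  change insertAt a n (TensorProduct.lift (M.endCompE (extLower f) s) (TensorProduct.map _ G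
    (Q.operad.decompE _ (plugDual hw n φ)))) = TensorProduct.lift (M.endCompE f _)
      (TensorProduct.map _ G (Q.operad.decompE _ φ))
  rw [decompE_extLower hw hO hu]
  induction Q.operad.decompE ((Equiv.sumComm _ _).trans f) φ using TensorProduct.induction_on with
  | zero => simp only [map_zero]
  | tmul ψ ω =>
    rw [LinearMap.rTensor_tmul, TensorProduct.map_tmul, TensorProduct.map_tmul,
      TensorProduct.lift.tmul, TensorProduct.lift.tmul,
      insertAt_endCompE_extLower ha f s _ (c • M.endSign q (F (plugDual hw (m + 1) ψ)))]
    · congr 2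
      change insertAt a (m + 1) (c • _) = c • M.endSign q (insertAt a (m + 1) _)
      rw [← insertAt_endSign ha]
      rfl
    · intro z x
      change c • M.endSign q (F (Q.operad.dualAct (Equiv.swap 0 1) (plugDual hw (m + 1) ψ))) _ =
        c • M.endSign q (F (plugDual hw (m + 1) ψ)) _
      rw [hF, endSign_endAct_swap ha]
  | add t t' ht ht' => simp only [map_add, ht, ht']

theorem finSumEquivOfFinset_insert {n : ℕ} (S : Finset (Fin n))
    (h : (insert 0 (S.map (Fin.succEmb n))).card = S.card + 1)
    (h' : (insert 0 (S.map (Fin.succEmb n)))ᶜ.card = Sᶜ.card) :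
    finSumEquivOfFinset h h' = extUpper (finSumEquivOfFinset (s := S) rfl rfl) := by
  refine finSumEquivOfFinset_eq _ _ _ ?_ ?_ ?_ ?_
  · intro i
    refine Fin.cases ?_ (fun i => ?_) i
    · exact Finset.mem_insert_self _ _
    · rw [extUpper_inl_succ, finSumEquivOfFinset_inl]
      exact Finset.mem_insert_of_mem (Finset.mem_map_of_mem _ (Finset.orderEmbOfFin_mem S rfl i))
  · intro i
    rw [extUpper_inr, finSumEquivOfFinset_inr, Finset.mem_insert, not_or]
    refine ⟨Fin.succ_ne_zero _, fun h => ?_⟩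
    obtain ⟨y, hy, hy'⟩ := Finset.mem_map.1 h
    rw [Fin.succ_injective _ hy'] at hy
    exact Finset.mem_compl.1 (Finset.orderEmbOfFin_mem Sᶜ rfl i) hy
  · intro i i' h
    induction i' using Fin.cases with
    | zero => exact absurd h (Fin.not_lt_zero _)
    | succ i' =>
      induction i using Fin.cases with
      | zero =>
        simp only [extUpper_inl_succ, extUpper_inl_zero]
        exact Fin.succ_pos _
      | succ i =>
        simp only [extUpper_inl_succ, finSumEquivOfFinset_inl, Fin.succ_lt_succ_iff,
          OrderEmbedding.lt_iff_lt] at h ⊢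
        exact h
  · intro i i' h
    simp only [extUpper_inr, finSumEquivOfFinset_inr, Fin.succ_lt_succ_iff, OrderEmbedding.lt_iff_lt]
    exact h

theorem finSumEquivOfFinset_map {n : ℕ} (S : Finset (Fin n))
    (h : (S.map (Fin.succEmb n)).card = S.card)
    (h' : (S.map (Fin.succEmb n))ᶜ.card = Sᶜ.card + 1) :
    finSumEquivOfFinset h h' = extLower (finSumEquivOfFinset (s := S) rfl rfl) := by
  refine finSumEquivOfFinset_eq _ _ _ ?_ ?_ ?_ ?_
  · intro i
    rw [extLower_inl, finSumEquivOfFinset_inl]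
    exact Finset.mem_map_of_mem _ (Finset.orderEmbOfFin_mem S rfl i)
  · intro i h
    obtain ⟨y, hy, hy'⟩ := Finset.mem_map.1 h
    induction i using Fin.cases with
    | zero => exact Fin.succ_ne_zero _ hy'
    | succ i =>
      rw [extLower_inr_succ, finSumEquivOfFinset_inr] at hy'
      rw [Fin.succ_injective _ hy'] at hy
      exact Finset.mem_compl.1 (Finset.orderEmbOfFin_mem Sᶜ rfl i) hy
  · intro i i' h
    simp only [extLower_inl, finSumEquivOfFinset_inl, Fin.succ_lt_succ_iff, OrderEmbedding.lt_iff_lt]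
    exact h
  · intro i i' h
    induction i' using Fin.cases with
    | zero => exact absurd h (Fin.not_lt_zero _)
    | succ i' =>
      induction i using Fin.cases with
      | zero =>
        simp only [extLower_inr_succ, extLower_inr_zero]
        exact Fin.succ_pos _
      | succ i =>
        simp only [extLower_inr_succ, finSumEquivOfFinset_inr, Fin.succ_lt_succ_iff,
          OrderEmbedding.lt_iff_lt] at h ⊢
        exact h

/-- The Leibniz rule. Trees whose upper vertex has the new input contribute the contraction of `G`,
the others that of `F`. There are no signs, as `a` and `u` are even. Equivariance is needed only for
the left factor. -/
theorem contract_star (ha : M.proj 0 a = a) (hO : Q.operad.LocallyFinite)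
    (hu : u ∈ Q.operad.deg (Fin 0) 0) (p q : ℤ) (F G : Conv Q.operad A)
    (hF : ∀ n (σ : Equiv.Perm (Fin n)) (φ : Q.operad.grDual n),
      F n (Q.operad.dualAct σ φ) = M.endAct σ (F n φ)) :
    contract hw a (M.star p q F G) =
      M.star p q (contract hw a F) G + M.star p q F (contract hw a G) := by
  funext n
  change (insertAt a n).comp ((M.star p q F G (n + 1)).comp (plugDual hw n)) =
    M.star p q (contract hw a F) G n + M.star p q F (contract hw a G) n
  rw [star_eq, star_eq, star_eq, sum_finset_succ,
    add_comm (∑ S, M.starAt p q (contract hw a F) G S), ← Finset.sum_add_distrib]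
  refine LinearMap.ext fun φ => ?_
  rw [LinearMap.comp_apply, LinearMap.comp_apply, LinearMap.sum_apply, map_sum,
    LinearMap.sum_apply]
  refine Finset.sum_congr rfl fun S _ => ?_
  refine LinearMap.congr_fun (f := (insertAt a n).comp ((M.starAt p q F G
    (insert 0 (S.map (Fin.succEmb n))) + M.starAt p q F G (S.map (Fin.succEmb n))).comp
      (plugDual hw n))) ?_ φ
  have h0 : (0 : Fin (n + 1)) ∉ S.map (Fin.succEmb n) := by simp
  have h1 : (insert 0 (S.map (Fin.succEmb n))).card = S.card + 1 := by
    rw [Finset.card_insert_of_notMem h0, Finset.card_map]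
  have h2 : (insert 0 (S.map (Fin.succEmb n)))ᶜ.card = Sᶜ.card := by
    rw [Finset.card_compl, Finset.card_compl, h1, Fintype.card_fin, Fintype.card_fin]
    omega
  have h3 : (S.map (Fin.succEmb n)).card = S.card := Finset.card_map _
  have h4 : (S.map (Fin.succEmb n))ᶜ.card = Sᶜ.card + 1 := by
    have := S.card_le_univ
    rw [Fintype.card_fin] at this
    rw [Finset.card_compl, Finset.card_compl, h3, Fintype.card_fin, Fintype.card_fin]
    omega
  rw [M.starAt_eq p q F G _ h1 h2, M.starAt_eq p q F G _ h3 h4, finSumEquivOfFinset_insert,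
    finSumEquivOfFinset_map, LinearMap.add_comp, LinearMap.comp_add,
    insertAt_convE_extUpper M hw ha hO, insertAt_convE_extLower M hw ha hO hu _ _ _ _ _ (hF _ _)]
  have hs1 : (fun c => unshuffleSign (insert 0 (S.map (Fin.succEmb n))) (Fin.cons 0 c)) =
      unshuffleSign S := funext fun c => unshuffleSign_ext S _ (fun i => by
        rw [Finset.mem_insert, or_iff_right (Fin.succ_ne_zero i)]
        exact Finset.mem_map' _) c
  have hs2 : (fun c => unshuffleSign (S.map (Fin.succEmb n)) (Fin.cons 0 c)) =
      unshuffleSign S := funext fun c => unshuffleSign_ext S _ (fun i => Finset.mem_map' _) c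
  rw [hs1, hs2]
  rfl

/-- The left factor of a grafting must have an input. -/
theorem star_arityZero_left (p q : ℤ) {F : Conv Q.operad A} (hF : ∀ n, F (n + 1) = 0)
    (G : Conv Q.operad A) : M.star p q F G = 0 := by
  funext n
  rw [star_eq]
  refine Finset.sum_eq_zero fun S _ => ?_
  rw [starAt, convE, hF, LinearMap.comp_zero, smul_zero, TensorProduct.map_zero_left,
    LinearMap.comp_zero, LinearMap.zero_comp]

/-- Only `S = ∅` leaves the upper vertex without inputs. The corresponding component of `Δ_(1)` is
`plugDual φ ⊗ u^*`, because every nullary operation is a multiple of `u`. -/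
theorem star_arityZero_right (p : ℤ) (F : Conv Q.operad A)
    {G : Conv Q.operad A} (hG : ∀ n, G (n + 1) = 0) (uStar : Q.operad.grDual 0)
    (hu : ∀ y, y = (uStar : Module.Dual k (Q.operad.obj (Fin 0))) y • u)
    (hG0 : G 0 uStar = MultilinearMap.constOfIsEmpty k (fun _ : Fin 0 => A) a) :
    M.star p 0 F G = contract hw a F := by
  funext n
  rw [star_eq, Finset.sum_eq_single ∅ _ fun h => (h (Finset.mem_univ _)).elim]
  · have hm : (∅ᶜ : Finset (Fin n)).card = n := by simp
    rw [M.starAt_eq p 0 F G ∅ Finset.card_empty hm]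
    have hf : ∀ i, finSumEquivOfFinset (s := (∅ : Finset (Fin n))) Finset.card_empty hm (.inr i) =
        i := by
      rw [finSumEquivOfFinset_eq Finset.card_empty hm (Equiv.emptySum (Fin 0) (Fin n))
        (fun i => i.elim0) (fun i => Finset.notMem_empty _) (fun i => i.elim0) fun _ _ h => h]
      exact fun _ => rfl
    refine LinearMap.ext fun φ => ?_
    have hdec : Q.operad.decompE ((Equiv.sumComm _ _).trans (finSumEquivOfFinset
        (s := (∅ : Finset (Fin n))) Finset.card_empty hm)) φ = plugDual hw n φ ⊗ₜ uStar := by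
      refine GradedOperad.decompE_eq _ _ _ fun x y => ?_
      rw [GradedOperad.dualEval_tmul, plugDual_apply, ← graftE_nullary u _ hf, mul_comm,
        ← smul_eq_mul, ← map_smul, ← map_smul, ← hu y]
    change TensorProduct.lift _ (TensorProduct.map _ _ (Q.operad.decompE _ φ)) = _
    rw [hdec, TensorProduct.map_tmul, TensorProduct.lift.tmul, hG0, contract_apply]
    refine M.multilinear_ext fun c x hx => ?_
    rw [M.endCompE_apply _ _ _ _ c x hx, insertAt_apply]
    have hs : unshuffleSign (∅ : Finset (Fin n)) c = 1 := by simp [unshuffleSign]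
    have hF : ((p * 0).negOnePow • (M.endSign 0).comp (F (n + 1))) (plugDual hw n φ) =
        F (n + 1) (plugDual hw n φ) := by
      rw [mul_zero, Int.negOnePow_zero, one_smul]
      exact M.endSign_zero _
    rw [hs, one_smul, hF]
    refine congrArg _ ?_
    congr 1
    exact funext fun i => congrArg x (hf i)
  · intro S _ hS
    obtain ⟨c, hc⟩ := Nat.exists_eq_succ_of_ne_zero (fun h => hS (Finset.card_eq_zero.1 h))
    rw [M.starAt_eq p 0 F G S hc rfl, hG, convE, TensorProduct.map_zero_right, LinearMap.comp_zero,
      LinearMap.zero_comp]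

theorem contract_inFil {m m' : ℕ} (ha : a ∈ M.fil m') {F : Conv Q.operad A} (hF : M.InFil m F) :
    M.InFil (m + m') (contract hw a F) :=
  fun n _ => endFil_insertAt ha (hF (n + 1) _)

theorem contract_isHom (ha : a ∈ M.deg 0) (hu : u ∈ Q.operad.deg (Fin 0) 0) {p : ℤ}
    {F : Conv Q.operad A} (hF : M.IsHom p F) : M.IsHom p (contract hw a F) where
  equivariant n σ φ := by
    rw [contract_apply, contract_apply, plugDual_dualAct, hF.equivariant,
      insertAt_endAct_extPerm (by rw [M.proj_of_mem ha]; simp)]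
  filtered n φ := by
    have := endFil_insertAt (M := M) (m' := 0) (by rw [M.fil_zero]; trivial)
      (hF.filtered (n + 1) (plugDual hw n φ)) (a := a)
    exact this
  degree n j φ hφ := endDeg_insertAt ha (hF.degree _ j _ (dualDeg_plugDual hw hu hφ))

theorem contract_boundary (d : OperadDerivation Q.operad) (hd : d.toFun (Fin 0) u = 0) (p : ℤ)
    (F : Conv Q.operad A) :
    contract hw a (boundary d p F) = boundary d p (contract hw a F) := by
  funext n
  refine LinearMap.ext fun φ => ?_
  change insertAt a n (-(p.negOnePow • F (n + 1) (Q.operad.dualDiff d (n + 1) (plugDual hw n φ)))) =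
    -(p.negOnePow • insertAt a n (F (n + 1) (plugDual hw n (Q.operad.dualDiff d n φ))))
  rw [plugDual_dualDiff hw d hd]
  rfl

end plugging

end CompleteGradedModule

end OperadTwist
end

noncomputable section

namespace OperadTwist

/-! ## Limits in the convolution algebra -/

namespace CompleteGradedModule

variable {k : Type u} [Field k] {A : Type w} [AddCommGroup A] [Module k A]
  (M : CompleteGradedModule k A)

/-- Separatedness is the uniqueness half of completeness: each homogeneous component of `x`, like
`0`, is a limit of the zero sequence. -/
theorem eq_zero_of_mem_fil {x : A} (hx : ∀ m, x ∈ M.fil m) : x = 0 := by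
  classical
  rw [← DirectSum.sum_support_decompose M.deg x]
  refine Finset.sum_eq_zero fun p _ => ?_
  obtain ⟨y, -, hy⟩ := M.complete p (fun _ => 0) (fun _ => zero_mem _) fun m => by
    rw [sub_zero]
    exact zero_mem _
  rw [hy _ ⟨Subtype.mem _, fun m => by
      rw [zero_sub]
      exact neg_mem (M.fil_homogeneous m x (hx m) p)⟩,
    hy 0 ⟨zero_mem _, fun m => by
      rw [sub_zero]
      exact zero_mem _⟩]

/-- Convergence with respect to the filtration. -/
def IsLim (x : ℕ → A) (y : A) : Prop := ∀ m, x m - y ∈ M.fil m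

variable {M}

theorem IsLim.unique {x : ℕ → A} {y y' : A} (h : M.IsLim x y) (h' : M.IsLim x y') : y = y' := by
  refine sub_eq_zero.1 (M.eq_zero_of_mem_fil fun m => ?_)
  have := sub_mem (h' m) (h m)
  rwa [sub_sub_sub_cancel_left] at this

theorem IsLim.add {x x' : ℕ → A} {y y' : A} (h : M.IsLim x y) (h' : M.IsLim x' y') :
    M.IsLim (fun m => x m + x' m) (y + y') := fun m => by
  rw [add_sub_add_comm]
  exact add_mem (h m) (h' m)

theorem IsLim.smul (c : k) {x : ℕ → A} {y : A} (h : M.IsLim x y) :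
    M.IsLim (fun m => c • x m) (c • y) := fun m => by
  rw [← smul_sub]
  exact Submodule.smul_mem _ _ (h m)

theorem isLim_sum {ι : Type*} (s : Finset ι) {x : ι → ℕ → A}
    (h : ∀ i ∈ s, ∃ y, M.IsLim (x i) y) : ∃ y, M.IsLim (fun m => ∑ i ∈ s, x i m) y := by
  choose! y hy using h
  refine ⟨∑ i ∈ s, y i, fun m => ?_⟩
  rw [← Finset.sum_sub_distrib]
  exact Submodule.sum_mem _ fun i hi => hy i hi m

/-! ### Filtration and limits of collections of maps. -/

variable {O : GradedOperad.{u, v} k}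

theorem InFil.mono {m m' : ℕ} (h : m ≤ m') {F : Conv O A} (hF : M.InFil m' F) : M.InFil m F :=
  fun n φ l x hx => M.fil_anti (Nat.add_le_add_left h _) (hF n φ l x hx)

theorem InFil.add {m : ℕ} {F G : Conv O A} (hF : M.InFil m F) (hG : M.InFil m G) :
    M.InFil m (F + G) :=
  fun n φ => M.endFil_add (hF n φ) (hG n φ)

theorem inFil_zero {m : ℕ} : M.InFil m (0 : Conv O A) := fun _ _ => M.endFil_zero

theorem InFil.smul {m : ℕ} (c : k) {F : Conv O A} (hF : M.InFil m F) : M.InFil m (c • F) :=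
  fun n φ => M.endFil_smul c (hF n φ)

theorem InFil.neg {m : ℕ} {F : Conv O A} (hF : M.InFil m F) : M.InFil m (-F) := by
  rw [← neg_one_smul k F]
  exact hF.smul _

theorem InFil.sub {m : ℕ} {F G : Conv O A} (hF : M.InFil m F) (hG : M.InFil m G) :
    M.InFil m (F - G) := by
  rw [sub_eq_add_neg]
  exact hF.add hG.neg

theorem inFil_sum {ι : Type*} {m : ℕ} (s : Finset ι) {F : ι → Conv O A}
    (hF : ∀ i ∈ s, M.InFil m (F i)) : M.InFil m (∑ i ∈ s, F i) :=
  Finset.sum_induction _ (M.InFil m) (fun _ _ => InFil.add) inFil_zero hF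

theorem eq_zero_of_endFil {n : ℕ} {F : MultilinearMap k (fun _ : Fin n => A) A}
    (hF : ∀ m, M.endFil m F) : F = 0 := by
  refine MultilinearMap.ext fun x => M.eq_zero_of_mem_fil fun m => ?_
  have := hF m (fun _ => 0) x (fun i => by rw [M.fil_zero]; trivial)
  rwa [Finset.sum_const_zero, zero_add] at this

theorem eq_zero_of_inFil {F : Conv O A} (hF : ∀ m, M.InFil m F) : F = 0 :=
  funext fun n => LinearMap.ext fun φ => eq_zero_of_endFil fun m => hF m n φ

theorem signed_sub {n : ℕ} (s : (Fin n → ZMod 2) → ℤˣ)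
    (F G : MultilinearMap k (fun _ : Fin n => A) A) :
    M.signed s (F - G) = M.signed s F - M.signed s G := by
  refine M.multilinear_ext fun c x hx => ?_
  rw [sub_apply, M.signed_apply s _ c x hx, M.signed_apply s _ c x hx, M.signed_apply s _ c x hx,
    sub_apply, smul_sub]

theorem endAct_sub {n : ℕ} (σ : Equiv.Perm (Fin n))
    (F G : MultilinearMap k (fun _ : Fin n => A) A) :
    M.endAct σ (F - G) = M.endAct σ F - M.endAct σ G := by
  rw [endAct_eq_signed, endAct_eq_signed, endAct_eq_signed, ← signed_sub]
  rfl

theorem endFil_endAct {n m : ℕ} (σ : Equiv.Perm (Fin n))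
    {F : MultilinearMap k (fun _ : Fin n => A) A} (hF : M.endFil m F) :
    M.endFil m (M.endAct σ F) := by
  rw [endAct_eq_signed]
  refine M.signed_endFil _ fun l x hx => ?_
  rw [MultilinearMap.domDomCongr_apply, ← Equiv.sum_comp σ l]
  exact hF _ _ fun i => hx (σ i)

theorem isHom_zero (p : ℤ) : M.IsHom p (0 : Conv O A) where
  equivariant n σ φ := by
    have := endAct_sub (M := M) σ 0 0
    rw [sub_self, sub_self] at this
    exact this.symm
  filtered n φ := M.endFil_zero
  degree n j φ _ _ _ _ := zero_mem _

theorem IsHom.sub {p : ℤ} {F G : Conv O A} (hF : M.IsHom p F) (hG : M.IsHom p G) :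
    M.IsHom p (F - G) where
  equivariant n σ φ := by
    change F n _ - G n _ = M.endAct σ (F n φ - G n φ)
    rw [hF.equivariant, hG.equivariant, endAct_sub]
  filtered n φ l x hx := sub_mem (hF.filtered n φ l x hx) (hG.filtered n φ l x hx)
  degree n j φ hφ p x hx := sub_mem (hF.degree n j φ hφ p x hx) (hG.degree n j φ hφ p x hx)

theorem IsHom.smul (c : k) {p : ℤ} {F : Conv O A} (hF : M.IsHom p F) : M.IsHom p (c • F) where
  equivariant n σ φ := by
    change c • F n _ = M.endAct σ (c • F n φ)
    rw [hF.equivariant]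
    refine M.multilinear_ext fun e x hx => ?_
    rw [smul_apply, endAct_eq_signed, endAct_eq_signed, M.signed_apply _ _ e x hx,
      M.signed_apply _ _ e x hx, smul_comm]
    rfl
  filtered n φ := M.endFil_smul c (hF.filtered n φ)
  degree n j φ hφ p x hx := Submodule.smul_mem _ _ (hF.degree n j φ hφ p x hx)

theorem IsHom.add {p : ℤ} {F G : Conv O A} (hF : M.IsHom p F) (hG : M.IsHom p G) :
    M.IsHom p (F + G) := by
  have := hF.sub (hG.smul (-1 : k))
  rwa [neg_one_smul k G, sub_neg_eq_add] at this

theorem IsHom.inFil_zero {p : ℤ} {F : Conv O A} (hF : M.IsHom p F) : M.InFil 0 F := hF.filtered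

theorem inFil_sub_of_le {s : ℕ → Conv O A} (h : ∀ m, M.InFil m (s (m + 1) - s m)) {m m' : ℕ}
    (hm : m ≤ m') : M.InFil m (s m' - s m) := by
  induction m', hm using Nat.le_induction with
  | base =>
    rw [sub_self]
    exact CompleteGradedModule.inFil_zero
  | succ m' hm ih =>
    rw [← sub_add_sub_cancel]
    exact ((h m').mono hm).add ih

/-- Completeness is available in one degree at a time. Decomposing the form and the arguments into
homogeneous parts leaves a finite sum of sequences, each in a single degree. -/
theorem exists_isLim (hO : ∀ n (φ : O.grDual n),
      φ ∈ Submodule.span k {ψ : O.grDual n | ∃ j, O.DualDeg j ψ}) {p : ℤ} {s : ℕ → Conv O A}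
    (hs : ∀ m, M.IsHom p (s m)) (h : ∀ m, M.InFil m (s (m + 1) - s m)) (n : ℕ) (φ : O.grDual n)
    (x : Fin n → A) : ∃ y, M.IsLim (fun m => s m n φ x) y := by
  classical
  induction hO n φ using Submodule.span_induction with
  | zero => exact ⟨0, fun m => by
    change s m n 0 x - 0 ∈ _
    rw [map_zero, sub_zero]
    exact zero_mem _⟩
  | add φ ψ _ _ hφ hψ =>
    obtain ⟨y, hy⟩ := hφ
    obtain ⟨y', hy'⟩ := hψ
    exact ⟨y + y', fun m => by
      change s m n (φ + ψ) x - _ ∈ _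
      rw [map_add]
      exact hy.add hy' m⟩
  | smul c φ _ hφ =>
    obtain ⟨y, hy⟩ := hφ
    exact ⟨c • y, fun m => by
      change s m n (c • φ) x - _ ∈ _
      rw [map_smul]
      exact hy.smul c m⟩
  | mem φ hφ =>
    obtain ⟨j, hφ⟩ := hφ
    have hx : x = fun i => ∑ q ∈ (DirectSum.decompose M.deg (x i)).support,
        (DirectSum.decompose M.deg (x i) q : A) :=
      funext fun i => (DirectSum.sum_support_decompose M.deg (x i)).symm
    have hsum : ∀ m, s m n φ x = ∑ r ∈ Fintype.piFinset
        (fun i => (DirectSum.decompose M.deg (x i)).support),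
          s m n φ fun i => (DirectSum.decompose M.deg (x i) (r i) : A) := by
      intro m
      conv_lhs => rw [hx]
      exact (s m n φ).map_sum_finset (fun i q => (DirectSum.decompose M.deg (x i) q : A)) _
    simp only [hsum]
    refine isLim_sum _ fun r _ => ?_
    obtain ⟨y, ⟨-, hy⟩, -⟩ := M.complete (∑ i, r i + (j + p))
      (fun m => s m n φ fun i => (DirectSum.decompose M.deg (x i) (r i) : A))
      (fun m => (hs m).degree n j φ hφ r _ fun i => Subtype.mem _) (fun m => by
        have := h m n φ (fun _ => 0) (fun i => (DirectSum.decompose M.deg (x i) (r i) : A))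
          (fun i => by rw [M.fil_zero]; trivial)
        rwa [Finset.sum_const_zero, zero_add] at this)
    exact ⟨y, hy⟩

/-- Pointwise limits are assembled into a map; multilinearity follows from uniqueness of limits, and
equivariance because the defect lies in all steps of the filtration. -/
theorem exists_limit (hO : ∀ n (φ : O.grDual n),
      φ ∈ Submodule.span k {ψ : O.grDual n | ∃ j, O.DualDeg j ψ}) {p : ℤ} {s : ℕ → Conv O A}
    (hs : ∀ m, M.IsHom p (s m)) (h : ∀ m, M.InFil m (s (m + 1) - s m)) :
    ∃ β, M.IsHom p β ∧ ∀ m, M.InFil m (β - s m) := by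
  choose y hy using exists_isLim hO hs h
  let β : Conv O A := fun n =>
    { toFun := fun φ =>
        { toFun := fun x => y n φ x
          map_update_add' := fun x i b c => (hy n φ _).unique (by
            simpa only [MultilinearMap.map_update_add] using (hy n φ _).add (hy n φ _))
          map_update_smul' := fun x i c b => (hy n φ _).unique (by
            simpa only [MultilinearMap.map_update_smul] using (hy n φ _).smul c) }
      map_add' := fun φ ψ => MultilinearMap.ext fun x => (hy n _ x).unique fun m => by
        change s m n (φ + ψ) x - _ ∈ _
        rw [map_add]
        exact (hy n φ x).add (hy n ψ x) m
      map_smul' := fun c φ => MultilinearMap.ext fun x => (hy n _ x).unique fun m => by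
        change s m n (c • φ) x - _ ∈ _
        rw [map_smul]
        exact (hy n φ x).smul c m }
  have hβ : ∀ n φ x, M.IsLim (fun m => s m n φ x) (β n φ x) := hy
  have hfil : ∀ m, M.InFil m (β - s m) := by
    intro m n φ l x hx
    -- On arguments of filtration `l`, the difference must lie in step `∑ l + m`. The index `∑ l +
    -- m` is where the pointwise limit is that close.
    have h1 := inFil_sub_of_le h (Nat.le_add_left m (∑ i, l i)) n φ l x hx
    have h2 := hβ n φ x (∑ i, l i + m)
    have h3 := sub_mem h1 h2
    change (s (∑ i, l i + m) n φ x - s m n φ x) - (s (∑ i, l i + m) n φ x - β n φ x) ∈ _ at h3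
    rwa [sub_sub_sub_cancel_left] at h3
  refine ⟨β, ⟨fun n σ φ => ?_, fun n φ => ?_, fun n j φ hφ q x hx => ?_⟩, hfil⟩
  · refine sub_eq_zero.1 (eq_zero_of_endFil (M := M) fun m => ?_)
    have h1 := hfil m n (O.dualAct σ φ)
    have h2 := endFil_endAct σ (hfil m n φ)
    change M.endFil m (M.endAct σ (β n φ - s m n φ)) at h2
    rw [endAct_sub, ← (hs m).equivariant] at h2
    intro l x hx
    have h3 := sub_mem (h1 l x hx) (h2 l x hx)
    change (β n (O.dualAct σ φ) x - s m n (O.dualAct σ φ) x) -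
      (M.endAct σ (β n φ) x - s m n (O.dualAct σ φ) x) ∈ _ at h3
    rwa [sub_sub_sub_cancel_right] at h3
  · have := (hfil 0).add (hs 0).inFil_zero
    rw [sub_add_cancel] at this
    exact this n φ
  · obtain ⟨y', ⟨hy', hy''⟩, -⟩ := M.complete (∑ i, q i + (j + p)) (fun m => s m n φ x)
      (fun m => (hs m).degree n j φ hφ q _ hx) (fun m => by
        have := h m n φ (fun _ => 0) x (fun i => by rw [M.fil_zero]; trivial)
        rwa [Finset.sum_const_zero, zero_add] at this)
    rw [(hβ n φ x).unique hy'']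
    exact hy'

end CompleteGradedModule

/-! ## Exponentials of derivations -/

theorem inv_factorial_smul_iterate {k : Type u} [Field k] [CharZero k] {V : Type*}
    [AddCommGroup V] [Module k V] (D : V →ₗ[k] V) (x : V) (n : ℕ) :
    D (((n.factorial : k)⁻¹) • (D ^ n) x) =
      (n + 1 : k) • (((n + 1).factorial : k)⁻¹) • (D ^ (n + 1)) x := by
  rw [map_smul, smul_smul, pow_succ', Module.End.mul_apply, Nat.factorial_succ]
  congr 1
  have : (n + 1 : k) ≠ 0 := Nat.cast_add_one_ne_zero n
  have : (n.factorial : k) ≠ 0 := Nat.cast_ne_zero.2 (Nat.factorial_ne_zero n)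
  push_cast
  field_simp

/-- Leibniz for divided powers, `D^n/n! B(x, y) = ∑ B(D^i x/i!, D^j y/j!)`. Only the rule on
iterates is assumed: the contraction obeys it for equivariant left factors, not for all collections
of maps. -/
theorem inv_factorial_smul_iterate_bilinear {k : Type u} [Field k] [CharZero k] {V : Type*}
    [AddCommGroup V] [Module k V] (B : V →ₗ[k] V →ₗ[k] V) (D : V →ₗ[k] V) (x y : V)
    (h : ∀ i j : ℕ, D (B ((D ^ i) x) ((D ^ j) y)) =
      B ((D ^ (i + 1)) x) ((D ^ j) y) + B ((D ^ i) x) ((D ^ (j + 1)) y)) (n : ℕ) :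
    ((n.factorial : k)⁻¹) • (D ^ n) (B x y) = ∑ ij ∈ Finset.HasAntidiagonal.antidiagonal n,
      B (((ij.1.factorial : k)⁻¹) • (D ^ ij.1) x) (((ij.2.factorial : k)⁻¹) • (D ^ ij.2) y) := by
  have h' : ∀ i j : ℕ, D (B (((i.factorial : k)⁻¹) • (D ^ i) x) (((j.factorial : k)⁻¹) • (D ^ j) y)) =
      (i + 1 : k) • B ((((i + 1).factorial : k)⁻¹) • (D ^ (i + 1)) x)
        (((j.factorial : k)⁻¹) • (D ^ j) y) +
      (j + 1 : k) • B (((i.factorial : k)⁻¹) • (D ^ i) x)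
        ((((j + 1).factorial : k)⁻¹) • (D ^ (j + 1)) y) := by
    intro i j
    rw [← LinearMap.map_smul₂, ← map_smul (B _), ← inv_factorial_smul_iterate,
      ← inv_factorial_smul_iterate]
    simp only [map_smul, LinearMap.smul_apply, h, smul_add, pow_succ', Module.End.mul_apply]
  induction n with
  | zero => simp
  | succ n ih =>
    have hn : (n + 1 : k) ≠ 0 := Nat.cast_add_one_ne_zero n
    refine smul_right_injective V hn ?_
    change (n + 1 : k) • _ = (n + 1 : k) • _
    rw [← inv_factorial_smul_iterate, ih, map_sum, Finset.sum_congr rfl fun ij _ => h' ij.1 ij.2,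
      Finset.sum_add_distrib, Finset.smul_sum]
    let b : ℕ × ℕ → V := fun ij => B (((ij.1.factorial : k)⁻¹) • (D ^ ij.1) x)
      (((ij.2.factorial : k)⁻¹) • (D ^ ij.2) y)
    have h1 : ∑ ij ∈ Finset.HasAntidiagonal.antidiagonal n, (ij.1 + 1 : k) • b (ij.1 + 1, ij.2) =
        ∑ ij ∈ Finset.HasAntidiagonal.antidiagonal (n + 1), (ij.1 : k) • b ij := by
      rw [Finset.Nat.sum_antidiagonal_succ]
      simp
    have h2 : ∑ ij ∈ Finset.HasAntidiagonal.antidiagonal n, (ij.2 + 1 : k) • b (ij.1, ij.2 + 1) =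
        ∑ ij ∈ Finset.HasAntidiagonal.antidiagonal (n + 1), (ij.2 : k) • b ij := by
      rw [Finset.Nat.sum_antidiagonal_succ']
      simp
    refine (congrArg₂ (· + ·) h1 h2).trans ?_
    rw [← Finset.sum_add_distrib]
    refine Finset.sum_congr rfl fun ij hij => ?_
    rw [← add_smul]
    congr 1
    exact_mod_cast Finset.HasAntidiagonal.mem_antidiagonal.1 hij

end OperadTwist
end

noncomputable section

namespace OperadTwist

/-! ## Exponentials of the contraction -/

namespace CompleteGradedModule

variable {k : Type u} [Field k] {A : Type w} [AddCommGroup A] [Module k A]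
  {M : CompleteGradedModule k A} {Q : Presentation.{u, v} k} {u : Q.operad.obj (Fin 0)}
  (hw : u ∈ Q.operad.wt (Fin 0) (-1)) {a : A}

variable (a) in
/-- The terms of the exponential series of `-contract`. -/
def expTerm (α : Conv Q.operad A) (n : ℕ) : Conv Q.operad A :=
  ((n.factorial : k)⁻¹) • ((-contract hw a) ^ n) α

theorem neg_contract_pow_isHom (ha : a ∈ M.deg 0) (hu : u ∈ Q.operad.deg (Fin 0) 0) {p : ℤ}
    {α : Conv Q.operad A} (hα : M.IsHom p α) (n : ℕ) :
    M.IsHom p (((-contract hw a) ^ n) α) := by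
  induction n with
  | zero => exact hα
  | succ n ih =>
    rw [pow_succ', Module.End.mul_apply, LinearMap.neg_apply, ← neg_one_smul k]
    exact (contract_isHom M hw ha hu ih).smul _

theorem neg_contract_pow_inFil (ha : a ∈ M.fil 1) {α : Conv Q.operad A} (hα : M.InFil 0 α)
    (n : ℕ) : M.InFil n (((-contract hw a) ^ n) α) := by
  induction n with
  | zero => exact hα
  | succ n ih =>
    rw [pow_succ', Module.End.mul_apply, LinearMap.neg_apply]
    exact (contract_inFil M hw ha ih).neg

theorem boundary_inFil {O : GradedOperad.{u, v} k} (d : OperadDerivation O) (p : ℤ) {m : ℕ}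
    {F : Conv O A} (hF : M.InFil m F) : M.InFil m (boundary d p F) := fun n φ => by
  have := M.endFil_units_smul p.negOnePow (hF n (O.dualDiff d n φ))
  exact fun l x hx => neg_mem (this l x hx)

/-- The boundary as a linear map. -/
def boundaryL {O : GradedOperad.{u, v} k} (d : OperadDerivation O) (p : ℤ) :
    Conv O A →ₗ[k] Conv O A where
  toFun := boundary d p
  map_add' F G := funext fun n => by
    rw [Pi.add_apply, boundary, boundary, boundary, Pi.add_apply, LinearMap.add_comp, smul_add,
      neg_add]
  map_smul' c F := funext fun n => by
    rw [Pi.smul_apply, boundary, boundary, Pi.smul_apply, LinearMap.smul_comp, smul_comm, smul_neg]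
    rfl

/-- The `n`-th divided power of minus the contraction, applied to `∂ α = -α ⋆ α`: it commutes with
`∂` and expands the product by the Leibniz rule. -/
theorem boundary_expTerm [CharZero k] (ha : M.proj 0 a = a) (ha' : a ∈ M.deg 0) (hO : Q.operad.LocallyFinite)
    (hu : u ∈ Q.operad.deg (Fin 0) 0) {d : OperadDerivation Q.operad}
    (hd : d.toFun (Fin 0) u = 0) {α : Conv Q.operad A} (hα : M.IsMC d α) (n : ℕ) :
    boundary d (-1) (expTerm hw a α n) = -∑ ij ∈ Finset.HasAntidiagonal.antidiagonal n,
      M.star (-1) (-1) (expTerm hw a α ij.1) (expTerm hw a α ij.2) := by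
  have hb : ∀ n, boundary d (-1) (((-contract hw a) ^ n) α) =
      ((-contract hw a) ^ n) (boundary d (-1) α) := by
    intro n
    induction n with
    | zero => rfl
    | succ n ih =>
      rw [pow_succ', Module.End.mul_apply, Module.End.mul_apply, ← ih, LinearMap.neg_apply,
        LinearMap.neg_apply, contract_boundary hw d hd]
      exact map_neg (boundaryL d (-1)) _
  have h := inv_factorial_smul_iterate_bilinear (M.starL (-1) (-1)) (-contract hw a) α α (by
    intro i j
    rw [pow_succ', pow_succ', Module.End.mul_apply, Module.End.mul_apply, LinearMap.neg_apply,
      LinearMap.neg_apply, LinearMap.neg_apply, map_neg, map_neg, LinearMap.neg_apply, ← neg_add]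
    exact congrArg _ (contract_star M hw ha hO hu _ _ _ _
      (neg_contract_pow_isHom hw ha' hu hα.hom i).equivariant)) n
  refine Eq.trans ?_ (congrArg _ h)
  rw [← smul_neg, ← map_neg, starL_apply, ← eq_neg_of_add_eq_zero_left hα.eq, ← hb]
  exact map_smul (boundaryL d (-1)) _ _

/-- The Maurer–Cartan defect of the limit lies in `F_m` for all `m`: replacing `β` by the partial
sum `s` costs terms in `F_m`, and so is the defect of `s`. Separatedness concludes. -/
theorem exists_exp [CharZero k] (hQ : Q.IsHomogeneous) (ha : a ∈ M.deg 0) (ha' : a ∈ M.fil 1)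
    (hO : Q.operad.LocallyFinite) (hu : u ∈ Q.operad.deg (Fin 0) 0)
    {d : OperadDerivation Q.operad} (hd : d.toFun (Fin 0) u = 0) {α : Conv Q.operad A}
    (hα : M.IsMC d α) : ∃ β, M.IsMC d β ∧
      ∀ m, M.InFil m (β - ∑ n ∈ Finset.range m, expTerm hw a α n) := by
  have ha0 : M.proj 0 a = a := by
    rw [M.proj_of_mem ha]
    simp
  have hfil : ∀ n, M.InFil n (expTerm hw a α n) := fun n =>
    (neg_contract_pow_inFil hw ha' hα.hom.inFil_zero n).smul _
  have hs : ∀ m, M.IsHom (-1) (∑ n ∈ Finset.range m, expTerm hw a α n) := fun m =>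
    Finset.sum_induction _ (M.IsHom (-1)) (fun _ _ => IsHom.add) (isHom_zero _) fun n _ =>
      (neg_contract_pow_isHom hw ha hu hα.hom n).smul _
  obtain ⟨β, hβ, hlim⟩ := exists_limit (fun n φ => Presentation.grDual_mem_span hQ hO n φ) hs
    fun m => by
      rw [Finset.sum_range_succ, add_sub_cancel_left]
      exact hfil m
  refine ⟨β, ⟨hβ, eq_zero_of_inFil (M := M) fun m => ?_⟩, hlim⟩
  let s := ∑ n ∈ Finset.range m, expTerm hw a α n
  have h1 : boundary d (-1) β + M.star (-1) (-1) β β =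
      boundary d (-1) (β - s) + (M.star (-1) (-1) (β - s) β + M.star (-1) (-1) s (β - s)) +
        (boundary d (-1) s + M.star (-1) (-1) s s) := by
    rw [← starL_apply, ← starL_apply, ← starL_apply, ← starL_apply]
    change boundaryL d (-1) β + _ = boundaryL d (-1) (β - s) + _ + (boundaryL d (-1) s + _)
    simp only [map_sub, LinearMap.sub_apply]
    abel
  -- The boundary of the partial sum cancels all products with `i + j < m`. The remaining ones have
  -- `i + j ≥ m` and lie in `F_m`.
  have h2 : boundary d (-1) s + M.star (-1) (-1) s s =
      ∑ ij ∈ (Finset.range m ×ˢ Finset.range m).filter (fun ij => m ≤ ij.1 + ij.2),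
        M.star (-1) (-1) (expTerm hw a α ij.1) (expTerm hw a α ij.2) := by
    have h3 : boundary d (-1) s = -∑ ij ∈ (Finset.range m ×ˢ Finset.range m).filter
        (fun ij => ¬ m ≤ ij.1 + ij.2),
          M.star (-1) (-1) (expTerm hw a α ij.1) (expTerm hw a α ij.2) := by
      refine (map_sum (boundaryL d (-1)) _ _).trans ((Finset.sum_congr rfl fun n _ =>
        boundary_expTerm hw ha0 ha hO hu hd hα n).trans ?_)
      rw [Finset.sum_neg_distrib, ← Finset.sum_fiberwise_of_maps_to (t := Finset.range m)
        (g := fun ij : ℕ × ℕ => ij.1 + ij.2) fun ij hij =>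
          Finset.mem_range.2 (not_le.1 (Finset.mem_filter.1 hij).2)]
      refine congrArg _ (Finset.sum_congr rfl fun n hn => Finset.sum_congr ?_ fun _ _ => rfl)
      ext ij
      rw [Finset.mem_range] at hn
      simp only [Finset.HasAntidiagonal.mem_antidiagonal, Finset.mem_filter, Finset.mem_product,
        Finset.mem_range]
      omega
    have h4 : M.star (-1) (-1) s s = ∑ ij ∈ Finset.range m ×ˢ Finset.range m,
        M.star (-1) (-1) (expTerm hw a α ij.1) (expTerm hw a α ij.2) := by
      rw [Finset.sum_product]
      exact (LinearMap.map_sum₂ (M.starL (-1) (-1)) _ _ _).trans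
        (Finset.sum_congr rfl fun i _ => map_sum _ _ _)
    rw [h3, h4, ← Finset.sum_filter_add_sum_filter_not (Finset.range m ×ˢ Finset.range m)
      (fun ij : ℕ × ℕ => m ≤ ij.1 + ij.2), neg_add_cancel_comm_assoc]
  rw [h1, h2]
  refine ((boundary_inFil d _ (hlim m)).add (InFil.add ?_ ?_)).add (inFil_sum _ fun ij hij => ?_)
  · exact M.star_inFil (hlim m) hβ.inFil_zero
  · have := M.star_inFil (p := -1) (q := -1) (hs m).inFil_zero (hlim m)
    rwa [zero_add] at this
  · exact (M.star_inFil (hfil _) (hfil _)).mono (Finset.mem_filter.1 hij).2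

/-- `ad_a` is minus the contraction, and `∂ a = 0` because `d u = 0`; so the second series of the
gauge action disappears. -/
theorem gaugeTerm_eq {d : OperadDerivation Q.operad} (hd : d.toFun (Fin 0) u = 0)
    {F : Conv Q.operad A} (hF : ∀ n, F (n + 1) = 0) (uStar : Q.operad.grDual 0)
    (hu : ∀ y, y = (uStar : Module.Dual k (Q.operad.obj (Fin 0))) y • u)
    (hF0 : ∀ φ : Q.operad.grDual 0, F 0 φ = (φ : Module.Dual k (Q.operad.obj (Fin 0))) u •
      MultilinearMap.constOfIsEmpty k (fun _ : Fin 0 => A) a)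
    (hu1 : (uStar : Module.Dual k (Q.operad.obj (Fin 0))) u = 1) (α : Conv Q.operad A) (n : ℕ) :
    M.gaugeTerm d F α n = expTerm hw a α n := by
  have had : M.ad 0 (-1) F = ⇑(-contract hw a) := by
    funext G
    rw [ad, M.star_arityZero_left _ _ hF, M.star_arityZero_right hw (-1) G hF uStar hu (by
      rw [hF0, hu1, one_smul]), zero_mul, Int.negOnePow_zero, one_smul, zero_sub]
    rfl
  have hb : boundary d 0 F = 0 := by
    funext n
    refine LinearMap.ext fun φ => ?_
    rw [boundary, Int.negOnePow_zero, one_smul]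
    cases n with
    | zero =>
      rw [LinearMap.neg_apply, LinearMap.comp_apply, hF0]
      change -((φ : Module.Dual k (Q.operad.obj (Fin 0))) (d.toFun (Fin 0) u) • _) = _
      rw [hd, map_zero, zero_smul, neg_zero]
      rfl
    | succ n =>
      rw [hF, LinearMap.zero_comp, neg_zero]
      rfl
  rw [gaugeTerm, hb, had, expTerm, ← Module.End.pow_apply, ← Module.End.pow_apply, map_zero,
    smul_zero, sub_zero]

theorem isGauge_of_limit {d : OperadDerivation Q.operad} {F α β : Conv Q.operad A}
    (h : ∀ m, M.InFil m (β - ∑ n ∈ Finset.range m, M.gaugeTerm d F α n)) : M.IsGauge d F α β :=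
  fun m => ⟨m, fun l hl => (h l).mono hl⟩

theorem IsGauge.unique {d : OperadDerivation Q.operad} {F α β β' : Conv Q.operad A}
    (h : M.IsGauge d F α β) (h' : M.IsGauge d F α β') : β' = β := by
  refine sub_eq_zero.1 (eq_zero_of_inFil (M := M) fun m => ?_)
  obtain ⟨N, hN⟩ := h m
  obtain ⟨N', hN'⟩ := h' m
  have := (hN' _ (le_max_right N N')).sub (hN _ (le_max_left N N'))
  rwa [sub_sub_sub_cancel_right] at this

end CompleteGradedModule

end OperadTwist
end

noncomputable section

namespace OperadTwist

/-! ## Restriction along the canonical map -/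

namespace QuadraticLinearData

variable {k : Type u} [Field k] (D : QuadraticLinearData.{u, v} k)
  (χ : D.E.koszulDual.obj 2 0 →ₗ[k] k) {A : Type w} [AddCommGroup A] [Module k A]

theorem res_apply {n : ℕ} (φ : (D.unitalDual χ).grDual n) (x : D.koszulDualOperad.obj (Fin n)) :
    (D.res χ n φ : Module.Dual k (D.koszulDualOperad.obj (Fin n))) x =
      (φ : Module.Dual k ((D.unitalDual χ).obj (Fin n))) (D.toUnitalDual χ (Fin n) x) := rfl

theorem degree_opMono {I : Type} (a : Mono D.dualPres.X I) :
    (D.opMono χ a).degree (D.uPres χ).dg = a.degree D.dualPres.dg := by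
  induction a with
  | one => rfl
  | gen x => rfl
  | map σ a ih => exact ih
  | comp a b iha ihb => exact congrArg₂ (· + ·) iha ihb

theorem u_mem_wt : D.u χ ∈ (D.unitalDual χ).wt (Fin 0) (-1) := (D.uPres χ).mon_mem_wt (.gen .u)

theorem toUnitalDual_mem_deg {I : Type} {p : ℤ} {x : D.koszulDualOperad.obj I}
    (hx : x ∈ D.koszulDualOperad.deg I p) : D.toUnitalDual χ I x ∈ (D.unitalDual χ).deg I p := by
  change x ∈ D.dualPres.operad.deg I p at hx
  induction hx using Presentation.deg_induction with
  | hm a h =>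
    rw [D.toUnitalDual_mon, ← h, ← D.degree_opMono χ]
    exact (D.uPres χ).mon_mem_deg _
  | h0 =>
    rw [map_zero]
    exact zero_mem _
  | ha x y _ _ hx hy =>
    rw [map_add]
    exact add_mem hx hy
  | hs c x _ hx =>
    rw [map_smul]
    exact Submodule.smul_mem _ _ hx

theorem res_dualAct {n : ℕ} (σ : Equiv.Perm (Fin n)) (φ : (D.unitalDual χ).grDual n) :
    D.res χ n ((D.unitalDual χ).dualAct σ φ) = D.koszulDualOperad.dualAct σ (D.res χ n φ) :=
  Subtype.ext (LinearMap.ext fun x =>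
    congrArg (φ : Module.Dual k ((D.unitalDual χ).obj (Fin n))) (D.toUnitalDual_map χ _ x).symm)

theorem dualDeg_res {n : ℕ} {j : ℤ} {φ : (D.unitalDual χ).grDual n}
    (hφ : (D.unitalDual χ).DualDeg j φ) : D.koszulDualOperad.DualDeg j (D.res χ n φ) :=
  fun q hq _ hx => hφ q hq _ (D.toUnitalDual_mem_deg χ hx)

theorem graftE_toUnitalDual {m j n : ℕ} (e : Fin m ⊕ Fin j ≃ Fin n)
    (x : D.koszulDualOperad.obj (Fin (m + 1))) (y : D.koszulDualOperad.obj (Fin j)) :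
    D.toUnitalDual χ _ (D.koszulDualOperad.graftE e x y) =
      (D.unitalDual χ).graftE e (D.toUnitalDual χ _ x) (D.toUnitalDual χ _ y) := by
  rw [GradedOperad.graftE_apply, GradedOperad.graftE_apply, toUnitalDual_map, toUnitalDual_comp,
    toUnitalDual_map]

variable {D} in
-- Restriction is a morphism of cooperads, being the transpose of a morphism of operads. This makes
-- the inclusion of convolution algebras compatible with `⋆`.
theorem ArityFinite.decompE_res (hD : D.ArityFinite) {m j n : ℕ} (e : Fin m ⊕ Fin j ≃ Fin n)
    (φ : (D.unitalDual χ).grDual n) : D.koszulDualOperad.decompE e (D.res χ n φ) =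
      TensorProduct.map (D.res χ (m + 1)) (D.res χ j) ((D.unitalDual χ).decompE e φ) := by
  refine GradedOperad.decompE_eq _ _ _ fun x y => ?_
  rw [res_apply, graftE_toUnitalDual, ← (hD.locallyFinite_unitalDual χ).dualEval_decompE]
  induction (D.unitalDual χ).decompE e φ using TensorProduct.induction_on with
  | zero => simp only [map_zero, LinearMap.zero_apply]
  | tmul ψ ω => rfl
  | add t t' ht ht' => simp only [map_add, LinearMap.add_apply, ht, ht']

variable {D} in
theorem ArityFinite.star_extend (hD : D.ArityFinite) (M : CompleteGradedModule k A) (p q : ℤ)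
    (f g : Conv D.koszulDualOperad A) :
    M.star p q (D.extend χ f) (D.extend χ g) = D.extend χ (M.star p q f g) := by
  funext n
  refine LinearMap.ext fun φ => ?_
  change M.star p q (D.extend χ f) (D.extend χ g) n φ = M.star p q f g n (D.res χ n φ)
  rw [M.star_eq, M.star_eq, LinearMap.sum_apply, LinearMap.sum_apply]
  refine Finset.sum_congr rfl fun S _ => ?_
  change TensorProduct.lift _ (TensorProduct.map _ _ ((D.unitalDual χ).decompE _ φ)) =
    TensorProduct.lift _ (TensorProduct.map _ _ (D.koszulDualOperad.decompE _ (D.res χ n φ)))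
  rw [hD.decompE_res]
  refine congrArg _ ?_
  induction (D.unitalDual χ).decompE ((Equiv.sumComm _ _).trans (finSumEquivOfFinset
    (s := S) rfl rfl)) φ using TensorProduct.induction_on with
  | zero => simp only [map_zero]
  | tmul ψ ω => rfl
  | add t t' ht ht' => simp only [map_add, ht, ht']

theorem boundary_extend (d : OperadDerivation D.koszulDualOperad)
    (d' : OperadDerivation (D.unitalDual χ))
    (hd' : ∀ n (x : D.koszulDualOperad.obj (Fin n)),
      d'.toFun (Fin n) (D.toUnitalDual χ (Fin n) x) =
        D.toUnitalDual χ (Fin n) (d.toFun (Fin n) x)) (p : ℤ) (f : Conv D.koszulDualOperad A) :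
    CompleteGradedModule.boundary d' p (D.extend χ f) =
      D.extend χ (CompleteGradedModule.boundary d p f) := by
  funext n
  refine LinearMap.ext fun φ => ?_
  change -(p.negOnePow • f n (D.res χ n ((D.unitalDual χ).dualDiff d' n φ))) =
    -(p.negOnePow • f n (D.koszulDualOperad.dualDiff d n (D.res χ n φ)))
  have : D.res χ n ((D.unitalDual χ).dualDiff d' n φ) =
      D.koszulDualOperad.dualDiff d n (D.res χ n φ) :=
    Subtype.ext (LinearMap.ext fun x =>
      congrArg (φ : Module.Dual k ((D.unitalDual χ).obj (Fin n))) (hd' n x))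
  rw [this]

/-! ### The image of the inclusion of convolution algebras. -/

variable {D}

/-- In positive arity the canonical map is bijective and its inverse respects degree and weight, so
forms extend. In arity zero the forms on `P^!` are zero. -/
theorem ArityFinite.exists_res (hD : D.ArityFinite)
    (hinj : ∀ n, Function.Injective (D.toUnitalDual χ (Fin n))) (n : ℕ)
    (ψ : D.koszulDualOperad.grDual n) : ∃ φ, D.res χ n φ = ψ ∧
      ∀ j, D.koszulDualOperad.DualDeg j ψ → (D.unitalDual χ).DualDeg j φ := by
  cases n with
  | zero =>
    have := hD.subsingleton (I := Fin 0) inferInstance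
    refine ⟨0, Subtype.ext (LinearMap.ext fun x => ?_), fun j _ q _ x _ => rfl⟩
    rw [Subsingleton.elim x 0, map_zero, map_zero]
  | succ n =>
    obtain ⟨ψ, N, hN⟩ := ψ
    let e := LinearEquiv.ofBijective (D.toUnitalDual χ (Fin (n + 1)))
      ⟨hinj _, D.toUnitalDual_surjective χ _⟩
    have he : ∀ x, e.symm (D.toUnitalDual χ (Fin (n + 1)) x) = x := e.symm_apply_apply
    refine ⟨⟨ψ.comp e.symm.toLinearMap, N, fun q hq x hx => ?_⟩,
      Subtype.ext (LinearMap.ext fun x => ?_), fun j hj q hq x hx => ?_⟩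
    · obtain ⟨y, hy, rfl⟩ := D.exists_toUnitalDual_of_mem_wt χ hx
      change ψ (e.symm _) = 0
      rw [he]
      exact hN q hq y hy
    · change ψ (e.symm _) = ψ x
      rw [he]
    · obtain ⟨y, hy, rfl⟩ := D.exists_toUnitalDual_of_mem_deg χ hx
      change ψ (e.symm _) = 0
      rw [he]
      exact hj q hq y hy

theorem res_injective (n : ℕ) : Function.Injective (D.res χ (n + 1)) := by
  intro φ φ' h
  refine Subtype.ext (LinearMap.ext fun x => ?_)
  obtain ⟨y, rfl⟩ := D.toUnitalDual_surjective χ _ x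
  exact congrArg (fun ψ : D.koszulDualOperad.grDual (n + 1) =>
    (ψ : Module.Dual k (D.koszulDualOperad.obj (Fin (n + 1)))) y) h

variable {χ}

theorem ArityFinite.extend_injective (hD : D.ArityFinite)
    (hinj : ∀ n, Function.Injective (D.toUnitalDual χ (Fin n))) {f g : Conv D.koszulDualOperad A}
    (h : D.extend χ f = D.extend χ g) : f = g := by
  funext n
  refine LinearMap.ext fun ψ => ?_
  obtain ⟨φ, rfl, -⟩ := hD.exists_res χ hinj n ψ
  exact LinearMap.congr_fun (congrFun h n) φ

/-- In positive arities restriction of forms is injective, so `β` factors through it; in arity zero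
there is nothing to factor. -/
theorem exists_extend {β : Conv (D.unitalDual χ) A} (hβ : β 0 = 0) : ∃ β₀, D.extend χ β₀ = β := by
  refine ⟨fun n => (β n).comp (GradedOperad.leftInv (D.res χ n)), funext fun n => ?_⟩
  refine LinearMap.ext fun φ => ?_
  cases n with
  | zero =>
    change β 0 _ = β 0 φ
    rw [hβ]
    rfl
  | succ n => exact congrArg (β (n + 1)) (GradedOperad.leftInv_apply _ (res_injective χ n) φ)

theorem ArityFinite.isHom_extend_iff (hD : D.ArityFinite)
    (hinj : ∀ n, Function.Injective (D.toUnitalDual χ (Fin n))) (M : CompleteGradedModule k A)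
    (p : ℤ) (f : Conv D.koszulDualOperad A) : M.IsHom p (D.extend χ f) ↔ M.IsHom p f := by
  constructor
  · intro h
    refine ⟨fun n σ ψ => ?_, fun n ψ => ?_, fun n j ψ hψ => ?_⟩
    · obtain ⟨φ, rfl, -⟩ := hD.exists_res χ hinj n ψ
      rw [← res_dualAct]
      exact h.equivariant n σ φ
    · obtain ⟨φ, rfl, -⟩ := hD.exists_res χ hinj n ψ
      exact h.filtered n φ
    · obtain ⟨φ, rfl, hφ⟩ := hD.exists_res χ hinj n ψ
      exact h.degree n j φ (hφ j hψ)
  · intro h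
    refine ⟨fun n σ φ => ?_, fun n φ => h.filtered n _, fun n j φ hφ =>
      h.degree n j _ (D.dualDeg_res χ hφ)⟩
    change f n _ = M.endAct σ (f n _)
    rw [res_dualAct, h.equivariant]

/-- The inclusion is injective and respects `∂` and `⋆`, so the equation can be tested on either
side. It serves twice: to transport `α` upwards, and to recognise the preimage of the gauge
transform as a Maurer–Cartan element. -/
theorem ArityFinite.isMC_extend_iff (hD : D.ArityFinite)
    (hinj : ∀ n, Function.Injective (D.toUnitalDual χ (Fin n)))
    {d : OperadDerivation D.koszulDualOperad} {d' : OperadDerivation (D.unitalDual χ)}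
    (hd' : ∀ n (x : D.koszulDualOperad.obj (Fin n)),
      d'.toFun (Fin n) (D.toUnitalDual χ (Fin n) x) =
        D.toUnitalDual χ (Fin n) (d.toFun (Fin n) x)) (M : CompleteGradedModule k A)
    (f : Conv D.koszulDualOperad A) : M.IsMC d' (D.extend χ f) ↔ M.IsMC d f := by
  have h : CompleteGradedModule.boundary d' (-1) (D.extend χ f) +
      M.star (-1) (-1) (D.extend χ f) (D.extend χ f) =
        D.extend χ (CompleteGradedModule.boundary d (-1) f + M.star (-1) (-1) f f) := by
    rw [hD.star_extend, D.boundary_extend χ d d' hd']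
    rfl
  constructor
  · rintro ⟨h1, h2⟩
    refine ⟨(hD.isHom_extend_iff hinj M _ _).1 h1, hD.extend_injective hinj ?_⟩
    rw [← h, h2]
    rfl
  · rintro ⟨h1, h2⟩
    refine ⟨(hD.isHom_extend_iff hinj M _ _).2 h1, ?_⟩
    rw [h, h2]
    rfl

/-- The derivation raises the weight `-1` of `u` to `0`, where arity zero has nothing. -/
theorem ArityFinite.derivation_u (hD : D.ArityFinite) (d' : OperadDerivation (D.unitalDual χ)) :
    d'.toFun (Fin 0) (D.u χ) = 0 :=
  hD.eq_zero_of_mem_wt χ (q := -1 + 1) (by norm_num) (d'.wt _ _ _ (D.u_mem_wt χ))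

theorem ArityFinite.exists_uStar (hD : D.ArityFinite)
    (hinj : ∀ n, Function.Injective (D.toUnitalDual χ (Fin n))) :
    ∃ uStar : (D.unitalDual χ).grDual 0,
      (uStar : Module.Dual k ((D.unitalDual χ).obj (Fin 0))) (D.u χ) = 1 := by
  obtain ⟨f, hf⟩ := Module.Projective.exists_dual_eq_one k (D.u_ne_zero χ (hinj 1))
  refine ⟨⟨f, -1, fun q hq x hx => ?_⟩, hf⟩
  rw [hD.eq_zero_of_mem_wt χ hq.ne' hx, map_zero]

end QuadraticLinearData

end OperadTwist
end

/-! ### The twisting criterion. -/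

theorem mainTheorem5 {k : Type u} [Field k] [CharZero k] (D : QuadraticLinearData.{u, v} k)
    (hD : D.ArityFinite) (χ : D.E.koszulDual.obj 2 0 →ₗ[k] k)
    (hχ : ∀ (σ : Equiv.Perm (Fin 2)) (μ : D.E.koszulDual.obj 2 0),
      χ (D.E.koszulDual.act 2 0 σ μ) = χ μ)
    (hinj : ∀ n, Function.Injective (D.toUnitalDual χ (Fin n)))
    (d : OperadDerivation D.koszulDualOperad) (hd : D.IsKoszulDifferential d)
    (d' : OperadDerivation (D.unitalDual χ))
    (hd' : ∀ n (x : D.koszulDualOperad.obj (Fin n)),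
      d'.toFun (Fin n) (D.toUnitalDual χ (Fin n) x) =
        D.toUnitalDual χ (Fin n) (d.toFun (Fin n) x))
    {A : Type w} [AddCommGroup A] [Module k A] (M : CompleteGradedModule k A)
    (α : Conv D.koszulDualOperad A) (hα : M.IsMC d α)
    (a : A) (ha : a ∈ M.deg 0) (ha' : a ∈ M.fil 1) :
    ∃ uStar : (D.unitalDual χ).grDual 0,
      (uStar : Module.Dual k ((D.unitalDual χ).obj (Fin 0))) (D.u χ) = 1 ∧
      (∀ φ : (D.unitalDual χ).grDual 0,
        φ = (φ : Module.Dual k ((D.unitalDual χ).obj (Fin 0))) (D.u χ) • uStar) ∧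
      ∃ β : Conv (D.unitalDual χ) A,
        M.IsGauge d' (D.ofArityZero χ a) (D.extend χ α) β ∧
        (∀ β' : Conv (D.unitalDual χ) A,
          M.IsGauge d' (D.ofArityZero χ a) (D.extend χ α) β' → β' = β) ∧
        M.IsMC d' β ∧
        ((∃ β₀ : Conv D.koszulDualOperad A, M.IsMC d β₀ ∧ β = D.extend χ β₀) ↔
          β 0 uStar = 0) := by
  obtain ⟨uStar, hu⟩ := hD.exists_uStar hinj
  have hspan : ∀ φ : (D.unitalDual χ).grDual 0,
      φ = (φ : Module.Dual k ((D.unitalDual χ).obj (Fin 0))) (D.u χ) • uStar := by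
    refine fun φ => Subtype.ext (LinearMap.ext fun x => ?_)
    obtain ⟨c, rfl⟩ := hD.exists_smul_u χ x
    rw [map_smul, Submodule.coe_smul, LinearMap.smul_apply, map_smul, hu, smul_eq_mul, smul_eq_mul,
      smul_eq_mul, mul_one, mul_comm]
  have huy : ∀ y, y = (uStar : Module.Dual k ((D.unitalDual χ).obj (Fin 0))) y • D.u χ := by
    intro y
    obtain ⟨c, rfl⟩ := hD.exists_smul_u χ y
    rw [map_smul, hu, smul_eq_mul, mul_one]
  have hdu := hD.derivation_u d'
  have hw := D.u_mem_wt χ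
  obtain ⟨β, hβ, hlim⟩ := CompleteGradedModule.exists_exp (Q := D.uPres χ) hw
    (D.unitalDual_isHomogeneous χ) ha ha' (hD.locallyFinite_unitalDual χ) (D.u_mem_deg χ) hdu
    ((hD.isMC_extend_iff hinj hd' M α).2 hα)
  have hgauge : M.IsGauge d' (D.ofArityZero χ a) (D.extend χ α) β := by
    refine CompleteGradedModule.isGauge_of_limit (Q := D.uPres χ) fun m => ?_
    rw [Finset.sum_congr rfl fun n _ => CompleteGradedModule.gaugeTerm_eq (Q := D.uPres χ) hw hdu
      (fun _ => rfl) uStar huy (fun _ => rfl) hu _ n]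
    exact hlim m
  refine ⟨uStar, hu, hspan, β, hgauge, fun β' hβ' =>
    CompleteGradedModule.IsGauge.unique (Q := D.uPres χ) hgauge hβ', hβ, ?_⟩
  constructor
  -- The form `u^*` restricts to zero on `P^!`, which has no nullary operations; so every element of
  -- the image vanishes on it.
  · rintro ⟨β₀, -, rfl⟩
    have := hD.subsingleton (I := Fin 0) inferInstance
    have h0 : D.res χ 0 uStar = 0 := Subtype.ext (LinearMap.ext fun x => by
      rw [Subsingleton.elim x 0, map_zero, map_zero])
    exact (congrArg (β₀ 0) h0).trans (map_zero _)
  · intro h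
    -- All forms in arity zero are multiples of `u^*`, so one value controls the whole arity zero
    -- part.
    have h0 : β 0 = 0 := LinearMap.ext fun φ => by
      rw [hspan φ, map_smul, h, smul_zero]
      rfl
    obtain ⟨β₀, rfl⟩ := QuadraticLinearData.exists_extend h0
    exact ⟨β₀, (hD.isMC_extend_iff hinj hd' M β₀).1 hβ, rfl⟩
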